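/- Let $\mathbb{K}$ be an algebraically closed field and let $A$ be a Nakayama algebra over $\mathbb{K}$, i.e. a finite dimensional $\mathbb{K}$-algebra such that every indecomposable projective and every indecomposable injective left $A$-module is uniserial. Write $A\text{-mod}$ for the category of finitely generated left $A$-modules; subcategories are full and closed under isomorphisms. We use the following notions. * A subcategory of $A\text{-mod}$ is wide if it is exact abelian (it contains $0$ and is closed under finite direct sums, kernels and cokernels) and closed under extensions; $\mathrm{wide}(A)$ is the collection of wide subcategories of $A\text{-mod}$. * For a set $\Sigma$ of maps between finitely generated projective $A$-modules, a universal localisation of $A$ at $\Sigma$ is a ring homomorphism $f\colon A\to A_\Sigma$ such that $A_\Sigma\otimes_A\sigma$ is an isomorphism for all $\sigma\in\Sigma$, and every ring homomorphism $A\to B$ such that $B\otimes_A\sigma$ is an isomorphism for all $\sigma\in\Sigma$ factors uniquely through $f$. Two ring homomorphisms $f\colon A\to B$, $g\colon A\to C$ are equivalent if $g=hf$ for some ring isomorphism $h\colon B\to C$; $\mathrm{uniloc}(A)$ is the collection of universal localisations of $A$ (at arbitrary $\Sigma$) up to equivalence. * For a finitely generated $A$-module $X$, let $P_1^X\xrightarrow{\sigma_0^X}P_0^X\to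 X\to 0$ be its minimal projective presentation. For a class $\mathcal{U}$ of finitely generated modules, $A_{\mathcal{U}}$ is the universal localisation of $A$ at $\{\sigma_0^X\mid X\in\mathcal{U}\}$. * ${}^*\mathcal{C}=\{X\in A\text{-mod}\mid \mathrm{Hom}_A(\sigma_0^X,C)\text{ is an isomorphism for all }C\in\mathcal{C}\}$ for a subcategory $\mathcal{C}$ of $A\text{-mod}$. For a set $\Sigma$ of maps between finitely generated projective modules, $\Sigma^*=\{X\in A\text{-mod}\mid \mathrm{Hom}_A(\sigma,X)\text{ is an isomorphism for all }\sigma\in\Sigma\}$, and for a class $\mathcal{U}$ of finitely generated modules, $\mathcal{U}^*=\{\sigma_0^X\mid X\in\mathcal{U}\}^*$. * For a ring homomorphism $A\to B$, $\mathcal{X}_B$ is the class of $A$-modules isomorphic to the restriction of a finitely generated left $B$-module. Then there is a bijection $$\omega\colon \mathrm{uniloc}(A)\longrightarrow \mathrm{wide}(A),\qquad A_\Sigma\longmapsto \mathcal{X}_{A_\Sigma}=\Sigma^*,$$ (where $\Sigma$ is a set of maps between finitely generated projective modules or a class of finitely generated modules), whose inverse maps a wide subcategory $\mathcal{C}$ to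 the equivalence class of $A_{{}^*\mathcal{C}}$. Moreover, a ring epimorphism $A\to B$ (an epimorphism in the category of unital rings) is a universal localisation if and only if $\mathrm{Tor}_1^A(B,B)=0$. -/

import Mathlib

open CategoryTheory CategoryTheory.Limits TensorProduct

universe u v

noncomputable section

/-! ### Modules -/

/-- An indecomposable module: nonzero, and not a direct sum of two nonzero submodules. -/
def IsIndecomposableModule (A : Type u) [Ring A] (M : Type u) [AddCommGroup M] [Module A M] :
    Prop :=
  Nontrivial M ∧ ∀ N N' : Submodule A M, IsCompl N N' → N = ⊥ ∨ N' = ⊥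

/-- A uniserial module: its submodules form a chain. -/
def IsUniserialModule (A : Type u) [Ring A] (M : Type u) [AddCommGroup M] [Module A M] : Prop :=
  ∀ N N' : Submodule A M, N ≤ N' ∨ N' ≤ N

/-- The condition on a finite dimensional algebra `A` to be a Nakayama algebra: every (finitely
generated left) indecomposable projective or indecomposable injective module is uniserial. -/
structure IsNakayama (A : Type u) [Ring A] : Prop where
  projective : ∀ (P : Type u) [AddCommGroup P] [Module A P], Module.Finite A P →
    Module.Projective A P → IsIndecomposableModule A P → IsUniserialModule A P
  injective : ∀ (Q : Type u) [AddCommGroup Q] [Module A Q], Module.Finite A Q →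
    Module.Injective A Q → IsIndecomposableModule A Q → IsUniserialModule A Q

/-- Superfluous (small) submodules. -/
def IsSuperfluousSubmodule {A : Type u} [Ring A] {M : Type u} [AddCommGroup M] [Module A M]
    (N : Submodule A M) : Prop :=
  ∀ L : Submodule A M, N ⊔ L = ⊤ → L = ⊤

/-- Finitely generated projective modules. -/
def IsFGProjective {A : Type u} [Ring A] (P : ModuleCat.{u} A) : Prop :=
  Module.Finite A P ∧ Module.Projective A P

/-- `P₁ --σ--> P₀ --π--> X --> 0` is a minimal projective presentation of `X` by finitely generated
projective modules: `π` is a projective cover of `X`, and `σ` is a projective cover of `ker π`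
followed by the inclusion. -/
structure IsMinimalPresentation {A : Type u} [Ring A] {P₁ P₀ X : ModuleCat.{u} A}
    (σ : P₁ ⟶ P₀) (π : P₀ ⟶ X) : Prop where
  proj₁ : IsFGProjective P₁
  proj₀ : IsFGProjective P₀
  surjective : Function.Surjective π.hom
  exact : LinearMap.range σ.hom = LinearMap.ker π.hom
  superfluous₀ : IsSuperfluousSubmodule (LinearMap.ker π.hom)
  superfluous₁ : IsSuperfluousSubmodule (LinearMap.ker σ.hom)

/-- `Hom_A(σ, Y)` is an isomorphism. -/
def HomIso {A : Type u} [Ring A] {P Q : ModuleCat.{u} A} (σ : P ⟶ Q) (Y : ModuleCat.{u} A) : Prop :=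
  Function.Bijective (fun φ : Q ⟶ Y => σ ≫ φ)

/-- The class of maps `σ₀^X` (minimal projective presentations) of the modules `X` in `U`. -/
def minimalPresentations {A : Type u} [Ring A] (U : ObjectProperty (ModuleCat.{u} A)) :
    MorphismProperty (ModuleCat.{u} A) :=
  fun _ P₀ σ => ∃ (X : ModuleCat.{u} A) (π : P₀ ⟶ X), U X ∧ IsMinimalPresentation σ π

/-- `*C`: the finitely generated modules `X` such that `Hom_A(σ₀^X, Y)` is an isomorphism for all
`Y` in `C`. -/
def leftStar {A : Type u} [Ring A] (C : ObjectProperty (ModuleCat.{u} A)) :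
    ObjectProperty (ModuleCat.{u} A) :=
  fun X => Module.Finite A X ∧ ∃ (P₁ P₀ : ModuleCat.{u} A) (σ : P₁ ⟶ P₀) (π : P₀ ⟶ X),
    IsMinimalPresentation σ π ∧ ∀ Y, C Y → HomIso σ Y

/-- For a class `S` of maps: the finitely generated modules `Y` such that `Hom_A(σ, Y)` is an
isomorphism for all `σ` in `S`. -/
def mapStar {A : Type u} [Ring A] (S : MorphismProperty (ModuleCat.{u} A)) :
    ObjectProperty (ModuleCat.{u} A) :=
  fun Y => Module.Finite A Y ∧ ∀ ⦃P Q : ModuleCat.{u} A⦄ (σ : P ⟶ Q), S σ → HomIso σ Y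

/-- `U*` for a class `U` of modules: the finitely generated modules `Y` such that `Hom_A(σ₀^X, Y)`
is an isomorphism for all `X` in `U`. -/
def rightStar {A : Type u} [Ring A] (U : ObjectProperty (ModuleCat.{u} A)) :
    ObjectProperty (ModuleCat.{u} A) :=
  mapStar (minimalPresentations U)

/-- Wide subcategories of the category of finitely generated `A`-modules: full, closed under
isomorphisms, exact abelian and closed under extensions. -/
structure IsWide {A : Type u} [Ring A] (C : ObjectProperty (ModuleCat.{u} A)) : Prop where
  le_fg : C ≤ ModuleCat.isFG.{u} A
  iso : C.IsClosedUnderIsomorphisms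
  zero : C.ContainsZero
  finiteProducts : C.IsClosedUnderFiniteProducts
  kernels : C.IsClosedUnderKernels
  cokernels : C.IsClosedUnderCokernels
  extensions : C.IsClosedUnderExtensions

/-- `wide(A)`. -/
def Wide (A : Type u) [Ring A] : Type (u + 1) :=
  { C : ObjectProperty (ModuleCat.{u} A) // IsWide C }

/-! ### The tensor product `B ⊗_A M` over a (noncommutative) ring -/

section Tensor

variable {A B : Type u} [Ring A] [Ring B] (f : A →+* B)

/-- The relations `b f(a) ⊗ m = b ⊗ a m`. -/
def tensorRel (M : Type u) [AddCommGroup M] [Module A M] : Submodule B (B ⊗[ℤ] M) :=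
  Submodule.span B { t | ∃ (b : B) (a : A) (m : M), t = (b * f a) ⊗ₜ[ℤ] m - b ⊗ₜ[ℤ] (a • m) }

/-- `B ⊗_A M`, as a left `B`-module. -/
abbrev BTensor (M : Type u) [AddCommGroup M] [Module A M] : Type u :=
  (B ⊗[ℤ] M) ⧸ tensorRel f M

/-- The map `B ⊗_ℤ φ`, as a map of left `B`-modules. -/
def preTensorMap {M N : Type u} [AddCommGroup M] [Module A M] [AddCommGroup N] [Module A N]
    (φ : M →ₗ[A] N) : B ⊗[ℤ] M →ₗ[B] B ⊗[ℤ] N :=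
  AlgebraTensorModule.map (LinearMap.id : B →ₗ[B] B) (φ.toAddMonoidHom.toIntLinearMap)

@[simp]
lemma preTensorMap_tmul {M N : Type u} [AddCommGroup M] [Module A M] [AddCommGroup N] [Module A N]
    (φ : M →ₗ[A] N) (b : B) (m : M) :
    preTensorMap φ (b ⊗ₜ[ℤ] m) = b ⊗ₜ[ℤ] φ m := rfl

lemma tensorRel_le {M N : Type u} [AddCommGroup M] [Module A M] [AddCommGroup N] [Module A N]
    (φ : M →ₗ[A] N) : tensorRel f M ≤ (tensorRel f N).comap (preTensorMap φ) := by
  refine Submodule.span_le.2 ?_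
  rintro _ ⟨b, a, m, rfl⟩
  refine Submodule.subset_span ⟨b, a, φ m, ?_⟩
  simp

/-- `B ⊗_A φ : B ⊗_A M → B ⊗_A N`. -/
def tensorMap {M N : Type u} [AddCommGroup M] [Module A M] [AddCommGroup N] [Module A N]
    (φ : M →ₗ[A] N) : BTensor f M →ₗ[B] BTensor f N :=
  Submodule.mapQ _ _ (preTensorMap φ) (tensorRel_le f φ)

lemma tensorMap_mk_tmul {M N : Type u} [AddCommGroup M] [Module A M] [AddCommGroup N] [Module A N]
    (φ : M →ₗ[A] N) (b : B) (m : M) :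
    tensorMap f φ (Submodule.Quotient.mk (b ⊗ₜ[ℤ] m)) = Submodule.Quotient.mk (b ⊗ₜ[ℤ] φ m) := rfl

lemma tensor_hom_ext {M N : Type u} [AddCommGroup M] [Module A M] [AddCommGroup N] [Module B N]
    {φ ψ : BTensor f M →ₗ[B] N}
    (h : ∀ b m, φ (Submodule.Quotient.mk (b ⊗ₜ[ℤ] m)) = ψ (Submodule.Quotient.mk (b ⊗ₜ[ℤ] m))) :
    φ = ψ := by
  refine Submodule.linearMap_qext _ ?_
  ext m
  exact h 1 m

/-- The functor `B ⊗_A -` from left `A`-modules to left `B`-modules. -/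
def tensorFunctor : ModuleCat.{u} A ⥤ ModuleCat.{u} B where
  obj M := ModuleCat.of B (BTensor f M)
  map φ := ModuleCat.ofHom (tensorMap f φ.hom)
  map_id M := by
    ext1
    exact tensor_hom_ext f fun b m => rfl
  map_comp φ ψ := by
    ext1
    exact tensor_hom_ext f fun b m => rfl

instance tensorFunctor_additive : (tensorFunctor f).Additive where
  map_add {M N φ ψ} := by
    ext1
    refine tensor_hom_ext f fun b m => ?_
    change (Submodule.Quotient.mk (b ⊗ₜ[ℤ] (φ.hom m + ψ.hom m)) : BTensor f N) =
      Submodule.Quotient.mk (b ⊗ₜ[ℤ] φ.hom m) + Submodule.Quotient.mk (b ⊗ₜ[ℤ] ψ.hom m)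
    rw [TensorProduct.tmul_add]
    rfl

/-- `Tor_1^A(B, B)`: the first left derived functor of `B ⊗_A -`, evaluated at the left `A`-module
`B`. -/
def torOne : ModuleCat.{u} B :=
  ((tensorFunctor f).leftDerived 1).obj ((ModuleCat.restrictScalars f).obj (ModuleCat.of B B))

end Tensor

/-! ### Ring epimorphisms and universal localisations -/

/-- Ring epimorphisms: epimorphisms in the category of rings with unit. -/
def IsRingEpi {A B : Type u} [Ring A] [Ring B] (f : A →+* B) : Prop :=
  Epi (RingCat.ofHom f)

/-- `X_B`: the essential image of the restriction functor from finitely generated `B`-modules to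
`A`-modules. -/
def resImage {A B : Type u} [Ring A] [Ring B] (f : A →+* B) : ObjectProperty (ModuleCat.{u} A) :=
  fun M => ∃ N : ModuleCat.{u} B, Module.Finite B N ∧
    Nonempty (M ≅ (ModuleCat.restrictScalars f).obj N)

/-- All maps in `S` are maps between finitely generated projective modules. -/
def BetweenFGProjectives {A : Type u} [Ring A] (S : MorphismProperty (ModuleCat.{u} A)) : Prop :=
  ∀ ⦃P Q : ModuleCat.{u} A⦄ (σ : P ⟶ Q), S σ → IsFGProjective P ∧ IsFGProjective Q

/-- `B ⊗_A σ` is an isomorphism for all `σ` in `S`. -/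
def Inverts {A B : Type u} [Ring A] [Ring B] (f : A →+* B)
    (S : MorphismProperty (ModuleCat.{u} A)) : Prop :=
  ∀ ⦃P Q : ModuleCat.{u} A⦄ (σ : P ⟶ Q), S σ → IsIso ((tensorFunctor f).map σ)

/-- `f : A → B` is the universal localisation of `A` at the class `S` of maps between finitely
generated projective modules. -/
structure IsUniversalLocalisationAt {A B : Type u} [Ring A] [Ring B]
    (S : MorphismProperty (ModuleCat.{u} A)) (f : A →+* B) : Prop where
  fgProjective : BetweenFGProjectives S
  inverts : Inverts f S
  universal : ∀ (C : Type u) [Ring C] (g : A →+* C), Inverts g S → ∃! h : B →+* C, h.comp f = g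

/-- `f : A → B` is a universal localisation. -/
def IsUniversalLocalisation {A B : Type u} [Ring A] [Ring B] (f : A →+* B) : Prop :=
  ∃ S : MorphismProperty (ModuleCat.{u} A), IsUniversalLocalisationAt S f

/-- A universal localisation of `A`, as a ring together with a ring homomorphism from `A`. -/
structure UniversalLocalisation (A : Type u) [Ring A] where
  carrier : Type u
  [ring : Ring carrier]
  hom : A →+* carrier
  isUniversalLocalisation : IsUniversalLocalisation hom

attribute [instance] UniversalLocalisation.ring

/-- Two universal localisations lie in the same epiclass if there is a ring isomorphism between them
compatible with the maps from `A`. -/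
instance epiclassSetoid (A : Type u) [Ring A] : Setoid (UniversalLocalisation A) where
  r L L' := ∃ h : L.carrier ≃+* L'.carrier, (h : L.carrier →+* L'.carrier).comp L.hom = L'.hom
  iseqv :=
    { refl := fun L => ⟨RingEquiv.refl _, rfl⟩
      symm := by
        rintro L L' ⟨h, hh⟩
        refine ⟨h.symm, ?_⟩
        rw [← hh]
        ext a
        simp
      trans := by
        rintro L L' L'' ⟨h, hh⟩ ⟨k, hk⟩
        refine ⟨h.trans k, ?_⟩
        rw [← hk, ← hh]
        rfl }

/-- `uniloc(A)`: the epiclasses of universal localisations of `A`. -/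
def UniLoc (A : Type u) [Ring A] : Type (u + 1) :=
  Quotient (epiclassSetoid A)

/-- The epiclass of a universal localisation. -/
def UniversalLocalisation.epiclass {A : Type u} [Ring A] (L : UniversalLocalisation A) : UniLoc A :=
  Quotient.mk (epiclassSetoid A) L

end

/-! ### Uniserial and uniform modules -/

section Uniserial

variable {A : Type u} [Ring A] {M N : Type u} [AddCommGroup M] [Module A M] [AddCommGroup N]
  [Module A N]

/-! Over a Nakayama algebra finitely generated indecomposable modules are uniserial and finite in
number (`IsSerialRing.exists_representatives`), and in an arbitrary module each element lies in a
finitely generated direct summand (`IsSerialRing.exists_fg_summand`). The first fact gives left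
approximations of `A` in additive classes (`IsSerialRing.exists_weaklyInitial`); the second carries
statements about finitely generated modules over to arbitrary ones, such as the target of a ring
homomorphism.

The core is `IsWide.rightStar_leftStar`: `(*C)* = C` for `C` wide. Let `T` with `t : T` be the
minimal approximation of `A` in the torsion class generated by `C`, with minimal presentation `Q₁ →
Q₀`. A lift of `t` to `Q₀` combines with it to a map `τ : A × Q₁ → Q₀` that is inverted by `C`,
hence by `(*C)*`. If `Y` inverts `τ`, then evaluation at `t` is a bijection from `Hom(T, Y)` to `Y`.
This makes `Y` torsion and forces kernels of maps from torsion modules to `Y` to be torsion, and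
such a `Y` lies in `C` (`IsWide.of_torsionClosure_ker`).

On the side of rings, the minimal approximation `M` of `A` in `C` itself is a reflection, and `B =
End(M)ᵐᵒᵖ` satisfies `X_B = C` (`IsWide.exists_resImage_eq`). If `A → R` inverts the presentations
of `*C`, the finitely generated summands of `R` lie in `(*C)* = C`, so `Hom_A(B, R) = R`, and `A →
R` factors uniquely through `B` (`isUniversalLocalisationAt_of_isWide`). Conversely `X_{A_S} = S*`
(`IsUniversalLocalisationAt.resImage_eq`), so a localisation is recovered from its wide subcategory.

For a ring epimorphism, `Tor_1^A(B, B) = 0` amounts to extending maps into `B`-modules from the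
first syzygy of `B` to its projective cover term, that is, to splitting extensions of `B` by
`B`-modules. Vanishing makes `X_B` closed under extensions, hence wide; for a universal localisation
the splitting holds because inverting `S` is closed under extensions. -/

lemma IsUniserialModule.of_injective (hN : IsUniserialModule A N) (f : M →ₗ[A] N)
    (hf : Function.Injective f) : IsUniserialModule A M := fun L L' => by
  simpa only [Submodule.map_le_map_iff_of_injective hf] using hN (L.map f) (L'.map f)

lemma IsUniserialModule.of_surjective (hM : IsUniserialModule A M) (f : M →ₗ[A] N)
    (hf : Function.Surjective f) : IsUniserialModule A N := fun L L' => by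
  simpa only [Submodule.comap_le_comap_iff_of_surjective hf] using hM (L.comap f) (L'.comap f)

/-- A uniform module: any two nonzero submodules meet. -/
def IsUniformModule (A : Type u) [Ring A] (M : Type u) [AddCommGroup M] [Module A M] : Prop :=
  ∀ L L' : Submodule A M, L ⊓ L' = ⊥ → L = ⊥ ∨ L' = ⊥

lemma IsUniformModule.of_injective (hN : IsUniformModule A N) (f : M →ₗ[A] N)
    (hf : Function.Injective f) : IsUniformModule A M := fun L L' h => by
  have := hN (L.map f) (L'.map f) (by rw [← Submodule.map_inf _ hf, h, Submodule.map_bot])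
  exact this.imp (fun h => Submodule.map_injective_of_injective hf (by simpa using h))
    fun h => Submodule.map_injective_of_injective hf (by simpa using h)

lemma Module.Injective.of_retract (h : Module.Injective A N) (i : M →ₗ[A] N) (r : N →ₗ[A] M)
    (hr : ∀ x, r (i x) = x) : Module.Injective A M where
  out X Y _ _ _ _ f hf g := by
    obtain ⟨k, hk⟩ := h.out f hf (i ∘ₗ g)
    exact ⟨r ∘ₗ k, fun x => by simp [hk, hr]⟩

end Uniserial

/-! ### Coinduced modules -/

section Coinduced

variable (K : Type v) [Field K] (A : Type u) [Ring A] [Algebra K A]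

/-- The coinduced module `Hom_K(A, M)`, with `A` acting through right multiplication on `A`. -/
def CoinducedModule (M : Type u) [AddCommGroup M] [Module K M] : Type u := A →ₗ[K] M

variable (M : Type u) [AddCommGroup M] [Module K M]

instance : AddCommGroup (CoinducedModule K A M) := inferInstanceAs (AddCommGroup (A →ₗ[K] M))

instance : Module K (CoinducedModule K A M) := inferInstanceAs (Module K (A →ₗ[K] M))

instance : Module A (CoinducedModule K A M) where
  smul a φ := LinearMap.comp (show A →ₗ[K] M from φ) (LinearMap.mulRight K a)
  one_smul φ := LinearMap.ext fun x => by
    change (show A →ₗ[K] M from φ) (x * 1) = _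
    rw [mul_one]
  mul_smul a b φ := LinearMap.ext fun x => by
    change (show A →ₗ[K] M from φ) (x * (a * b)) = (show A →ₗ[K] M from φ) (x * a * b)
    rw [mul_assoc]
  smul_zero a := rfl
  smul_add a φ ψ := rfl
  add_smul a b φ := LinearMap.ext fun x => by
    change (show A →ₗ[K] M from φ) (x * (a + b)) =
      (show A →ₗ[K] M from φ) (x * a) + (show A →ₗ[K] M from φ) (x * b)
    rw [mul_add, map_add]
  zero_smul φ := LinearMap.ext fun x => by
    change (show A →ₗ[K] M from φ) (x * 0) = 0
    rw [mul_zero, map_zero]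

instance : IsScalarTower K A (CoinducedModule K A M) where
  smul_assoc k a φ := LinearMap.ext fun x => by
    change (show A →ₗ[K] M from φ) (x * (k • a)) = k • (show A →ₗ[K] M from φ) (x * a)
    rw [mul_smul_comm, map_smul]

lemma CoinducedModule.finite [FiniteDimensional K A] [FiniteDimensional K M] :
    Module.Finite A (CoinducedModule K A M) :=
  haveI : Module.Finite K (CoinducedModule K A M) := inferInstanceAs (Module.Finite K (A →ₗ[K] M))
  Module.Finite.of_restrictScalars_finite K A _

/-- Evaluation at `1` turns `A`-linear maps into `Hom_K(A, M)` into `K`-linear maps into `M`, and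
the latter extend along injections because `K` is a field. -/
lemma CoinducedModule.injective : Module.Injective A (CoinducedModule K A M) where
  out X Y _ _ _ _ f hf g := by
    let _ : Module K X := Module.compHom X (algebraMap K A)
    let _ : Module K Y := Module.compHom Y (algebraMap K A)
    have : IsScalarTower K A X := ⟨fun k a x => by rw [Algebra.smul_def, mul_smul]; rfl⟩
    have : IsScalarTower K A Y := ⟨fun k a x => by rw [Algebra.smul_def, mul_smul]; rfl⟩
    let ev : CoinducedModule K A M →ₗ[K] M := LinearMap.applyₗ (R := K) (1 : A)
    obtain ⟨r, hr⟩ := (f.restrictScalars K).exists_leftInverse_of_injective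
      (LinearMap.ker_eq_bot.2 hf)
    let h : Y →ₗ[K] M := (ev ∘ₗ g.restrictScalars K) ∘ₗ r
    have hh : ∀ x, h (f x) = ev (g x) := fun x => by
      have := LinearMap.congr_fun hr x
      simp only [LinearMap.comp_apply, LinearMap.restrictScalars_apply, LinearMap.id_apply] at this
      simp [h, this]
    let k (y : Y) : CoinducedModule K A M := h ∘ₗ (LinearMap.toSpanSingleton A Y y).restrictScalars K
    refine ⟨{ toFun := k, map_add' := fun y y' => ?_, map_smul' := fun a y => ?_ }, fun x => ?_⟩
    · refine LinearMap.ext fun a => ?_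
      change h (a • (y + y')) = h (a • y) + h (a • y')
      rw [smul_add, map_add]
    · refine LinearMap.ext fun b => ?_
      change h (b • a • y) = h ((b * a) • y)
      rw [mul_smul]
    · refine LinearMap.ext fun a => ?_
      change h (a • f x) = (show A →ₗ[K] M from g x) a
      rw [← map_smul, hh, map_smul]
      change (show A →ₗ[K] M from g x) (1 * a) = _
      rw [one_mul]

/-- Every finitely generated module embeds into a finitely generated injective module. -/
lemma exists_injective_embedding [FiniteDimensional K A] (M : Type u) [AddCommGroup M] [Module A M]
    [Module.Finite A M] : ∃ (E : Type u) (_ : AddCommGroup E) (_ : Module A E),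
      Module.Finite A E ∧ Module.Injective A E ∧ ∃ i : M →ₗ[A] E, Function.Injective i := by
  let _ : Module K M := Module.compHom M (algebraMap K A)
  have : IsScalarTower K A M := ⟨fun k a x => by rw [Algebra.smul_def, mul_smul]; rfl⟩
  have : FiniteDimensional K M := Module.Finite.trans A M
  let j (m : M) : CoinducedModule K A M := (LinearMap.toSpanSingleton A M m).restrictScalars K
  refine ⟨CoinducedModule K A M, inferInstance, inferInstance, CoinducedModule.finite K A M,
    CoinducedModule.injective K A M,
    { toFun := j, map_add' := fun y y' => ?_, map_smul' := fun a y => ?_ }, fun x y h => ?_⟩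
  · refine LinearMap.ext fun a => ?_
    change a • (y + y') = a • y + a • y'
    rw [smul_add]
  · refine LinearMap.ext fun b => ?_
    change b • a • y = (b * a) • y
    rw [mul_smul]
  · have : (1 : A) • x = (1 : A) • y := LinearMap.congr_fun (show (j x : A →ₗ[K] M) = j y from h) 1
    simpa using this

end Coinduced

/-! ### Modules over Nakayama algebras -/

section Nakayama

variable {A : Type u} [Ring A]

lemma exists_isCompl_of_not_indecomposable {M : Type u} [AddCommGroup M] [Module A M]
    [Nontrivial M] (h : ¬ IsIndecomposableModule A M) :
    ∃ N N' : Submodule A M, IsCompl N N' ∧ N ≠ ⊤ ∧ N' ≠ ⊤ := by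
  simp only [IsIndecomposableModule, not_and, not_forall, not_or] at h
  obtain ⟨N, N', hc, h1, h2⟩ := h inferInstance
  refine ⟨N, N', hc, ?_, ?_⟩
  · rintro rfl
    exact h2 (top_disjoint.1 hc.disjoint)
  · rintro rfl
    exact h1 (disjoint_top.1 hc.disjoint)

variable [IsArtinianRing A] (hA : IsNakayama A)

include hA in
-- Induction on the length of `E`. If `E` decomposes, the kernels of the two projections restricted
-- to `M` meet in zero, so by uniformity one is zero and `M` embeds into a proper, again injective,
-- summand.
lemma IsNakayama.isUniserial_of_embedding {M : Type u} [AddCommGroup M] [Module A M]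
    [Nontrivial M] (hM : IsUniformModule A M) (E : Type u) [AddCommGroup E] [Module A E]
    [Module.Finite A E] (hE : Module.Injective A E) (i : M →ₗ[A] E) (hi : Function.Injective i) :
    IsUniserialModule A M := by
  induction h : Module.length A E using WellFoundedLT.induction generalizing E with
  | ind n ih =>
  subst h
  have : Nontrivial E := hi.nontrivial
  by_cases hind : IsIndecomposableModule A E
  · exact (hA.injective E inferInstance hE hind).of_injective i hi
  obtain ⟨N, N', hc, hN, hN'⟩ := exists_isCompl_of_not_indecomposable hind
  have key : LinearMap.ker (N.projectionOnto N' hc ∘ₗ i) ⊓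
      LinearMap.ker (N'.projectionOnto N hc.symm ∘ₗ i) = ⊥ := by
    rw [eq_bot_iff]
    rintro x ⟨hx, hx'⟩
    have h1 : i x ∈ N' := (Submodule.projectionOnto_apply_eq_zero_iff hc).1 hx
    have h2 : i x ∈ N := (Submodule.projectionOnto_apply_eq_zero_iff hc.symm).1 hx'
    have h3 : i x = 0 := (Submodule.disjoint_def.1 hc.disjoint) _ h2 h1
    exact hi (by simpa using h3)
  rcases hM _ _ key with h | h
  · exact ih _ (Submodule.length_lt hN) N
      (hE.of_retract N.subtype (N.projectionOnto N' hc) (by simp)) _ (LinearMap.ker_eq_bot.1 h) rfl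
  · exact ih _ (Submodule.length_lt hN') N'
      (hE.of_retract N'.subtype (N'.projectionOnto N hc.symm) (by simp)) _
      (LinearMap.ker_eq_bot.1 h) rfl

/-- The two properties of the modules over a Nakayama algebra on which their classification rests:
finitely generated uniform modules are uniserial, and the regular module is a finite sum of uniserial
submodules. -/
structure IsSerialRing (A : Type u) [Ring A] : Prop where
  uniform : ∀ (M : Type u) [AddCommGroup M] [Module A M], Module.Finite A M →
    IsUniformModule A M → IsUniserialModule A M
  regular : ∃ s : Set (Submodule A A), s.Finite ∧ s.Nonempty ∧ (∀ P ∈ s, IsUniserialModule A P) ∧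
    sSup s = ⊤

include hA in
-- Split `P` until the summands are indecomposable. Only their sum matters later, so directness is
-- not recorded.
lemma IsNakayama.exists_uniserial_sSup_eq_top (P : Type u) [AddCommGroup P] [Module A P]
    [Module.Finite A P] (hP : Module.Projective A P) :
    ∃ s : Set (Submodule A P), s.Finite ∧ (∀ Q ∈ s, IsUniserialModule A Q) ∧ sSup s = ⊤ := by
  induction h : Module.length A P using WellFoundedLT.induction generalizing P with
  | ind n ih =>
  subst h
  cases subsingleton_or_nontrivial P
  · exact ⟨∅, Set.finite_empty, by simp, Subsingleton.elim _ _⟩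
  by_cases hind : IsIndecomposableModule A P
  · refine ⟨{⊤}, Set.finite_singleton _, ?_, by simp⟩
    rintro _ rfl
    exact (hA.projective P inferInstance hP hind).of_injective (⊤ : Submodule A P).subtype
      Subtype.val_injective
  obtain ⟨N, N', hc, hN, hN'⟩ := exists_isCompl_of_not_indecomposable hind
  have aux : ∀ (N N' : Submodule A P), IsCompl N N' → N ≠ ⊤ →
      ∃ s : Set (Submodule A P), s.Finite ∧ (∀ Q ∈ s, IsUniserialModule A Q) ∧ sSup s = N := by
    intro N N' hc hN
    obtain ⟨s, hs, hs', hs''⟩ := ih _ (Submodule.length_lt hN) N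
      (Module.Projective.of_split N.subtype (N.projectionOnto N' hc) (by ext; simp)) rfl
    refine ⟨Submodule.map N.subtype '' s, hs.image _, ?_, ?_⟩
    · rintro _ ⟨Q, hQ, rfl⟩
      let e := Submodule.equivMapOfInjective N.subtype Subtype.val_injective Q
      exact (hs' Q hQ).of_surjective e.toLinearMap e.surjective
    · simp only [sSup_image, ← Submodule.map_iSup, ← sSup_eq_iSup, hs'', Submodule.map_top,
        Submodule.range_subtype]
  obtain ⟨s, h1, h2, h3⟩ := aux N N' hc hN
  obtain ⟨t, h4, h5, h6⟩ := aux N' N hc.symm hN'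
  refine ⟨s ∪ t, h1.union h4, ?_, ?_⟩
  · rintro Q (hQ | hQ)
    exacts [h2 Q hQ, h5 Q hQ]
  · rw [sSup_union, h3, h6, hc.sup_eq_top]

include hA in
lemma IsNakayama.isSerialRing (K : Type v) [Field K] [Algebra K A] [FiniteDimensional K A] :
    IsSerialRing A where
  uniform M _ _ _ hM := by
    cases subsingleton_or_nontrivial M
    · exact fun N N' => Or.inl (Subsingleton.elim N N').le
    obtain ⟨E, _, _, _, hE, i, hi⟩ := exists_injective_embedding K A M
    exact hA.isUniserial_of_embedding hM E hE i hi
  regular := by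
    obtain ⟨s, h1, h2, h3⟩ := hA.exists_uniserial_sSup_eq_top A inferInstance
    -- Adding `⊥` keeps the set nonempty even when `A` is the zero ring.
    refine ⟨insert ⊥ s, h1.insert _, Set.insert_nonempty _ _, ?_, by simpa using h3⟩
    rintro P (rfl | hP)
    · exact fun N N' => Or.inl (Subsingleton.elim N N').le
    · exact h2 P hP

end Nakayama

/-! ### Independent families in modular lattices -/

section Independent

variable {α : Type*} [CompleteLattice α] [IsModularLattice α]

lemma sSupIndep.insert_of_disjoint {s : Set α} (hs : sSupIndep s) {a : α}
    (h : Disjoint a (sSup s)) : sSupIndep (insert a s) := by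
  by_cases ha : a ∈ s
  · rwa [Set.insert_eq_of_mem ha]
  rintro b (rfl | hb)
  · exact h.mono_right (sSup_le_sSup (by
      rintro c ⟨rfl | hc, hc'⟩
      · exact (hc' rfl).elim
      · exact hc))
  · have h1 : sSup (insert a s \ {b}) ≤ sSup (s \ {b}) ⊔ a := by
      refine sSup_le ?_
      rintro c ⟨rfl | hc, hc'⟩
      · exact le_sup_right
      · exact (le_sSup (show c ∈ s \ {b} from ⟨hc, hc'⟩)).trans le_sup_left
    refine Disjoint.mono_right h1 (Disjoint.disjoint_sup_right_of_disjoint_sup_left (hs hb) ?_)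
    exact h.symm.mono_left (sup_le (le_sSup hb) (sSup_le_sSup Set.sdiff_subset))

/-- The elements of `t` move to the other side one at a time, whence the generalisation over `r`. -/
lemma sSupIndep.disjoint_sSup_sSup_of_finite {s : Set α} (hs : sSupIndep s) {t : Set α}
    (ht : t.Finite) (hts : t ⊆ s) {r : Set α} (hr : r ⊆ s) (htr : Disjoint t r) :
    Disjoint (sSup t) (sSup r) := by
  induction t, ht using Set.Finite.induction_on generalizing r with
  | empty => simp
  | @insert a t ha ht ih =>
    rw [Set.insert_subset_iff] at hts
    rw [Set.disjoint_insert_left] at htr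
    have h1 := ih hts.2 (r := insert a r) (Set.insert_subset hts.1 hr)
      (Set.disjoint_insert_right.2 ⟨ha, htr.2⟩)
    rw [sSup_insert] at h1 ⊢
    rw [sup_comm]
    exact Disjoint.disjoint_sup_left_of_disjoint_sup_right (hs.disjoint_sSup hts.1 hr htr.1) h1

end Independent

/-! ### Splitting off uniserial submodules of maximal length -/

section Serial

variable {A : Type u} [Ring A] {M N : Type u} [AddCommGroup M] [Module A M] [AddCommGroup N]
  [Module A N]

lemma IsUniserialModule.le_or_le {L : Submodule A M} (hL : IsUniserialModule A L)
    {P Q : Submodule A M} (hP : P ≤ L) (hQ : Q ≤ L) : P ≤ Q ∨ Q ≤ P := by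
  have := hL (P.comap L.subtype) (Q.comap L.subtype)
  rwa [Submodule.comap_subtype_le_iff, Submodule.comap_subtype_le_iff, inf_eq_right.2 hP,
    inf_eq_right.2 hQ] at this

lemma IsUniserialModule.of_le {L P : Submodule A M} (hL : IsUniserialModule A L) (h : P ≤ L) :
    IsUniserialModule A P :=
  hL.of_injective (Submodule.inclusion h) (Submodule.inclusion_injective h)

lemma IsUniserialModule.map {L : Submodule A M} (hL : IsUniserialModule A L) (g : M →ₗ[A] N) :
    IsUniserialModule A (L.map g) :=
  hL.of_surjective (g.submoduleMap L) (g.submoduleMap_surjective L)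

lemma Submodule.length_lt_of_lt [IsArtinianRing A] {P Q : Submodule A M} (hQ : Q.FG) (h : P < Q) :
    Module.length A P < Module.length A Q := by
  have : Module.Finite A Q := Module.Finite.iff_fg.2 hQ
  have h1 : Submodule.comap Q.subtype P ≠ ⊤ := by
    rw [Ne, Submodule.comap_subtype_eq_top]
    exact h.not_ge
  rw [← (Submodule.comapSubtypeEquivOfLe h.le).length_eq]
  exact Submodule.length_lt h1

lemma Submodule.FG.of_le_fg [IsArtinianRing A] {P Q : Submodule A M} (hQ : Q.FG) (h : P ≤ Q) :
    P.FG := by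
  have : IsNoetherian A Q := isNoetherian_of_fg_of_noetherian Q hQ
  have := (IsNoetherian.noetherian (P.comap Q.subtype)).map Q.subtype
  rwa [Submodule.map_comap_subtype, inf_eq_right.2 h] at this

/-- If the regular module is the sum of the submodules in the finite set `s` and `A (g x)` is
uniserial, then `A (g x) = P (g x)` for some `P` in `s`. -/
lemma IsUniserialModule.exists_map_eq_span {s : Set (Submodule A A)} (hs : s.Finite)
    (hne : s.Nonempty) (hs' : sSup s = ⊤) (x : M)
    (hu : IsUniserialModule A (Submodule.span A {x})) :
    ∃ P ∈ s, P.map (LinearMap.toSpanSingleton A M x) = Submodule.span A {x} := by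
  let φ := LinearMap.toSpanSingleton A M x
  have hφ : LinearMap.range φ = Submodule.span A {x} := LinearMap.range_toSpanSingleton _
  have hle : ∀ P : Submodule A A, P.map φ ≤ Submodule.span A {x} := fun P => by
    rw [← hφ]
    exact LinearMap.map_le_range
  -- The images lie in a chain, so a maximal one contains the others and equals their sum.
  obtain ⟨P, hP, hmax⟩ := hs.exists_maximalFor (fun P => P.map φ) s hne
  refine ⟨P, hP, le_antisymm (hle P) ?_⟩
  rw [← hφ, LinearMap.range_eq_map, ← hs']
  simp only [sSup_eq_iSup, Submodule.map_iSup]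
  refine iSup₂_le fun Q hQ => ?_
  rcases hu.le_or_le (hle P) (hle Q) with h | h
  · exact hmax hQ h
  · exact h

variable (hS : IsSerialRing A)

include hS

/-- A uniserial cyclic module in a quotient lifts to a uniserial submodule. -/
lemma IsSerialRing.exists_uniserial_lift (g : M →ₗ[A] N) (x : M)
    (hu : IsUniserialModule A (Submodule.span A {g x})) :
    ∃ W ≤ Submodule.span A {x}, IsUniserialModule A W ∧ W.map g = Submodule.span A {g x} := by
  obtain ⟨s, hs, hne, hs', hs''⟩ := hS.regular
  obtain ⟨P, hP, h⟩ := hu.exists_map_eq_span hs hne hs''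
  refine ⟨P.map (LinearMap.toSpanSingleton A M x), ?_, (hs' P hP).map _, ?_⟩
  · rw [← LinearMap.range_toSpanSingleton]
    exact LinearMap.map_le_range
  · rw [← Submodule.map_comp, LinearMap.comp_toSpanSingleton, h]

variable [IsArtinianRing A]

/-- A uniserial submodule of maximal length is a direct summand. -/
lemma IsSerialRing.exists_isCompl {U : Submodule A M} (hU : IsUniserialModule A U) (hfg : U.FG)
    (hmax : ∀ W : Submodule A M, W.FG → IsUniserialModule A W →
      Module.length A W ≤ Module.length A U)
    {N₀ : Submodule A M} (hN₀ : Disjoint U N₀) : ∃ N₁, N₀ ≤ N₁ ∧ IsCompl U N₁ := by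
  obtain ⟨N, hle, hN⟩ := zorn_le_nonempty₀ {N : Submodule A M | Disjoint U N} (by
    intro c hc hchain y hy
    refine ⟨sSup c, ?_, fun z hz => le_sSup hz⟩
    exact (hchain.directedOn.disjoint_sSup_right).2 fun z hz => hc hz) N₀ hN₀
  refine ⟨N, hle, hN.prop, codisjoint_iff.2 (eq_top_iff.2 fun x _ => ?_)⟩
  -- By maximality of `N`, the image of `U` is essential in `M ⧸ N`; since it is uniserial, `M ⧸ N`
  -- is uniform.
  have hess : ∀ L : Submodule A (M ⧸ N), L ≠ ⊥ → L ⊓ U.map N.mkQ ≠ ⊥ := by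
    intro L hL hbot
    have h1 : Disjoint U (L.comap N.mkQ) := by
      rw [Submodule.disjoint_def]
      intro y hyU hyL
      have h2 : N.mkQ y ∈ L ⊓ U.map N.mkQ := ⟨hyL, Submodule.mem_map_of_mem hyU⟩
      rw [hbot, Submodule.mem_bot, Submodule.mkQ_apply, Submodule.Quotient.mk_eq_zero] at h2
      exact Submodule.disjoint_def.1 hN.prop y hyU h2
    have h2 : N ≤ L.comap N.mkQ := Submodule.le_comap_mkQ N L
    have h3 := hN.le_of_ge h1 h2
    apply hL
    rw [eq_bot_iff]
    intro q hq
    obtain ⟨y, rfl⟩ := N.mkQ_surjective q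
    exact (Submodule.Quotient.mk_eq_zero N).2 (h3 hq)
  have hUu : IsUniserialModule A (U.map N.mkQ) := hU.map _
  have hunif : IsUniformModule A (M ⧸ N) := by
    intro L L' h
    by_contra! hne
    rcases hUu.le_or_le (inf_le_right : L ⊓ U.map N.mkQ ≤ _)
      (inf_le_right : L' ⊓ U.map N.mkQ ≤ _) with h1 | h1
    · exact hess L hne.1 (eq_bot_iff.2 (h ▸ le_inf inf_le_left (h1.trans inf_le_left)))
    · exact hess L' hne.2 (eq_bot_iff.2 (h ▸ le_inf (h1.trans inf_le_left) inf_le_left))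
  by_contra hx
  have hq : N.mkQ x ∉ U.map N.mkQ := by
    rintro ⟨y, hy, hxy⟩
    apply hx
    have h1 : x - y ∈ N := (Submodule.Quotient.eq N).1 hxy.symm
    have := Submodule.add_mem_sup hy h1
    rwa [add_sub_cancel] at this
  -- If `x ∉ U + N`, then `A q` together with the image of `U` is finitely generated and uniform,
  -- hence uniserial, so `A q` strictly contains that image. A uniserial lift `W` of `A q` would be
  -- longer than `U`.
  let q := N.mkQ x
  have hLfg : (Submodule.span A {q} ⊔ U.map N.mkQ).FG :=
    (Submodule.fg_span_singleton q).sup (hfg.map _)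
  have hLu : IsUniserialModule A ↥(Submodule.span A {q} ⊔ U.map N.mkQ) :=
    hS.uniform _ (Module.Finite.iff_fg.2 hLfg)
      (hunif.of_injective (Submodule.subtype _) Subtype.val_injective)
  have hlt : U.map N.mkQ < Submodule.span A {q} := by
    refine lt_of_le_of_ne ?_ ?_
    · refine (hLu.le_or_le le_sup_right le_sup_left).resolve_right fun h => hq ?_
      exact h (Submodule.mem_span_singleton_self q)
    · intro h
      exact hq (h ▸ Submodule.mem_span_singleton_self q)
  obtain ⟨W, hWx, hW, hWmap⟩ := hS.exists_uniserial_lift N.mkQ x (hLu.of_le le_sup_left)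
  have h1 := hmax W ((Submodule.fg_span_singleton x).of_le_fg hWx) hW
  have h2 := Submodule.length_lt_of_lt (Submodule.fg_span_singleton q) hlt
  have h3 : Module.length A (Submodule.span A {q}) ≤ Module.length A W := by
    rw [← hWmap]
    exact Module.length_le_of_surjective _ (N.mkQ.submoduleMap_surjective W)
  have h4 : Module.length A U ≤ Module.length A (U.map N.mkQ) := by
    refine Module.length_le_of_injective (N.mkQ.submoduleMap U) fun y z hyz => ?_
    have h5 : (y : M) - z ∈ N := (Submodule.Quotient.eq N).1 (congrArg Subtype.val hyz)
    have h6 := Submodule.disjoint_def.1 hN.prop _ (U.sub_mem y.2 z.2) h5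
    exact Subtype.ext (sub_eq_zero.1 h6)
  exact absurd (h3.trans (h1.trans h4)) h2.not_ge

/-- A finite independent sum of uniserial submodules of maximal length is a direct summand. -/
lemma IsSerialRing.exists_isCompl_sSup {n : ℕ∞}
    (hmax : ∀ W : Submodule A M, W.FG → IsUniserialModule A W → Module.length A W ≤ n)
    {t : Set (Submodule A M)} (ht : t.Finite) (hind : sSupIndep t)
    (hfg : ∀ U ∈ t, U.FG) (hu : ∀ U ∈ t, IsUniserialModule A U)
    (hn : ∀ U ∈ t, Module.length A U = n)
    {N₀ : Submodule A M} (hN₀ : Disjoint (sSup t) N₀) : ∃ N₁, N₀ ≤ N₁ ∧ IsCompl (sSup t) N₁ := by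
  induction t, ht using Set.Finite.induction_on generalizing N₀ with
  | empty => exact ⟨⊤, le_top, by simpa using isCompl_bot_top⟩
  | @insert U t ha ht ih =>
    have h0 : Disjoint U (sSup t) := hind.disjoint_sSup (Set.mem_insert _ _)
      (Set.subset_insert _ _) ha
    rw [sSup_insert] at hN₀ ⊢
    obtain ⟨P, hP, hP'⟩ := hS.exists_isCompl (hu U (Set.mem_insert _ _))
      (hfg U (Set.mem_insert _ _))
      (fun W h1 h2 => (hmax W h1 h2).trans (hn U (Set.mem_insert _ _)).ge)
      (Disjoint.disjoint_sup_right_of_disjoint_sup_left h0 hN₀)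
    obtain ⟨Q, hQ, hQ'⟩ := ih (hind.mono (Set.subset_insert _ _))
      (fun U hU => hfg U (Set.mem_insert_of_mem _ hU))
      (fun U hU => hu U (Set.mem_insert_of_mem _ hU))
      (fun U hU => hn U (Set.mem_insert_of_mem _ hU)) (N₀ := U ⊔ N₀)
      (Disjoint.disjoint_sup_right_of_disjoint_sup_left h0.symm (by rwa [sup_comm (sSup t)]))
    have hUQ : U ≤ Q := le_sup_left.trans hQ
    -- `P` is a complement of `U` containing `sSup t`, and `Q` is a complement of `sSup t`
    -- containing `U`; the modular law shows that `P ⊓ Q` is a complement of the sum.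
    refine ⟨P ⊓ Q, le_inf (le_sup_right.trans hP) (le_sup_right.trans hQ), ?_, ?_⟩
    · rw [disjoint_iff]
      calc (U ⊔ sSup t) ⊓ (P ⊓ Q) = ((U ⊔ sSup t) ⊓ Q) ⊓ P := by
            rw [inf_comm P Q, inf_assoc]
        _ = U ⊓ P := by rw [sup_inf_assoc_of_le _ hUQ, hQ'.inf_eq_bot, sup_bot_eq]
        _ = ⊥ := hP'.inf_eq_bot
    · rw [codisjoint_iff]
      calc U ⊔ sSup t ⊔ P ⊓ Q = sSup t ⊔ (U ⊔ P ⊓ Q) := by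
            rw [sup_comm U, sup_assoc]
        _ = sSup t ⊔ Q := by rw [← sup_inf_assoc_of_le _ hUQ, hP'.sup_eq_top, top_inf_eq]
        _ = ⊤ := hQ'.sup_eq_top

end Serial

/-! ### Finitely generated direct summands and the classification of indecomposables -/

section Summands

variable {A : Type u} [Ring A] {M : Type u} [AddCommGroup M] [Module A M]

/-- Every element of the submodule `V` lies in a finitely generated direct summand of `V`. -/
def HasFGSummands (V : Submodule A M) : Prop :=
  ∀ x ∈ V, ∃ X X' : Submodule A M, X ⊔ X' = V ∧ Disjoint X X' ∧ X.FG ∧ x ∈ X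

lemma HasFGSummands.map {N : Type u} [AddCommGroup N] [Module A N] {V : Submodule A M}
    (h : HasFGSummands V) (i : M →ₗ[A] N) (hi : Function.Injective i) :
    HasFGSummands (V.map i) := by
  rintro _ ⟨x, hx, rfl⟩
  obtain ⟨X, X', h1, h2, h3, h4⟩ := h x hx
  refine ⟨X.map i, X'.map i, by rw [← Submodule.map_sup, h1], ?_, h3.map i,
    Submodule.mem_map_of_mem h4⟩
  rw [disjoint_iff, ← Submodule.map_inf _ hi, h2.eq_bot, Submodule.map_bot]

lemma HasFGSummands.sup {V W : Submodule A M} (hV : HasFGSummands V) (hW : HasFGSummands W)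
    (hVW : Disjoint V W) : HasFGSummands (V ⊔ W) := by
  intro z hz
  obtain ⟨x, hx, y, hy, rfl⟩ := Submodule.mem_sup.1 hz
  obtain ⟨X, X', rfl, h2, h3, h4⟩ := hV x hx
  obtain ⟨Y, Y', rfl, k2, k3, k4⟩ := hW y hy
  refine ⟨X ⊔ Y, X' ⊔ Y', sup_sup_sup_comm .., ?_, h3.sup k3, Submodule.add_mem_sup h4 k4⟩
  rw [Submodule.disjoint_def] at h2 k2 hVW ⊢
  intro z hz hz'
  obtain ⟨a, ha, b, hb, rfl⟩ := Submodule.mem_sup.1 hz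
  obtain ⟨a', ha', b', hb', hab⟩ := Submodule.mem_sup.1 hz'
  have e : a - a' = b' - b := by
    rw [sub_eq_sub_iff_add_eq_add, ← hab, add_comm a' b']
  have h5 : a - a' = 0 := hVW _
    (Submodule.sub_mem _ (Submodule.mem_sup_left ha) (Submodule.mem_sup_right ha'))
    (e ▸ Submodule.sub_mem _ (Submodule.mem_sup_right hb') (Submodule.mem_sup_left hb))
  have h6 : b' = b := sub_eq_zero.1 (e ▸ h5)
  have h7 : a = a' := sub_eq_zero.1 h5
  rw [h2 a ha (h7 ▸ ha'), k2 b hb (h6 ▸ hb'), add_zero]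

lemma exists_finite_subset_of_fg_le_sSup {s : Set (Submodule A M)} {G : Submodule A M} (hG : G.FG)
    (h : G ≤ sSup s) : ∃ t ⊆ s, t.Finite ∧ G ≤ sSup t := by
  obtain ⟨t, ht, h'⟩ := (CompleteLattice.isCompactElement_iff_exists_le_sSup_of_le_sSup _ G).1
    ((Submodule.fg_iff_compact G).1 hG) s h
  exact ⟨t, ht, t.finite_toSet, by rwa [Finset.sup_id_eq_sSup] at h'⟩

variable [IsArtinianRing A] (hS : IsSerialRing A)

include hS

/-- A nonzero cyclic submodule is the sum of the images of the uniserial pieces of `A`, so one of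
these images is nonzero. -/
lemma IsSerialRing.exists_uniserial_ne_bot [Nontrivial M] :
    ∃ W : Submodule A M, W.FG ∧ IsUniserialModule A W ∧ W ≠ ⊥ := by
  obtain ⟨s, hs, -, hs', hs''⟩ := hS.regular
  obtain ⟨x, hx⟩ := exists_ne (0 : M)
  by_contra! h
  have h1 : LinearMap.ker (LinearMap.toSpanSingleton A M x) = ⊤ := by
    rw [eq_top_iff, ← hs'']
    refine sSup_le fun P hP => ?_
    have hPfg : P.FG := IsNoetherian.noetherian P
    exact LinearMap.le_ker_iff_map.2 (h _ (hPfg.map _) ((hs' P hP).map _))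
  have : (1 : A) ∈ LinearMap.ker (LinearMap.toSpanSingleton A M x) := h1 ▸ Submodule.mem_top
  exact hx (by simpa using this)

/-- Take a maximal independent set `s` of finitely generated uniserial submodules of length exactly
`n + 1`, and `N` maximal among the submodules disjoint from `sSup s`. Elements of `sSup s` lie in
finite subsums, the induction hypothesis applies to `N`, and the point is that `sSup s` and `N`
together span `M`. -/
lemma IsSerialRing.hasFGSummands_top_of_length_le (n : ℕ) (M : Type u) [AddCommGroup M] [Module A M]
    (hmax : ∀ W : Submodule A M, W.FG → IsUniserialModule A W → Module.length A W ≤ n) :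
    HasFGSummands (⊤ : Submodule A M) := by
  induction n generalizing M with
  | zero =>
    have h0 : Subsingleton M := by
      by_contra h
      rw [not_subsingleton_iff_nontrivial] at h
      obtain ⟨W, h1, h2, h3⟩ := hS.exists_uniserial_ne_bot (M := M)
      have h4 := hmax W h1 h2
      rw [Nat.cast_zero, nonpos_iff_eq_zero, Module.length_eq_zero_iff,
        Submodule.subsingleton_iff_eq_bot] at h4
      exact h3 h4
    intro x _
    exact ⟨⊥, ⊤, bot_sup_eq _, disjoint_bot_left, Submodule.fg_bot, by simp [Subsingleton.elim x 0]⟩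
  | succ n ih =>
    let good : Set (Set (Submodule A M)) := {s | sSupIndep s ∧ ∀ U ∈ s, U.FG ∧
      IsUniserialModule A U ∧ Module.length A U = (n + 1 : ℕ)}
    obtain ⟨s, -, hs⟩ := zorn_subset_nonempty good (by
      intro c hc hchain _
      refine ⟨⋃₀ c, ⟨?_, ?_⟩, fun z hz => Set.subset_sUnion_of_mem hz⟩
      · rw [Set.sUnion_eq_iUnion]
        exact sSupIndep_iUnion_of_directed hchain.directed fun i => (hc i.2).1
      · rintro U ⟨r, hr, hU⟩
        exact (hc hr).2 U hU) ∅ ⟨sSupIndep_empty, by simp⟩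
    obtain ⟨hind, hgood⟩ := hs.prop
    obtain ⟨N, -, hN⟩ := zorn_le_nonempty₀ {N : Submodule A M | Disjoint (sSup s) N} (by
      intro c hc hchain y hy
      refine ⟨sSup c, ?_, fun z hz => le_sSup hz⟩
      exact (hchain.directedOn.disjoint_sSup_right).2 fun z hz => hc hz) ⊥ disjoint_bot_right
    have hdisj : Disjoint (sSup s) N := hN.prop
    have hV : HasFGSummands (sSup s) := by
      intro x hx
      obtain ⟨t, ht, htf, hxt⟩ := exists_finite_subset_of_fg_le_sSup
        (Submodule.fg_span_singleton x) ((Submodule.span_singleton_le_iff_mem _ _).2 hx)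
      refine ⟨sSup t, sSup (s \ t), by rw [← sSup_union, Set.union_sdiff_cancel ht],
        hind.disjoint_sSup_sSup_of_finite htf ht Set.sdiff_subset Set.disjoint_sdiff_right, ?_,
        hxt (Submodule.mem_span_singleton_self x)⟩
      have : Finite t := htf
      rw [sSup_eq_iSup']
      exact Submodule.fg_iSup _ fun U => (hgood U (ht U.2)).1
    have hNs : HasFGSummands N := by
      have h1 := ih N (by
        intro W hWfg hW
        let e := Submodule.equivMapOfInjective N.subtype Subtype.val_injective W
        have hWu : IsUniserialModule A (W.map N.subtype) :=
          hW.of_surjective e.toLinearMap e.surjective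
        have h2 := hmax _ (hWfg.map N.subtype) hWu
        rw [e.length_eq]
        by_contra hlt
        have h3 : Module.length A (W.map N.subtype) = (n + 1 : ℕ) := by
          refine le_antisymm h2 ?_
          rw [Nat.cast_add, Nat.cast_one]
          exact Order.add_one_le_of_lt (not_le.1 hlt)
        -- A uniserial submodule of `N` of length `n + 1` could be added to `s`; by maximality it
        -- already belongs to `s`, yet it is disjoint from `sSup s`.
        have h4 : Disjoint (W.map N.subtype) (sSup s) :=
          hdisj.symm.mono_left (Submodule.map_subtype_le N W)
        have h5 : insert (W.map N.subtype) s ∈ good := by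
          refine ⟨hind.insert_of_disjoint h4, ?_⟩
          rintro U (rfl | hU)
          · exact ⟨hWfg.map _, hWu, h3⟩
          · exact hgood U hU
        have h6 : W.map N.subtype ∈ s := hs.le_of_ge h5 (Set.subset_insert _ _)
          (Set.mem_insert _ _)
        have h7 : W.map N.subtype = ⊥ := disjoint_self.1 (h4.mono_right (le_sSup h6))
        rw [h7, Module.length_bot] at h3
        exact absurd h3.symm (by simp))
      have h2 := h1.map N.subtype Subtype.val_injective
      rwa [Submodule.map_top, Submodule.range_subtype] at h2
    have htop : sSup s ⊔ N = ⊤ := by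
      rw [eq_top_iff]
      intro x _
      -- `G` embeds into the cyclic module `(A x + N) / N`, so it lies in a finite subsum `sSup t`,
      -- which has a complement `N₁` containing `N`. For `x = y + z` along this decomposition it
      -- suffices that `N + A z` still avoids `sSup s`, for then `z ∈ N`.
      let G := (Submodule.span A {x} ⊔ N) ⊓ sSup s
      have hG : G.FG := by
        have h1 : (G.map N.mkQ).FG := by
          refine (Submodule.fg_span_singleton (N.mkQ x)).of_le_fg ?_
          refine (Submodule.map_mono inf_le_left).trans ?_
          rw [Submodule.map_sup, Submodule.map_span, Set.image_singleton, Submodule.mkQ_map_self,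
            sup_bot_eq]
        have h2 : (G.comap (sSup s).subtype).FG := by
          refine Submodule.fg_of_fg_map_injective (N.mkQ ∘ₗ (sSup s).subtype) ?_ ?_
          · rw [← LinearMap.ker_eq_bot, LinearMap.ker_comp, Submodule.ker_mkQ]
            exact Submodule.disjoint_iff_comap_eq_bot.1 hdisj
          · rwa [Submodule.map_comp, Submodule.map_comap_subtype, inf_eq_right.2 inf_le_right]
        have h3 := h2.map (sSup s).subtype
        rwa [Submodule.map_comap_subtype, inf_eq_right.2 inf_le_right] at h3
      obtain ⟨t, ht, htf, hGt⟩ := exists_finite_subset_of_fg_le_sSup hG inf_le_right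
      have hst : sSup t ⊔ sSup (s \ t) = sSup s := by rw [← sSup_union, Set.union_sdiff_cancel ht]
      have hd : Disjoint (sSup t) (sSup (s \ t)) :=
        hind.disjoint_sSup_sSup_of_finite htf ht Set.sdiff_subset Set.disjoint_sdiff_right
      obtain ⟨N₁, hN₁, hc⟩ := hS.exists_isCompl_sSup hmax htf (hind.mono ht)
        (fun U hU => (hgood U (ht hU)).1) (fun U hU => (hgood U (ht hU)).2.1)
        (fun U hU => (hgood U (ht hU)).2.2)
        (Disjoint.disjoint_sup_right_of_disjoint_sup_left hd (hst ▸ hdisj))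
      have hVN : sSup s ⊓ N₁ ≤ sSup (s \ t) := by
        rw [← hst, sup_comm, sup_inf_assoc_of_le _ (le_sup_left.trans hN₁), hc.inf_eq_bot,
          sup_bot_eq]
      obtain ⟨y, hy, z, hz, rfl⟩ := Submodule.mem_sup.1
        (show x ∈ sSup t ⊔ N₁ from hc.sup_eq_top ▸ Submodule.mem_top)
      refine Submodule.add_mem_sup (sSup_le_sSup ht hy) ?_
      have hNz : Disjoint (sSup s) (N ⊔ Submodule.span A {z}) := by
        rw [Submodule.disjoint_def]
        intro v hv hv'
        obtain ⟨k, hk, w, hw, rfl⟩ := Submodule.mem_sup.1 hv'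
        obtain ⟨a, rfl⟩ := Submodule.mem_span_singleton.1 hw
        have h1 : k + a • z ∈ N₁ := N₁.add_mem (hN₁ (Submodule.mem_sup_right hk))
          (N₁.smul_mem a hz)
        -- Adding `a • y` moves the element into `G`, hence into `sSup t`; so `k + a • z` lies in
        -- both `sSup t` and `N₁`.
        have h2 : k + a • z + a • y ∈ G := by
          refine ⟨?_, Submodule.add_mem _ hv (Submodule.smul_mem _ a (sSup_le_sSup ht hy))⟩
          have e : k + a • z + a • y = a • (y + z) + k := by rw [smul_add]; abel
          rw [e]
          exact Submodule.add_mem_sup (Submodule.smul_mem _ _ (Submodule.mem_span_singleton_self _))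
            hk
        have h3 : k + a • z ∈ sSup t := by
          have := Submodule.sub_mem _ (hGt h2) (Submodule.smul_mem _ a hy)
          rwa [add_sub_cancel_right] at this
        exact Submodule.disjoint_def.1 hc.disjoint _ h3 h1
      exact hN.le_of_ge hNz le_sup_left
        (Submodule.mem_sup_right (Submodule.mem_span_singleton_self z))
    rw [← htop]
    exact hV.sup hNs hdisj

omit hS [IsArtinianRing A] in
lemma IsUniserialModule.exists_eq_span {W : Submodule A M} (hfg : W.FG)
    (hW : IsUniserialModule A W) : ∃ x : M, W = Submodule.span A {x} := by
  induction W, hfg using Submodule.fg_induction with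
  | singleton x => exact ⟨x, rfl⟩
  | sup N N' _ _ ih ih' =>
    rcases hW.le_or_le (le_sup_left : N ≤ N ⊔ N') (le_sup_right : N' ≤ N ⊔ N') with h | h
    · rw [sup_eq_right.2 h]
      exact ih' (hW.of_le le_sup_right)
    · rw [sup_eq_left.2 h]
      exact ih (hW.of_le le_sup_left)

omit hS [IsArtinianRing A] in
-- A finitely generated uniserial module is cyclic. The resulting bound is independent of the
-- ambient module, so the induction on uniserial length covers all modules.
lemma IsUniserialModule.length_le {W : Submodule A M} (hfg : W.FG)
    (hW : IsUniserialModule A W) : Module.length A W ≤ Module.length A A := by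
  obtain ⟨x, rfl⟩ := hW.exists_eq_span hfg
  rw [← LinearMap.range_toSpanSingleton]
  exact Module.length_le_of_surjective _ (LinearMap.surjective_rangeRestrict _)

/-- Every element of a module over a Nakayama algebra lies in a finitely generated direct summand. -/
theorem IsSerialRing.exists_fg_summand (x : M) :
    ∃ X X' : Submodule A M, IsCompl X X' ∧ X.FG ∧ x ∈ X := by
  obtain ⟨n, hn⟩ := ENat.ne_top_iff_exists.1 (Module.length_ne_top (R := A) (M := A))
  obtain ⟨X, X', h1, h2, h3, h4⟩ := hS.hasFGSummands_top_of_length_le n M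
    (fun W h1 h2 => (IsUniserialModule.length_le h1 h2).trans hn.ge) x Submodule.mem_top
  exact ⟨X, X', ⟨h2, codisjoint_iff.2 h1⟩, h3, h4⟩

/-- Finitely generated indecomposable modules over a Nakayama algebra are uniserial. -/
theorem IsSerialRing.isUniserial_of_indecomposable [Module.Finite A M]
    (hM : IsIndecomposableModule A M) : IsUniserialModule A M := by
  have := hM.1
  let T : Set ℕ∞ := {n | ∃ U : Submodule A M, IsUniserialModule A U ∧ Module.length A U = n}
  have hT : Nonempty T := ⟨⟨0, ⊥, fun N N' => Or.inl (Subsingleton.elim N N').le, by simp⟩⟩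
  have hle : ∀ U : Submodule A M, Module.length A U ≤ Module.length A M := fun U =>
    Module.length_le_of_injective U.subtype Subtype.val_injective
  obtain ⟨U, hU, hUn⟩ := ENat.sSup_mem_of_nonempty_of_lt_top (s := T) (lt_of_le_of_lt
    (sSup_le (by rintro _ ⟨U, -, rfl⟩; exact hle U))
    (lt_top_iff_ne_top.2 (Module.length_ne_top (R := A) (M := M))))
  have hmax : ∀ W : Submodule A M, W.FG → IsUniserialModule A W →
      Module.length A W ≤ Module.length A U := fun W _ hW => hUn ▸ le_sSup ⟨W, hW, rfl⟩
  obtain ⟨N, -, hN⟩ := hS.exists_isCompl hU (IsNoetherian.noetherian U) hmax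
    (disjoint_bot_right : Disjoint U ⊥)
  -- The uniserial submodule `U` of maximal length splits off, so it is zero or everything; it is
  -- not zero because `M` has a nonzero uniserial submodule.
  rcases hM.2 U N hN with rfl | rfl
  · obtain ⟨W, h1, h2, h3⟩ := hS.exists_uniserial_ne_bot (M := M)
    have h4 := hmax W h1 h2
    rw [Module.length_bot, nonpos_iff_eq_zero, Module.length_eq_zero_iff,
      Submodule.subsingleton_iff_eq_bot] at h4
    exact (h3 h4).elim
  · have hU' : U = ⊤ := by simpa using hN.sup_eq_top
    subst hU'
    exact hU.of_surjective (⊤ : Submodule A M).subtype fun x => ⟨⟨x, Submodule.mem_top⟩, rfl⟩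

omit hS in
-- On a chain of submodules length is injective, and it is bounded by the finite length of `M`.
lemma IsUniserialModule.finite_submodule [Module.Finite A M] (hM : IsUniserialModule A M) :
    Finite (Submodule A M) := by
  obtain ⟨n, hn⟩ := ENat.ne_top_iff_exists.1 (Module.length_ne_top (R := A) (M := M))
  have hlt : ∀ L L' : Submodule A M, L < L' → Module.length A L < Module.length A L' :=
    fun L L' h => Submodule.length_lt_of_lt (IsNoetherian.noetherian L') h
  have hinj : Function.Injective fun L : Submodule A M => Module.length A L := by
    intro L L' h
    by_contra hne
    rcases hM L L' with h1 | h1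
    · exact (hlt L L' (lt_of_le_of_ne h1 hne)).ne h
    · exact (hlt L' L (lt_of_le_of_ne h1 (Ne.symm hne))).ne h.symm
  have hfin : (Set.Iic (n : ℕ∞)).Finite := by
    refine ((Set.finite_Iic n).image (Nat.cast : ℕ → ℕ∞)).subset fun k hk => ?_
    obtain ⟨m, rfl⟩ := ENat.ne_top_iff_exists.1 (ne_top_of_le_ne_top (ENat.natCast_ne_top n) hk)
    exact ⟨m, by simpa using hk, rfl⟩
  refine Set.finite_univ_iff.1 (Set.Finite.of_injOn ?_ hinj.injOn hfin)
  intro L _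
  exact (Module.length_le_of_injective L.subtype Subtype.val_injective).trans hn.ge

/-- A Nakayama algebra has finitely many finitely generated indecomposable modules. -/
theorem IsSerialRing.exists_representatives :
    ∃ (ι : Type u) (X : ι → ModuleCat.{u} A), Finite ι ∧ (∀ i, Module.Finite A (X i)) ∧
      ∀ (M : Type u) [AddCommGroup M] [Module A M], Module.Finite A M →
        IsIndecomposableModule A M → ∃ i, Nonempty (M ≃ₗ[A] X i) := by
  obtain ⟨s, hs, hne, hs', hs''⟩ := hS.regular
  have : Finite s := hs
  have (P : s) : Finite (Submodule A P) := (hs' P P.2).finite_submodule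
  -- An indecomposable module is uniserial, hence cyclic, hence a quotient of one of the finitely
  -- many uniserial pieces `P` of `A`.
  refine ⟨Σ P : s, Submodule A P, fun i => ModuleCat.of A (i.1 ⧸ i.2), inferInstance,
    fun i => inferInstanceAs (Module.Finite A (i.1 ⧸ i.2)), fun M _ _ _ hM => ?_⟩
  have hu := hS.isUniserial_of_indecomposable hM
  obtain ⟨x, hx⟩ := IsUniserialModule.exists_eq_span (Module.Finite.fg_top (R := A) (M := M))
    (hu.of_injective (⊤ : Submodule A M).subtype Subtype.val_injective)
  obtain ⟨P, hP, h⟩ := IsUniserialModule.exists_map_eq_span hs hne hs'' x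
    (hu.of_injective (Submodule.subtype _) Subtype.val_injective)
  let φ := LinearMap.toSpanSingleton A M x ∘ₗ P.subtype
  have hφ : Function.Surjective φ := by
    rw [← LinearMap.range_eq_top, LinearMap.range_comp, Submodule.range_subtype, h, hx]
  exact ⟨⟨⟨P, hP⟩, LinearMap.ker φ⟩, ⟨(φ.quotKerEquivOfSurjective hφ).symm⟩⟩

end Summands

/-! ### Additive classes of modules -/

section AdditiveClass

variable {A : Type u} [Ring A]

/-- A class of finitely generated modules closed under isomorphisms, finite products and direct
summands. -/
structure IsAdditiveClass (D : ObjectProperty (ModuleCat.{u} A)) : Prop where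
  fg : ∀ X, D X → Module.Finite A X
  of_equiv : ∀ {X Y : ModuleCat.{u} A}, (X ≃ₗ[A] Y) → D X → D Y
  pi : ∀ (ι : Type u) [Finite ι] (X : ι → ModuleCat.{u} A), (∀ i, D (X i)) →
    D (ModuleCat.of A (∀ i, X i))
  summand : ∀ (X : ModuleCat.{u} A) (N N' : Submodule A X), IsCompl N N' → D X →
    D (ModuleCat.of A N)

lemma exists_fin_span (K : Type v) [Field K] [Algebra K A] [FiniteDimensional K A]
    (X : Type u) [AddCommGroup X] [Module A X] [Module.Finite A X] :
    ∃ (n : ℕ) (w : Fin n → X), ∀ x, ∃ c : Fin n → K, ∑ j, algebraMap K A (c j) • w j = x := by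
  let _ : Module K X := Module.compHom X (algebraMap K A)
  have : IsScalarTower K A X := ⟨fun k a x => by rw [Algebra.smul_def, mul_smul]; rfl⟩
  have : Module.Finite K X := Module.Finite.trans A X
  obtain ⟨n, w, hw⟩ := Module.Finite.exists_fin (R := K) (M := X)
  refine ⟨n, w, fun x => ?_⟩
  obtain ⟨c, hc⟩ := (Submodule.mem_span_range_iff_exists_fun K).1
    (show x ∈ Submodule.span K (Set.range w) from hw ▸ Submodule.mem_top)
  exact ⟨c, hc⟩

/-- Multiplication by a scalar, as a linear map over the algebra. -/
def algebraScalar {K : Type v} [Field K] [Algebra K A] (X : Type u) [AddCommGroup X] [Module A X]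
    (k : K) : X →ₗ[A] X where
  toFun x := algebraMap K A k • x
  map_add' := smul_add _
  map_smul' a x := by
    rw [RingHom.id_apply, ← mul_smul, ← mul_smul, Algebra.commutes]

/-- An additive class of modules over a Nakayama algebra has a left approximation of the regular
module. -/
theorem IsSerialRing.exists_weaklyInitial (K : Type v) [Field K] [Algebra K A]
    [FiniteDimensional K A] [IsArtinianRing A] (hS : IsSerialRing A)
    {D : ObjectProperty (ModuleCat.{u} A)} (hD : IsAdditiveClass D) :
    ∃ (M : ModuleCat.{u} A) (m : M), D M ∧
      ∀ Y : ModuleCat.{u} A, D Y → ∀ y : Y, ∃ φ : M →ₗ[A] Y, φ m = y := by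
  obtain ⟨ι, X, hι, hX, hrep⟩ := hS.exists_representatives
  have hspan := fun i => exists_fin_span (A := A) K (X i)
  choose n w hw using hspan
  -- `M` contains each representative `X i` in `D` once for every member of a `K`-spanning family of
  -- `X i`, and `m` collects the spanning vectors. A `K`-linear combination of projections then
  -- sends `m` to any prescribed element of `X i`.
  let J := Σ i : {i : ι // D (X i)}, Fin (n i)
  let M : ModuleCat.{u} A := ModuleCat.of A (∀ j : J, X j.1)
  let m : M := fun j : J => w j.1 j.2
  refine ⟨M, m, hD.pi J _ fun j => j.1.2, fun Y hY y => ?_⟩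
  have hfgY := hD.fg Y hY
  induction h : Module.length A Y using WellFoundedLT.induction generalizing Y with
  | ind l ih =>
  subst h
  cases subsingleton_or_nontrivial Y
  · exact ⟨0, Subsingleton.elim _ _⟩
  by_cases hind : IsIndecomposableModule A Y
  · obtain ⟨i, ⟨e⟩⟩ := hrep Y hfgY hind
    have hi : D (X i) := hD.of_equiv e hY
    obtain ⟨c, hc⟩ := hw i (e y)
    refine ⟨e.symm.toLinearMap ∘ₗ ∑ j : Fin (n i), algebraScalar (X i) (c j) ∘ₗ
      (LinearMap.proj (R := A) (φ := fun j : J => X j.1) ⟨⟨i, hi⟩, j⟩), ?_⟩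
    rw [LinearMap.comp_apply, LinearMap.sum_apply]
    exact (LinearEquiv.symm_apply_eq e).2 hc
  · obtain ⟨N, N', hc, hN, hN'⟩ := exists_isCompl_of_not_indecomposable hind
    obtain ⟨φ, hφ⟩ := ih _ (Submodule.length_lt hN) (ModuleCat.of A N) (hD.summand Y N N' hc hY)
      (N.projectionOnto N' hc y) (inferInstanceAs (Module.Finite A N)) rfl
    obtain ⟨ψ, hψ⟩ := ih _ (Submodule.length_lt hN') (ModuleCat.of A N')
      (hD.summand Y N' N hc.symm hY) (N'.projectionOnto N hc.symm y)
      (inferInstanceAs (Module.Finite A N')) rfl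
    refine ⟨N.subtype ∘ₗ φ + N'.subtype ∘ₗ ψ, ?_⟩
    rw [LinearMap.add_apply, LinearMap.comp_apply, LinearMap.comp_apply, hφ, hψ]
    exact Submodule.projection_add_projection_eq_self hc y

end AdditiveClass

/-! ### Wide subcategories -/

section Wide

variable {A : Type u} [Ring A] {C : ObjectProperty (ModuleCat.{u} A)}

lemma IsWide.of_equiv (hC : IsWide C) {X Y : ModuleCat.{u} A} (e : X ≃ₗ[A] Y) (h : C X) : C Y :=
  hC.iso.of_iso e.toModuleIso h

lemma IsWide.ker (hC : IsWide C) {X Y : ModuleCat.{u} A} (g : X →ₗ[A] Y) (hX : C X) (hY : C Y) :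
    C (ModuleCat.of A (LinearMap.ker g)) :=
  have := hC.kernels
  C.prop_of_isLimit_kernelFork (ModuleCat.kernelIsLimit (ModuleCat.ofHom g)) hX hY

lemma IsWide.coker (hC : IsWide C) {X Y : ModuleCat.{u} A} (g : X →ₗ[A] Y) (hX : C X) (hY : C Y) :
    C (ModuleCat.of A (Y ⧸ LinearMap.range g)) :=
  have := hC.cokernels
  C.prop_of_isColimit_cokernelCofork (ModuleCat.cokernelIsColimit (ModuleCat.ofHom g)) hX hY

lemma IsWide.ext (hC : IsWide C) {X : ModuleCat.{u} A} (N : Submodule A X)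
    (h1 : C (ModuleCat.of A N)) (h2 : C (ModuleCat.of A (X ⧸ N))) : C X := by
  have := hC.extensions
  let S : ShortComplex (ModuleCat.{u} A) := ShortComplex.mk (ModuleCat.ofHom N.subtype)
    (ModuleCat.ofHom N.mkQ) (by ext x; simp)
  have hS : S.ShortExact := ModuleCat.shortComplex_shortExact S (LinearMap.exact_subtype_mkQ N)
    Subtype.val_injective N.mkQ_surjective
  exact ObjectProperty.IsClosedUnderExtensions.prop_X₂_of_shortExact hS h1 h2

lemma IsWide.range (hC : IsWide C) {X Y : ModuleCat.{u} A} (g : X →ₗ[A] Y) (hX : C X) (hY : C Y) :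
    C (ModuleCat.of A (LinearMap.range g)) := by
  have h := hC.ker (Y := ModuleCat.of A (Y ⧸ LinearMap.range g)) (LinearMap.range g).mkQ hY
    (hC.coker g hX hY)
  rwa [Submodule.ker_mkQ] at h

lemma IsWide.isAdditiveClass (hC : IsWide C) : IsAdditiveClass C where
  fg X hX := hC.le_fg X hX
  of_equiv e h := hC.of_equiv e h
  pi ι _ X hX :=
    have := hC.finiteProducts
    C.prop_of_isLimit_fan (ModuleCat.productConeIsLimit X) hX
  summand X N N' hc hX := by
    have h := hC.range (X := X) (Y := X) (N.projection N' hc) hX hX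
    rwa [Submodule.range_projection] at h

end Wide

/-! ### Modules on which a map becomes invertible -/

section HomIso

variable {A : Type u} [Ring A] {P Q : ModuleCat.{u} A} {σ : P ⟶ Q}

lemma homIso_iff {Y : ModuleCat.{u} A} : HomIso σ Y ↔
    (∀ φ : Q →ₗ[A] Y, φ ∘ₗ σ.hom = 0 → φ = 0) ∧
      ∀ ψ : P →ₗ[A] Y, ∃ φ : Q →ₗ[A] Y, φ ∘ₗ σ.hom = ψ := by
  constructor
  · rintro ⟨h1, h2⟩
    refine ⟨fun φ hφ => ?_, fun ψ => ?_⟩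
    · have : ModuleCat.ofHom φ = 0 := h1 (by
        ext1
        simpa using hφ)
      simpa using congrArg ModuleCat.Hom.hom this
    · obtain ⟨φ, hφ⟩ := h2 (ModuleCat.ofHom ψ)
      exact ⟨φ.hom, by simpa using congrArg ModuleCat.Hom.hom hφ⟩
  · rintro ⟨h1, h2⟩
    refine ⟨fun φ ψ h => ?_, fun ψ => ?_⟩
    · have h3 := h1 (φ.hom - ψ.hom) (by
        rw [LinearMap.sub_comp, sub_eq_zero]
        simpa using congrArg ModuleCat.Hom.hom h)
      ext1
      exact sub_eq_zero.1 h3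
    · obtain ⟨φ, hφ⟩ := h2 ψ.hom
      exact ⟨ModuleCat.ofHom φ, by ext1; simpa using hφ⟩

lemma HomIso.of_retract {Y Z : ModuleCat.{u} A} (h : HomIso σ Z) (i : Y →ₗ[A] Z) (r : Z →ₗ[A] Y)
    (hr : r ∘ₗ i = LinearMap.id) : HomIso σ Y := by
  rw [homIso_iff] at h ⊢
  refine ⟨fun φ hφ => ?_, fun ψ => ?_⟩
  · have h1 := h.1 (i ∘ₗ φ) (by rw [LinearMap.comp_assoc, hφ, LinearMap.comp_zero])
    rw [← LinearMap.id_comp φ, ← hr, LinearMap.comp_assoc, h1, LinearMap.comp_zero]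
  · obtain ⟨φ, hφ⟩ := h.2 (i ∘ₗ ψ)
    exact ⟨r ∘ₗ φ, by rw [LinearMap.comp_assoc, hφ, ← LinearMap.comp_assoc, hr, LinearMap.id_comp]⟩

lemma HomIso.of_equiv {Y Z : ModuleCat.{u} A} (h : HomIso σ Z) (e : Y ≃ₗ[A] Z) : HomIso σ Y :=
  h.of_retract e.toLinearMap e.symm.toLinearMap (by ext; simp)

lemma HomIso.summand {Y : ModuleCat.{u} A} (h : HomIso σ Y) {N N' : Submodule A Y}
    (hc : IsCompl N N') : HomIso σ (ModuleCat.of A N) :=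
  HomIso.of_retract (Y := ModuleCat.of A N) h N.subtype (N.projectionOnto N' hc)
    (Submodule.projectionOnto_comp_subtype hc)

/-- The product is given by its universal property so that the restriction of the `B`-module `Fin n
→ B` also qualifies. -/
lemma HomIso.pi {ι : Type*} {X : ι → ModuleCat.{u} A} {Y : ModuleCat.{u} A}
    (p : ∀ i, Y →ₗ[A] X i) (hp : ∀ (Z : ModuleCat.{u} A) (f : ∀ i, Z →ₗ[A] X i),
      ∃! g : Z →ₗ[A] Y, ∀ i, p i ∘ₗ g = f i) (h : ∀ i, HomIso σ (X i)) : HomIso σ Y := by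
  simp only [homIso_iff] at h ⊢
  refine ⟨fun φ hφ => ?_, fun ψ => ?_⟩
  · obtain ⟨g, -, hg⟩ := hp Q 0
    rw [hg φ fun i => (h i).1 _ (by rw [LinearMap.comp_assoc, hφ, LinearMap.comp_zero]),
      hg 0 fun i => LinearMap.comp_zero _]
  · choose φ hφ using fun i => (h i).2 (p i ∘ₗ ψ)
    obtain ⟨g, hg, -⟩ := hp Q φ
    obtain ⟨k, -, hk⟩ := hp P fun i => p i ∘ₗ ψ
    refine ⟨g, ?_⟩
    rw [hk ψ fun i => rfl, hk (g ∘ₗ σ.hom) fun i => by rw [← LinearMap.comp_assoc, hg, hφ]]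

/-- This and the next two lemmas are instances of the five lemma for `Hom(Q, -) → Hom(P, -)`.
Kernels need no projectivity, so this one also applies to `unitHom f`, whose target `B` need not be
projective. -/
lemma HomIso.ker {X Y Z : ModuleCat.{u} A} (hX : HomIso σ X) (hY : HomIso σ Y) (i : Z →ₗ[A] X)
    (g : X →ₗ[A] Y) (hi : Function.Injective i) (hex : LinearMap.range i = LinearMap.ker g) :
    HomIso σ Z := by
  rw [homIso_iff] at hX hY ⊢
  refine ⟨fun φ hφ => ?_, fun ψ => ?_⟩
  · have h1 := hX.1 (i ∘ₗ φ) (by rw [LinearMap.comp_assoc, hφ, LinearMap.comp_zero])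
    ext x
    exact hi (by simpa using LinearMap.congr_fun h1 x)
  · obtain ⟨φ, hφ⟩ := hX.2 (i ∘ₗ ψ)
    have h1 := hY.1 (g ∘ₗ φ) (by
      rw [LinearMap.comp_assoc, hφ, ← LinearMap.comp_assoc, LinearMap.range_le_ker_iff.1 hex.le,
        LinearMap.zero_comp])
    have h2 : ∀ x, φ x ∈ LinearMap.range i := fun x => by
      rw [hex]
      exact LinearMap.congr_fun h1 x
    refine ⟨(LinearEquiv.ofInjective i hi).symm.toLinearMap ∘ₗ φ.codRestrict _ h2, ?_⟩
    ext x
    apply hi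
    have h3 : ∀ z : LinearMap.range i, i ((LinearEquiv.ofInjective i hi).symm z) = z := fun z => by
      rw [← LinearEquiv.ofInjective_apply (h := hi), LinearEquiv.apply_symm_apply]
    simpa [h3] using LinearMap.congr_fun hφ x

lemma HomIso.coker (hP : Module.Projective A P) (hQ : Module.Projective A Q)
    {X Y Z : ModuleCat.{u} A} (hX : HomIso σ X) (hY : HomIso σ Y)
    (g : X →ₗ[A] Y) (p : Y →ₗ[A] Z) (hp : Function.Surjective p) (hex : LinearMap.range g = LinearMap.ker p) :
    HomIso σ Z := by
  rw [homIso_iff] at hX hY ⊢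
  refine ⟨fun φ hφ => ?_, fun ψ => ?_⟩
  · obtain ⟨φ', hφ'⟩ := Module.projective_lifting_property p φ hp
    have h1 : ∀ x, (φ' ∘ₗ σ.hom) x ∈ LinearMap.range g := fun x => by
      rw [hex, LinearMap.mem_ker, ← LinearMap.comp_apply, ← LinearMap.comp_assoc, hφ', hφ]
      rfl
    obtain ⟨θ, hθ⟩ := Module.projective_lifting_property g.rangeRestrict
      ((φ' ∘ₗ σ.hom).codRestrict _ h1) g.surjective_rangeRestrict
    obtain ⟨θ', hθ'⟩ := hX.2 θ
    have h2 : g ∘ₗ θ = φ' ∘ₗ σ.hom := by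
      ext x
      exact congrArg Subtype.val (LinearMap.congr_fun hθ x)
    have h3 := hY.1 (φ' - g ∘ₗ θ') (by
      rw [LinearMap.sub_comp, LinearMap.comp_assoc, hθ', h2, sub_self])
    rw [← hφ', sub_eq_zero.1 h3, ← LinearMap.comp_assoc, LinearMap.range_le_ker_iff.1 hex.le,
      LinearMap.zero_comp]
  · obtain ⟨ψ', hψ'⟩ := Module.projective_lifting_property p ψ hp
    obtain ⟨φ, hφ⟩ := hY.2 ψ'
    exact ⟨p ∘ₗ φ, by rw [LinearMap.comp_assoc, hφ, hψ']⟩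

lemma HomIso.ext (hQ : Module.Projective A Q) {X Y Z : ModuleCat.{u} A} (hX : HomIso σ X)
    (hZ : HomIso σ Z) (i : X →ₗ[A] Y) (p : Y →ₗ[A] Z) (hi : Function.Injective i) (hp : Function.Surjective p)
    (hex : LinearMap.range i = LinearMap.ker p) : HomIso σ Y := by
  have hlift : ∀ {R : ModuleCat.{u} A} (φ : R →ₗ[A] Y), p ∘ₗ φ = 0 →
      ∃ χ : R →ₗ[A] X, i ∘ₗ χ = φ := by
    intro R φ hφ
    have h2 : ∀ x, φ x ∈ LinearMap.range i := fun x => by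
      rw [hex]
      exact LinearMap.congr_fun hφ x
    refine ⟨(LinearEquiv.ofInjective i hi).symm.toLinearMap ∘ₗ φ.codRestrict _ h2, ?_⟩
    ext x
    change i ((LinearEquiv.ofInjective i hi).symm _) = _
    rw [← LinearEquiv.ofInjective_apply (h := hi), LinearEquiv.apply_symm_apply]
    rfl
  have hpi : p ∘ₗ i = 0 := LinearMap.range_le_ker_iff.1 hex.le
  rw [homIso_iff] at hX hZ ⊢
  refine ⟨fun φ hφ => ?_, fun ψ => ?_⟩
  · obtain ⟨χ, rfl⟩ := hlift φ (hZ.1 _ (by rw [LinearMap.comp_assoc, hφ, LinearMap.comp_zero]))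
    rw [hX.1 χ, LinearMap.comp_zero]
    ext x
    exact hi (by simpa using LinearMap.congr_fun hφ x)
  · obtain ⟨φ, hφ⟩ := hZ.2 (p ∘ₗ ψ)
    obtain ⟨φ', rfl⟩ := Module.projective_lifting_property p φ hp
    obtain ⟨χ, hχ⟩ := hlift (ψ - φ' ∘ₗ σ.hom) (by
      rw [LinearMap.comp_sub, ← hφ, LinearMap.comp_assoc, sub_self])
    obtain ⟨χ', rfl⟩ := hX.2 χ
    refine ⟨φ' + i ∘ₗ χ', ?_⟩
    rw [LinearMap.add_comp, LinearMap.comp_assoc, hχ, add_sub_cancel]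

end HomIso

/-! ### Minimal projective presentations -/

section Presentation

variable {A : Type u} [Ring A]

/-- The range of `f` and `ker g` span `P`, so `f` is surjective by superfluousness, and then
injective because `P` is noetherian; `e` is its inverse. -/
lemma exists_equiv_of_superfluous_ker [IsNoetherianRing A] {P Z : Type u} [AddCommGroup P]
    [Module A P] [Module.Finite A P] [AddCommGroup Z] [Module A Z] (g : P →ₗ[A] Z)
    (hg : IsSuperfluousSubmodule (LinearMap.ker g)) (f : P →ₗ[A] P) (hf : g ∘ₗ f = g) :
    ∃ e : P →ₗ[A] P, g ∘ₗ e = g ∧ e ∘ₗ f = LinearMap.id := by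
  have hsurj : Function.Surjective f := by
    rw [← LinearMap.range_eq_top]
    refine hg _ (eq_top_iff.2 fun x _ => ?_)
    rw [← sub_add_cancel x (f x)]
    refine Submodule.add_mem_sup ?_ (LinearMap.mem_range_self f x)
    rw [LinearMap.mem_ker, map_sub, sub_eq_zero]
    exact (LinearMap.congr_fun hf x).symm
  have hinj : Function.Injective f := IsNoetherian.injective_of_surjective_endomorphism f hsurj
  let e := LinearEquiv.ofBijective f ⟨hinj, hsurj⟩
  have he : e.symm.toLinearMap ∘ₗ f = LinearMap.id := by
    ext x
    exact e.symm_apply_apply x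
  have he' : f ∘ₗ e.symm.toLinearMap = LinearMap.id := by
    ext x
    exact e.apply_symm_apply x
  refine ⟨e.symm.toLinearMap, ?_, he⟩
  rw [← hf, LinearMap.comp_assoc, he', LinearMap.comp_id]
  exact hf.symm

/-- If some proper `L` still maps onto `M`, lifting `π` through `L` gives an endomorphism `f` of `P`
over `M` with image in `L`. By Fitting's lemma the range of a high power of `f` is a proper direct
summand that still maps onto `M`. -/
lemma exists_projectiveCover_of_surjective [IsArtinianRing A] {M : Type u} [AddCommGroup M]
    [Module A M] (P : ModuleCat.{u} A) (hP : IsFGProjective P) (π : P →ₗ[A] M)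
    (hπ : Function.Surjective π) : ∃ (P' : ModuleCat.{u} A) (π' : P' →ₗ[A] M), IsFGProjective P' ∧
      Function.Surjective π' ∧ IsSuperfluousSubmodule (LinearMap.ker π') := by
  induction h : Module.length A P using WellFoundedLT.induction generalizing P with
  | ind n ih =>
  subst h
  have := hP.1
  have := hP.2
  by_cases hsup : IsSuperfluousSubmodule (LinearMap.ker π)
  · exact ⟨P, π, hP, hπ, hsup⟩
  simp only [IsSuperfluousSubmodule, not_forall] at hsup
  obtain ⟨L, hL, hne⟩ := hsup
  have hsurj : Function.Surjective (π ∘ₗ L.subtype) := by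
    intro x
    obtain ⟨y, rfl⟩ := hπ x
    obtain ⟨k, hk, l, hl, rfl⟩ := Submodule.mem_sup.1
      (show y ∈ LinearMap.ker π ⊔ L from hL ▸ Submodule.mem_top)
    exact ⟨⟨l, hl⟩, by simpa using hk⟩
  obtain ⟨φ, hφ⟩ := Module.projective_lifting_property _ π hsurj
  let f : Module.End A P := L.subtype ∘ₗ φ
  have hf : ∀ x, π (f x) = π x := LinearMap.congr_fun hφ
  obtain ⟨k, hk⟩ := Filter.eventually_atTop.1 f.eventually_isCompl_ker_pow_range_pow
  -- The exponent `k + 1` guarantees at least one factor `f`, which puts the range inside `L`.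
  have hc := hk (k + 1) (Nat.le_succ k)
  have hpow : ∀ (j : ℕ) (x : P), π ((f ^ j) x) = π x := by
    intro j
    induction j with
    | zero => intro x; rfl
    | succ j ihj => intro x; rw [pow_succ', Module.End.mul_apply, hf, ihj]
  have hle : LinearMap.range (f ^ (k + 1)) ≤ L := by
    rintro _ ⟨x, rfl⟩
    rw [pow_succ', Module.End.mul_apply]
    exact (φ _).2
  have hlt : LinearMap.range (f ^ (k + 1)) ≠ ⊤ := fun h => hne (top_le_iff.1 (h ▸ hle))
  refine ih _ (Submodule.length_lt hlt) (ModuleCat.of A (LinearMap.range (f ^ (k + 1))))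
    ⟨inferInstanceAs (Module.Finite A (LinearMap.range (f ^ (k + 1)))),
      Module.Projective.of_split (Submodule.subtype _) (Submodule.projectionOnto _ _ hc.symm)
        (Submodule.projectionOnto_comp_subtype _)⟩ (π ∘ₗ Submodule.subtype _) ?_ rfl
  intro x
  obtain ⟨y, rfl⟩ := hπ x
  exact ⟨⟨_, LinearMap.mem_range_self (f ^ (k + 1)) y⟩, hpow (k + 1) y⟩

lemma exists_projectiveCover [IsArtinianRing A] (M : Type u) [AddCommGroup M]
    [Module A M] [Module.Finite A M] : ∃ (P : ModuleCat.{u} A) (π : P →ₗ[A] M),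
      IsFGProjective P ∧ Function.Surjective π ∧ IsSuperfluousSubmodule (LinearMap.ker π) := by
  obtain ⟨n, f, hf⟩ := Module.Finite.exists_fin' A M
  exact exists_projectiveCover_of_surjective (ModuleCat.of A (Fin n → A))
    ⟨inferInstanceAs (Module.Finite A (Fin n → A)),
      inferInstanceAs (Module.Projective A (Fin n → A))⟩ f hf

/-- Finitely generated modules over an artinian ring have minimal projective presentations. -/
lemma exists_isMinimalPresentation [IsArtinianRing A] (X : ModuleCat.{u} A)
    (hX : Module.Finite A X) : ∃ (P₁ P₀ : ModuleCat.{u} A) (σ : P₁ ⟶ P₀) (π : P₀ ⟶ X),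
      IsMinimalPresentation σ π := by
  obtain ⟨P₀, π, h1, h2, h3⟩ := exists_projectiveCover (A := A) X
  have := h1.1
  obtain ⟨P₁, ρ, k1, k2, k3⟩ := exists_projectiveCover (A := A) (LinearMap.ker π)
  refine ⟨P₁, P₀, ModuleCat.ofHom ((LinearMap.ker π).subtype ∘ₗ ρ), ModuleCat.ofHom π, k1, h1, h2,
    ?_, h3, ?_⟩
  · simp [LinearMap.range_comp, LinearMap.range_eq_top.2 k2]
  · simpa [LinearMap.ker_comp] using k3

/-- A minimal projective presentation is a retract of every projective presentation. -/
lemma IsMinimalPresentation.exists_retract [IsNoetherianRing A] {P₁ P₀ Q₁ Q₀ X : ModuleCat.{u} A}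
    {σ : P₁ ⟶ P₀} {π : P₀ ⟶ X} (h : IsMinimalPresentation σ π) (hQ₁ : Module.Projective A Q₁)
    (hQ₀ : Module.Projective A Q₀) (τ : Q₁ →ₗ[A] Q₀) (ρ : Q₀ →ₗ[A] X) (hρ : Function.Surjective ρ)
    (hex : LinearMap.range τ = LinearMap.ker ρ) :
    ∃ (α₁ : P₁ →ₗ[A] Q₁) (β₁ : Q₁ →ₗ[A] P₁) (α₀ : P₀ →ₗ[A] Q₀) (β₀ : Q₀ →ₗ[A] P₀),
      β₁ ∘ₗ α₁ = LinearMap.id ∧ β₀ ∘ₗ α₀ = LinearMap.id ∧ τ ∘ₗ α₁ = α₀ ∘ₗ σ.hom ∧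
        σ.hom ∘ₗ β₁ = β₀ ∘ₗ τ ∧ ρ ∘ₗ α₀ = π.hom ∧ π.hom ∘ₗ β₀ = ρ := by
  have := h.proj₀.1
  have := h.proj₁.1
  have := h.proj₀.2
  have := h.proj₁.2
  have hlift : ∀ {R S T : ModuleCat.{u} A} (_ : Module.Projective A R) (s : S →ₗ[A] T)
      (r : R →ₗ[A] T), LinearMap.range r ≤ LinearMap.range s → ∃ t : R →ₗ[A] S, s ∘ₗ t = r := by
    intro R S T _ s r hrs
    obtain ⟨t, ht⟩ := Module.projective_lifting_property s.rangeRestrict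
      (r.codRestrict _ fun x => hrs (LinearMap.mem_range_self r x)) s.surjective_rangeRestrict
    refine ⟨t, ?_⟩
    ext x
    exact congrArg Subtype.val (LinearMap.congr_fun ht x)
  have hπσ : π.hom ∘ₗ σ.hom = 0 := LinearMap.range_le_ker_iff.1 h.exact.le
  have hρτ : ρ ∘ₗ τ = 0 := LinearMap.range_le_ker_iff.1 hex.le
  obtain ⟨α₀, hα₀⟩ := Module.projective_lifting_property ρ π.hom hρ
  obtain ⟨β₀', hβ₀'⟩ := Module.projective_lifting_property π.hom ρ h.surjective
  -- The composite `β₀' ∘ₗ α₀` is an automorphism over `X`; composing with its inverse turns `β₀'`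
  -- into a retraction of `α₀`.
  obtain ⟨e, he, he'⟩ := exists_equiv_of_superfluous_ker π.hom h.superfluous₀ (β₀' ∘ₗ α₀)
    (by rw [← LinearMap.comp_assoc, hβ₀', hα₀])
  have hβ₀ : π.hom ∘ₗ (e ∘ₗ β₀') = ρ := by rw [← LinearMap.comp_assoc, he, hβ₀']
  obtain ⟨α₁, hα₁⟩ := hlift h.proj₁.2 τ (α₀ ∘ₗ σ.hom) (by
    rw [hex, LinearMap.range_le_ker_iff, ← LinearMap.comp_assoc, hα₀, hπσ])
  obtain ⟨β₁', hβ₁'⟩ := hlift hQ₁ σ.hom ((e ∘ₗ β₀') ∘ₗ τ) (by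
    rw [h.exact, LinearMap.range_le_ker_iff, ← LinearMap.comp_assoc, hβ₀, hρτ])
  obtain ⟨e₁, he₁, he₁'⟩ := exists_equiv_of_superfluous_ker σ.hom h.superfluous₁ (β₁' ∘ₗ α₁)
    (by
      rw [← LinearMap.comp_assoc, hβ₁', LinearMap.comp_assoc, hα₁, ← LinearMap.comp_assoc,
        LinearMap.comp_assoc α₀, he', LinearMap.id_comp])
  exact ⟨α₁, e₁ ∘ₗ β₁', α₀, e ∘ₗ β₀', by rw [LinearMap.comp_assoc, he₁'],
    by rw [LinearMap.comp_assoc, he'], hα₁, by rw [← LinearMap.comp_assoc, he₁, hβ₁'], hα₀, hβ₀⟩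

/-- `σ` is a retract of `τ`. In particular the condition does not depend on the chosen minimal
presentation. -/
lemma HomIso.of_presentation [IsNoetherianRing A] {P₁ P₀ Q₁ Q₀ X : ModuleCat.{u} A}
    {σ : P₁ ⟶ P₀} {π : P₀ ⟶ X} (h : IsMinimalPresentation σ π) (hQ₁ : Module.Projective A Q₁)
    (hQ₀ : Module.Projective A Q₀) {τ : Q₁ ⟶ Q₀} (ρ : Q₀ →ₗ[A] X) (hρ : Function.Surjective ρ)
    (hex : LinearMap.range τ.hom = LinearMap.ker ρ) {Y : ModuleCat.{u} A} (hY : HomIso τ Y) :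
    HomIso σ Y := by
  obtain ⟨α₁, β₁, α₀, β₀, h1, h0, hα, hβ, -, -⟩ := h.exists_retract hQ₁ hQ₀ τ.hom ρ hρ hex
  rw [homIso_iff] at hY ⊢
  refine ⟨fun φ hφ => ?_, fun ψ => ?_⟩
  · have := hY.1 (φ ∘ₗ β₀) (by
      rw [LinearMap.comp_assoc, ← hβ, ← LinearMap.comp_assoc, hφ, LinearMap.zero_comp])
    rw [← LinearMap.comp_id φ, ← h0, ← LinearMap.comp_assoc, this, LinearMap.zero_comp]
  · obtain ⟨φ, hφ⟩ := hY.2 (ψ ∘ₗ β₁)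
    exact ⟨φ ∘ₗ α₀, by rw [LinearMap.comp_assoc, ← hα, ← LinearMap.comp_assoc, hφ,
      LinearMap.comp_assoc, h1, LinearMap.comp_id]⟩

/-- `leftStar` asks for one minimal presentation while `rightStar` tests all of them, so two
presentations of `X` have to be compared. -/
lemma le_rightStar_leftStar [IsNoetherianRing A] {C : ObjectProperty (ModuleCat.{u} A)}
    (hC : C ≤ ModuleCat.isFG.{u} A) : C ≤ rightStar (leftStar C) := by
  intro Y hY
  refine ⟨hC Y hY, ?_⟩
  rintro P Q σ ⟨X, π, ⟨-, P₁, P₀, τ, ρ, hτ, h⟩, hσ⟩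
  exact HomIso.of_presentation hσ hτ.proj₁.2 hτ.proj₀.2 ρ.hom hτ.surjective hτ.exact (h Y hY)

/-- Maps between finitely generated projective modules that are inverted on `C` are inverted on all
modules in `(*C)*`. -/
lemma HomIso.of_rightStar_leftStar [IsArtinianRing A] {C : ObjectProperty (ModuleCat.{u} A)}
    {Q₁ Q₀ : ModuleCat.{u} A} (hQ₁ : IsFGProjective Q₁) (hQ₀ : IsFGProjective Q₀) (τ : Q₁ ⟶ Q₀)
    (hC : ∀ Z, C Z → HomIso τ Z) {Y : ModuleCat.{u} A} (hY : rightStar (leftStar C) Y) :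
    HomIso τ Y := by
  have := hQ₁.1
  have := hQ₀.1
  have := hQ₁.2
  have := hQ₀.2
  -- `τ` is the direct sum of the minimal presentation `σ` of its cokernel, an isomorphism, and a
  -- map `P' → 0`. If `C` inverts `τ`, then both the cokernel and `P'` belong to `*C`, so `Y`
  -- inverts every summand.
  let X : ModuleCat.{u} A := ModuleCat.of A (Q₀ ⧸ LinearMap.range τ.hom)
  let ρ : Q₀ →ₗ[A] X := (LinearMap.range τ.hom).mkQ
  have hρ : Function.Surjective ρ := Submodule.mkQ_surjective _
  have hex : LinearMap.range τ.hom = LinearMap.ker ρ := (Submodule.ker_mkQ _).symm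
  obtain ⟨P₁, P₀, σ, π, hσ⟩ := exists_isMinimalPresentation X
    (inferInstanceAs (Module.Finite A (Q₀ ⧸ LinearMap.range τ.hom)))
  obtain ⟨α₁, β₁, α₀, β₀, h1, h0, hα, hβ, hα', hβ'⟩ :=
    hσ.exists_retract hQ₁.2 hQ₀.2 τ.hom ρ hρ hex
  have hσY : HomIso σ Y := hY.2 σ ⟨X, π, ⟨inferInstanceAs
    (Module.Finite A (Q₀ ⧸ LinearMap.range τ.hom)), P₁, P₀, σ, π, hσ, fun Z hZ =>
      HomIso.of_presentation hσ hQ₁.2 hQ₀.2 ρ hρ hex (hC Z hZ)⟩, hσ⟩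
  rw [homIso_iff] at hσY ⊢
  -- `p` and `q` are the idempotents cutting out the minimal presentation
  let p : Module.End A Q₁ := α₁ ∘ₗ β₁
  let q : Module.End A Q₀ := α₀ ∘ₗ β₀
  have hp : p * p = p := by
    change (α₁ ∘ₗ β₁) ∘ₗ (α₁ ∘ₗ β₁) = α₁ ∘ₗ β₁
    rw [LinearMap.comp_assoc, ← LinearMap.comp_assoc β₁, h1, LinearMap.id_comp]
  have hq : q * q = q := by
    change (α₀ ∘ₗ β₀) ∘ₗ (α₀ ∘ₗ β₀) = α₀ ∘ₗ β₀
    rw [LinearMap.comp_assoc, ← LinearMap.comp_assoc β₀, h0, LinearMap.id_comp]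
  have hτp : τ.hom ∘ₗ p = q ∘ₗ τ.hom := by
    change τ.hom ∘ₗ (α₁ ∘ₗ β₁) = (α₀ ∘ₗ β₀) ∘ₗ τ.hom
    rw [← LinearMap.comp_assoc, hα, LinearMap.comp_assoc, hβ, LinearMap.comp_assoc]
  have hρq : ρ ∘ₗ q = ρ := by
    change ρ ∘ₗ (α₀ ∘ₗ β₀) = ρ
    rw [← LinearMap.comp_assoc, hα', hβ']
  obtain ⟨s, hs⟩ : ∃ s : Q₀ →ₗ[A] Q₁, τ.hom ∘ₗ s = 1 - q := by
    obtain ⟨t, ht⟩ := Module.projective_lifting_property τ.hom.rangeRestrict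
      ((1 - q).codRestrict (LinearMap.range τ.hom) fun x => by
        rw [hex, LinearMap.mem_ker, LinearMap.sub_apply, map_sub, sub_eq_zero]
        exact (LinearMap.congr_fun hρq x).symm) τ.hom.surjective_rangeRestrict
    refine ⟨t, ?_⟩
    ext x
    exact congrArg Subtype.val (LinearMap.congr_fun ht x)
  have e1 : ∀ x, τ.hom (s x) = x - q x := LinearMap.congr_fun hs
  have e2 : ∀ x, τ.hom (p x) = q (τ.hom x) := LinearMap.congr_fun hτp
  have e3 : ∀ x, p (p x) = p x := LinearMap.congr_fun hp
  have e4 : ∀ x, q (q x) = q x := LinearMap.congr_fun hq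
  -- Cutting `s` down by the complementary idempotents makes it take values in `ker p` while keeping
  -- `τ ∘ s' = 1 - q`.
  let s' : Q₀ →ₗ[A] Q₁ := (1 - p : Module.End A Q₁) ∘ₗ s ∘ₗ (1 - q : Module.End A Q₀)
  have e5 : ∀ x, s' x = s (x - q x) - p (s (x - q x)) := fun x => rfl
  have e6 : ∀ x, τ.hom (s' x) = x - q x := fun x => by
    rw [e5, map_sub, e2, e1, map_sub, map_sub, map_sub, e4]
    simp
  have e7 : ∀ x, p (s' x) = 0 := fun x => by rw [e5, map_sub, e3, sub_self]
  -- The idempotent onto the summand `P'`, on which `τ` vanishes.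
  let δ : Q₁ →ₗ[A] Q₁ := LinearMap.id - p - s' ∘ₗ τ.hom
  have e9 : ∀ x, δ x = x - p x - s' (τ.hom x) := fun x => rfl
  have e10 : ∀ x, τ.hom (δ x) = 0 := fun x => by
    rw [e9, map_sub, map_sub, e2, e6, sub_self]
  have e11 : ∀ x, δ (δ x) = δ x := fun x => by
    have : p (δ x) = 0 := by rw [e9, map_sub, map_sub, e3, sub_self, e7, sub_zero]
    rw [e9 (δ x), this, e10, map_zero, sub_zero, sub_zero]
  let P' : ModuleCat.{u} A := ModuleCat.of A (LinearMap.range δ)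
  have hδ' : ∀ x : LinearMap.range δ, δ x = x := by
    rintro ⟨_, y, rfl⟩
    exact e11 y
  have hP' : IsFGProjective P' := ⟨inferInstanceAs (Module.Finite A (LinearMap.range δ)),
    Module.Projective.of_split (LinearMap.range δ).subtype δ.rangeRestrict
      (by ext x; exact hδ' x)⟩
  have hzero : ∀ Z, C Z → ∀ θ : P' →ₗ[A] Z, θ = 0 := by
    intro Z hZ θ
    obtain ⟨φ, hφ⟩ := (homIso_iff.1 (hC Z hZ)).2 (θ ∘ₗ δ.rangeRestrict)
    ext x
    have h2 := LinearMap.congr_fun hφ x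
    have h3 : δ.rangeRestrict x = x := Subtype.ext (hδ' x)
    rw [LinearMap.comp_apply, LinearMap.comp_apply, h3, ← hδ' x, e10, map_zero] at h2
    exact h2.symm
  -- The minimal presentation `0 → P'` of the projective module `P'`; inverting it means that
  -- `Hom(P', -)` vanishes.
  let τ' : ModuleCat.of A PUnit.{u + 1} ⟶ P' := 0
  have hmin : IsMinimalPresentation τ' (𝟙 P') :=
    { proj₁ := ⟨inferInstanceAs (Module.Finite A PUnit.{u + 1}),
        inferInstanceAs (Module.Projective A PUnit.{u + 1})⟩
      proj₀ := hP'
      surjective := fun x => ⟨x, rfl⟩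
      exact := by simp [τ']
      superfluous₀ := fun L hL => by simpa using hL
      superfluous₁ := fun L hL => Subsingleton.elim (α := Submodule A PUnit.{u + 1}) _ _ }
  have hPU : ∀ (Z : ModuleCat.{u} A) (θ θ' : ModuleCat.of A PUnit.{u + 1} →ₗ[A] Z), θ = θ' :=
    fun Z θ θ' => LinearMap.ext fun x => by
      rw [show x = 0 from rfl, map_zero, map_zero]
  have hYP : ∀ θ : P' →ₗ[A] Y, θ = 0 := by
    have h2 : HomIso τ' Y := hY.2 τ' ⟨P', 𝟙 P', ⟨hP'.1, _, _, τ', 𝟙 P', hmin, fun Z hZ => by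
      rw [homIso_iff]
      exact ⟨fun φ _ => hzero Z hZ φ, fun ψ => ⟨0, hPU Z _ _⟩⟩⟩, hmin⟩
    rw [homIso_iff] at h2
    exact fun θ => h2.1 θ (hPU Y _ _)
  refine ⟨fun φ hφ => ?_, fun ψ => ?_⟩
  · -- `φ` factors through the cokernel of `τ`
    have h2 : φ ∘ₗ α₀ = 0 := hσY.1 _ (by
      rw [LinearMap.comp_assoc, ← hα, ← LinearMap.comp_assoc, hφ, LinearMap.zero_comp])
    ext x
    have h3 : φ (τ.hom (s x)) = 0 := LinearMap.congr_fun hφ (s x)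
    have h4 : φ (q x) = 0 := LinearMap.congr_fun h2 (β₀ x)
    rw [e1, map_sub, h4, sub_zero] at h3
    exact h3
  · obtain ⟨c, hc⟩ := hσY.2 (ψ ∘ₗ α₁)
    refine ⟨c ∘ₗ β₀ + ψ ∘ₗ s', ?_⟩
    ext x
    have h2 : ψ (δ x) = 0 := LinearMap.congr_fun (hYP (ψ ∘ₗ (LinearMap.range δ).subtype))
      ⟨δ x, LinearMap.mem_range_self δ x⟩
    have h3 : c (β₀ (τ.hom x)) = ψ (p x) := by
      rw [← LinearMap.comp_apply β₀, ← hβ]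
      exact LinearMap.congr_fun hc (β₁ x)
    rw [e9, map_sub, map_sub, sub_sub, sub_eq_zero] at h2
    rw [h2, ← h3]
    rfl

end Presentation

/-! ### Factoring linear maps through injections and surjections -/

section Factor

variable {A : Type u} [Ring A] {X Y Z : Type u} [AddCommGroup X] [Module A X] [AddCommGroup Y]
  [Module A Y] [AddCommGroup Z] [Module A Z]

lemma exists_comp_eq_of_range_le (j : Y →ₗ[A] Z) (hj : Function.Injective j) (f : X →ₗ[A] Z)
    (h : ∀ x, f x ∈ LinearMap.range j) : ∃ g : X →ₗ[A] Y, ∀ x, j (g x) = f x := by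
  refine ⟨(LinearEquiv.ofInjective j hj).symm.toLinearMap ∘ₗ f.codRestrict _ h, fun x => ?_⟩
  change j ((LinearEquiv.ofInjective j hj).symm _) = _
  rw [← LinearEquiv.ofInjective_apply (h := hj), LinearEquiv.apply_symm_apply]
  rfl

lemma exists_comp_eq_of_ker_le (q : X →ₗ[A] Y) (hq : Function.Surjective q) (f : X →ₗ[A] Z)
    (h : LinearMap.ker q ≤ LinearMap.ker f) : ∃ g : Y →ₗ[A] Z, ∀ x, g (q x) = f x := by
  refine ⟨(LinearMap.ker q).liftQ f h ∘ₗ (q.quotKerEquivOfSurjective hq).symm.toLinearMap,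
    fun x => ?_⟩
  have : (q.quotKerEquivOfSurjective hq).symm (q x) = (LinearMap.ker q).mkQ x := by
    rw [LinearEquiv.symm_apply_eq]
    rfl
  simp [this]

end Factor

/-! ### The torsion class generated by a class of modules -/

section Torsion

variable {A : Type u} [Ring A] {C : ObjectProperty (ModuleCat.{u} A)}

/-- The torsion class generated by `C`: the finitely generated modules all of whose nonzero quotients
receive a nonzero map from a module in `C`. -/
def torsionClosure (C : ObjectProperty (ModuleCat.{u} A)) : ObjectProperty (ModuleCat.{u} A) :=
  fun Y => Module.Finite A Y ∧ ∀ (W : ModuleCat.{u} A) (p : Y →ₗ[A] W), Function.Surjective p →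
    Nontrivial W → ∃ Z : ModuleCat.{u} A, C Z ∧ ∃ φ : Z →ₗ[A] W, φ ≠ 0

lemma torsionClosure_of_surjective {X Y : ModuleCat.{u} A} (hX : torsionClosure C X)
    (q : X →ₗ[A] Y) (hq : Function.Surjective q) : torsionClosure C Y :=
  have := hX.1
  ⟨Module.Finite.of_surjective q hq, fun W p hp hW => hX.2 W (p ∘ₗ q) (hp.comp hq) hW⟩

lemma torsionClosure_exists_ne_zero {X W : ModuleCat.{u} A} (hX : torsionClosure C X)
    (f : X →ₗ[A] W) (hf : f ≠ 0) : ∃ Z : ModuleCat.{u} A, C Z ∧ ∃ φ : Z →ₗ[A] W, φ ≠ 0 := by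
  have hne : Nontrivial (LinearMap.range f) := by
    rw [Submodule.nontrivial_iff_ne_bot, Ne, LinearMap.range_eq_bot]
    exact hf
  obtain ⟨Z, hZ, φ, hφ⟩ := hX.2 (ModuleCat.of A (LinearMap.range f)) f.rangeRestrict
    f.surjective_rangeRestrict hne
  refine ⟨Z, hZ, (LinearMap.range f).subtype ∘ₗ φ, fun h => hφ ?_⟩
  ext x
  exact LinearMap.congr_fun h x

lemma le_torsionClosure (hC : C ≤ ModuleCat.isFG.{u} A) : C ≤ torsionClosure C := by
  refine fun Y hY => ⟨hC Y hY, fun W p hp hW => ⟨Y, hY, p, ?_⟩⟩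
  rintro rfl
  obtain ⟨w, hw⟩ := exists_ne (0 : W)
  obtain ⟨y, rfl⟩ := hp w
  exact hw rfl

/-- A quotient map of `Y` is either nonzero on `X` or factors through `Z`. Neither injectivity of
`i` nor exactness at `Y` is needed, so images of torsion modules serve as left ends. -/
lemma torsionClosure_ext [IsArtinianRing A] {X Y Z : ModuleCat.{u} A} (hX : torsionClosure C X)
    (hZ : torsionClosure C Z) (i : X →ₗ[A] Y) (q : Y →ₗ[A] Z) (hq : Function.Surjective q)
    (hex : LinearMap.ker q ≤ LinearMap.range i) : torsionClosure C Y := by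
  have := hX.1
  have := hZ.1
  constructor
  · refine ⟨Submodule.fg_of_fg_map_of_fg_inf_ker q ?_ ?_⟩
    · rw [Submodule.map_top, LinearMap.range_eq_top.2 hq]
      exact Module.Finite.fg_top
    · rw [top_inf_eq]
      exact Submodule.FG.of_le_fg (by
        rw [LinearMap.range_eq_map]
        exact Module.Finite.fg_top.map i) hex
  · intro W p hp hW
    by_cases h : p ∘ₗ i = 0
    · obtain ⟨p', hp'⟩ := exists_comp_eq_of_ker_le q hq p
        (hex.trans (LinearMap.range_le_ker_iff.2 h))
      refine hZ.2 W p' (fun w => ?_) hW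
      obtain ⟨y, rfl⟩ := hp w
      exact ⟨q y, hp' y⟩
    · exact torsionClosure_exists_ne_zero hX (p ∘ₗ i) h

lemma torsionClosure_isAdditiveClass : IsAdditiveClass (torsionClosure C) where
  fg X hX := hX.1
  of_equiv e h := torsionClosure_of_surjective h e.toLinearMap e.surjective
  pi ι _ X hX := by
    have := fun i => (hX i).1
    refine ⟨inferInstanceAs (Module.Finite A (∀ i, X i)), fun W p hp hW => ?_⟩
    classical
    have : ∃ i, p ∘ₗ LinearMap.single A (fun i => X i) i ≠ 0 := by
      by_contra! h
      have h0 : p = 0 := LinearMap.pi_ext' (φ := fun i => X i) fun i => by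
        rw [h i, LinearMap.zero_comp]
      obtain ⟨w, hw⟩ := exists_ne (0 : W)
      obtain ⟨y, rfl⟩ := hp w
      exact hw (by rw [h0]; rfl)
    obtain ⟨i, hi⟩ := this
    exact torsionClosure_exists_ne_zero (hX i) _ hi
  summand X N N' hc hX := torsionClosure_of_surjective (Y := ModuleCat.of A N) hX
    (N.projectionOnto N' hc) (Submodule.projectionOnto_surjective hc)

variable [IsArtinianRing A] (hC : IsWide C)

include hC

omit [IsArtinianRing A] in
lemma IsWide.of_subsingleton (X : ModuleCat.{u} A) [Subsingleton X] : C X :=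
  hC.of_equiv (X := ModuleCat.of A (∀ i : PEmpty.{u + 1}, (i.elim : ModuleCat.{u} A)))
    { toFun := fun _ => 0, invFun := fun _ => 0, map_add' := by simp, map_smul' := by simp,
      left_inv := fun _ => funext fun i => i.elim,
      right_inv := fun _ => Subsingleton.elim _ _ }
    (hC.isAdditiveClass.pi PEmpty.{u + 1} _ fun i => i.elim)

/-- Kernels of maps from the torsion class generated by a wide subcategory `C` to `C` are torsion. -/
lemma IsWide.torsionClosure_ker (Y Z : ModuleCat.{u} A) (hY : torsionClosure C Y) (hZ : C Z)
    (g : Y →ₗ[A] Z) : torsionClosure C (ModuleCat.of A (LinearMap.ker g)) := by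
  induction h : Module.length A Y using WellFoundedLT.induction generalizing Y Z with
  | ind n ih =>
  subst h
  have := hY.1
  cases subsingleton_or_nontrivial Y
  · exact torsionClosure_of_surjective (Y := ModuleCat.of A (LinearMap.ker g)) hY 0
      fun x => ⟨0, Subsingleton.elim (α := LinearMap.ker g) _ _⟩
  obtain ⟨Z₁, hZ₁, φ, hφ⟩ := hY.2 Y LinearMap.id (fun x => ⟨x, rfl⟩) inferInstance
  -- For a nonzero map `φ` from a module of `C` to `Y`, `ker g` is an extension of the kernel of the
  -- induced map `Y / im φ → Z / im (g φ)` by an image of `ker (g φ)`. The former is torsion by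
  -- induction, the latter since `ker (g φ)` lies in `C`.
  have h1 := ih (Module.length A (Y ⧸ LinearMap.range φ))
    (Submodule.length_quotient_lt _ fun h => hφ (LinearMap.range_eq_bot.1 h))
    (ModuleCat.of A (Y ⧸ LinearMap.range φ)) (ModuleCat.of A (Z ⧸ LinearMap.range (g ∘ₗ φ)))
    (torsionClosure_of_surjective (Y := ModuleCat.of A (Y ⧸ LinearMap.range φ)) hY
      (LinearMap.range φ).mkQ (Submodule.mkQ_surjective _))
    (hC.coker _ hZ₁ hZ)
    (Submodule.mapQ _ _ g (by rintro _ ⟨z, rfl⟩; exact ⟨z, rfl⟩)) rfl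
  refine torsionClosure_ext (Y := ModuleCat.of A (LinearMap.ker g))
    (le_torsionClosure hC.le_fg _ (hC.ker (g ∘ₗ φ) hZ₁ hZ)) h1
    ((φ ∘ₗ Submodule.subtype _).codRestrict (LinearMap.ker g) fun z => z.2)
    (((LinearMap.range φ).mkQ ∘ₗ Submodule.subtype _).codRestrict _ fun y => ?_) ?_ ?_
  · have h2 : g y = 0 := y.2
    simp [h2]
  · rintro ⟨y, hy⟩
    obtain ⟨y, rfl⟩ := Submodule.mkQ_surjective _ y
    obtain ⟨z, hz⟩ : g y ∈ LinearMap.range (g ∘ₗ φ) := by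
      rw [← Submodule.Quotient.mk_eq_zero]
      exact hy
    refine ⟨⟨y - φ z, by simpa [sub_eq_zero] using hz.symm⟩, Subtype.ext ?_⟩
    change (LinearMap.range φ).mkQ (y - φ z) = (LinearMap.range φ).mkQ y
    rw [map_sub, sub_eq_self]
    exact (Submodule.Quotient.mk_eq_zero _).2 (LinearMap.mem_range_self φ z)
  · rintro ⟨y, hy⟩ hy'
    obtain ⟨z, rfl⟩ : y ∈ LinearMap.range φ := by
      rw [← Submodule.Quotient.mk_eq_zero]
      exact congrArg Subtype.val hy'
    exact ⟨⟨z, hy⟩, rfl⟩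

/-- As long as `ker π` is nonzero it is torsion and receives a nonzero map from `C`; dividing `Y` by
its image stays in `C` and shortens `Y`. -/
lemma IsWide.of_surjective_of_torsionClosure_ker (X Y : ModuleCat.{u} A) (hY : C Y)
    (hX : ∀ M : ModuleCat.{u} A, torsionClosure C M → ∀ g : M →ₗ[A] X,
      torsionClosure C (ModuleCat.of A (LinearMap.ker g)))
    (π : Y →ₗ[A] X) (hπ : Function.Surjective π) : C X := by
  induction h : Module.length A Y using WellFoundedLT.induction generalizing Y with
  | ind n ih =>
  subst h
  have : Module.Finite A Y := hC.le_fg Y hY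
  cases subsingleton_or_nontrivial (LinearMap.ker π)
  · refine hC.of_equiv (LinearEquiv.ofBijective π ⟨?_, hπ⟩) hY
    rw [← LinearMap.ker_eq_bot]
    exact (Submodule.subsingleton_iff_eq_bot).1 inferInstance
  obtain ⟨Z, hZ, φ, hφ⟩ := (hX Y (le_torsionClosure hC.le_fg Y hY) π).2
    (ModuleCat.of A (LinearMap.ker π)) LinearMap.id (fun x => ⟨x, rfl⟩)
    (inferInstanceAs (Nontrivial (LinearMap.ker π)))
  let ψ : Z →ₗ[A] Y := (LinearMap.ker π).subtype ∘ₗ φ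
  have hψ : LinearMap.range ψ ≠ ⊥ := fun h => hφ (by
    ext z
    exact LinearMap.congr_fun (LinearMap.range_eq_bot.1 h) z)
  have hle : LinearMap.range ψ ≤ LinearMap.ker π := by
    rintro _ ⟨z, rfl⟩
    exact (φ z).2
  refine ih _ (Submodule.length_quotient_lt _ hψ) (ModuleCat.of A (Y ⧸ LinearMap.range ψ))
    (hC.coker ψ hZ hY) ((LinearMap.range ψ).liftQ π hle) (fun x => ?_) rfl
  obtain ⟨y, rfl⟩ := hπ x
  exact ⟨(LinearMap.range ψ).mkQ y, rfl⟩

/-- A torsion module `X` lies in the wide subcategory `C` if the torsion class generated by `C`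
is closed under kernels of maps to `X`. -/
lemma IsWide.of_torsionClosure_ker (X : ModuleCat.{u} A) (hX : torsionClosure C X)
    (hker : ∀ M : ModuleCat.{u} A, torsionClosure C M → ∀ g : M →ₗ[A] X,
      torsionClosure C (ModuleCat.of A (LinearMap.ker g))) : C X := by
  induction h : Module.length A X using WellFoundedLT.induction generalizing X with
  | ind n ih =>
  subst h
  have := hX.1
  cases subsingleton_or_nontrivial X
  · exact hC.of_subsingleton X
  obtain ⟨Z, hZ, φ, hφ⟩ := hX.2 X LinearMap.id (fun x => ⟨x, rfl⟩) inferInstance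
  by_cases htop : LinearMap.range φ = ⊤
  · exact hC.of_surjective_of_torsionClosure_ker X Z hZ hker φ (LinearMap.range_eq_top.1 htop)
  have hsub : torsionClosure C (ModuleCat.of A (LinearMap.range φ)) :=
    torsionClosure_of_surjective (Y := ModuleCat.of A (LinearMap.range φ))
      (le_torsionClosure hC.le_fg Z hZ) φ.rangeRestrict φ.surjective_rangeRestrict
  -- Both `im φ` and `X / im φ` are shorter torsion modules, and each inherits the kernel condition.
  refine hC.ext (LinearMap.range φ) ?_ ?_
  · refine ih _ (Submodule.length_lt htop) (ModuleCat.of A (LinearMap.range φ)) hsub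
      (fun M hM g => ?_) rfl
    have h1 := hker M hM ((LinearMap.range φ).subtype ∘ₗ g)
    rwa [LinearMap.ker_comp, Submodule.ker_subtype] at h1
  · refine ih _ (Submodule.length_quotient_lt _ fun h => hφ (LinearMap.range_eq_bot.1 h))
      (ModuleCat.of A (X ⧸ LinearMap.range φ)) (torsionClosure_of_surjective
        (Y := ModuleCat.of A (X ⧸ LinearMap.range φ)) hX (LinearMap.range φ).mkQ
        (Submodule.mkQ_surjective _)) (fun M hM g => ?_) rfl
    -- The pullback of `M` and `X` over `X / im φ`. It is an extension of `M` by `im φ`, hence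
    -- torsion, and the kernel of its projection to `X` maps onto `ker g`.
    let E : Submodule A (M × X) := LinearMap.ker
      (g ∘ₗ LinearMap.fst A M X - (LinearMap.range φ).mkQ ∘ₗ LinearMap.snd A M X)
    have hE : ∀ z : M × X, z ∈ E ↔ g z.1 = (LinearMap.range φ).mkQ z.2 := fun z => sub_eq_zero
    have hTE : torsionClosure C (ModuleCat.of A E) := by
      refine torsionClosure_ext (Y := ModuleCat.of A E) hsub hM
        ((LinearMap.inr A M X ∘ₗ (LinearMap.range φ).subtype).codRestrict E fun x => ?_)
        (LinearMap.fst A M X ∘ₗ E.subtype) (fun m => ?_) ?_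
      · rw [hE]
        change g 0 = (LinearMap.range φ).mkQ x
        rw [map_zero]
        exact ((Submodule.Quotient.mk_eq_zero _).2 x.2).symm
      · obtain ⟨x, hx⟩ := Submodule.mkQ_surjective _ (g m)
        exact ⟨⟨(m, x), (hE _).2 hx.symm⟩, rfl⟩
      · rintro ⟨⟨m, x⟩, hmx⟩ hm
        obtain rfl : m = 0 := hm
        rw [hE] at hmx
        refine ⟨⟨x, (Submodule.Quotient.mk_eq_zero _).1 (hmx.symm.trans (map_zero g))⟩, rfl⟩
    have h1 := hker (ModuleCat.of A E) hTE (LinearMap.snd A M X ∘ₗ E.subtype)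
    refine torsionClosure_of_surjective (Y := ModuleCat.of A (LinearMap.ker g)) h1
      ((LinearMap.fst A M X ∘ₗ E.subtype ∘ₗ Submodule.subtype _).codRestrict (LinearMap.ker g)
        fun z => ?_) ?_
    · have h2 := (hE z.1.1).1 z.1.2
      have h3 : z.1.1.2 = 0 := z.2
      rw [h3, map_zero] at h2
      exact h2
    · rintro ⟨m, hm⟩
      exact ⟨⟨⟨(m, 0), (hE _).2 (by rw [map_zero]; exact hm)⟩, rfl⟩, rfl⟩

end Torsion

/-! ### Wide subcategories are determined by the maps they invert -/

section Approximation

variable {A : Type u} [Ring A] {C : ObjectProperty (ModuleCat.{u} A)}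

/-- A weakly initial pointed module in a class closed under quotients may be chosen minimal. -/
lemma exists_minimal_weaklyInitial [IsArtinianRing A] {D : ObjectProperty (ModuleCat.{u} A)}
    (hfg : ∀ X, D X → Module.Finite A X)
    (hD : ∀ (X : ModuleCat.{u} A) (φ : X →ₗ[A] X), D X → D (ModuleCat.of A (LinearMap.range φ)))
    (M : ModuleCat.{u} A) (m : M) (hM : D M)
    (hm : ∀ Y : ModuleCat.{u} A, D Y → ∀ y : Y, ∃ φ : M →ₗ[A] Y, φ m = y) :
    ∃ (M : ModuleCat.{u} A) (m : M), D M ∧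
      (∀ Y : ModuleCat.{u} A, D Y → ∀ y : Y, ∃ φ : M →ₗ[A] Y, φ m = y) ∧
      ∀ φ : M →ₗ[A] M, φ m = m → Function.Surjective φ := by
  induction h : Module.length A M using WellFoundedLT.induction generalizing M with
  | ind n ih =>
  subst h
  have := hfg M hM
  by_cases hmin : ∀ φ : M →ₗ[A] M, φ m = m → Function.Surjective φ
  · exact ⟨M, m, hM, hm, hmin⟩
  push Not at hmin
  obtain ⟨φ, hφ, hns⟩ := hmin
  refine ih _ (Submodule.length_lt fun h => hns (LinearMap.range_eq_top.1 h))
    (ModuleCat.of A (LinearMap.range φ)) ⟨m, m, hφ⟩ (hD M φ hM) (fun Y hY y => ?_) rfl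
  obtain ⟨ψ, hψ⟩ := hm Y hY y
  exact ⟨ψ ∘ₗ (LinearMap.range φ).subtype, hψ⟩

variable [IsArtinianRing A] {T : ModuleCat.{u} A} {t : T} (hT : torsionClosure C T)
  (hweak : ∀ Y : ModuleCat.{u} A, torsionClosure C Y → ∀ y : Y, ∃ φ : T →ₗ[A] Y, φ t = y)
  (hmin : ∀ φ : T →ₗ[A] T, φ t = t → Function.Surjective φ)

include hT hweak hmin

/-- The minimal left approximation of the regular module in a torsion class is Ext-projective. -/
lemma exists_extension_of_ker_le {Q₁ Q₀ : ModuleCat.{u} A} (σ : Q₁ →ₗ[A] Q₀) (π : Q₀ →ₗ[A] T)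
    (hπ : Function.Surjective π) (hex : LinearMap.range σ = LinearMap.ker π) {W : ModuleCat.{u} A}
    (hW : torsionClosure C W) (h : Q₁ →ₗ[A] W) (hh : LinearMap.ker σ ≤ LinearMap.ker h) :
    ∃ c : Q₀ →ₗ[A] W, ∀ x, c (σ x) = h x := by
  have := hT.1
  -- The pushout of `σ` along `h` is an extension of `T` by `W`; the hypothesis on kernels makes `i`
  -- injective. A splitting of this extension yields the desired map.
  let R : Submodule A (W × Q₀) := LinearMap.range (h.prod (-σ))
  let i : W →ₗ[A] (W × Q₀) ⧸ R := R.mkQ ∘ₗ LinearMap.inl A W Q₀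
  let k : Q₀ →ₗ[A] (W × Q₀) ⧸ R := R.mkQ ∘ₗ LinearMap.inr A W Q₀
  have hπσ : ∀ x, π (σ x) = 0 := fun x => by
    have : σ x ∈ LinearMap.ker π := hex ▸ LinearMap.mem_range_self σ x
    exact this
  let q : (W × Q₀) ⧸ R →ₗ[A] T := R.liftQ (π ∘ₗ LinearMap.snd A W Q₀) (by
    rintro _ ⟨x, rfl⟩
    simp [hπσ])
  have hik : ∀ x, k (σ x) = i (h x) := fun x => by
    refine ((Submodule.Quotient.eq R).2 ⟨x, ?_⟩).symm
    simp
  have hi : Function.Injective i := by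
    rw [← LinearMap.ker_eq_bot, eq_bot_iff]
    intro w hw
    obtain ⟨x, hx⟩ := (Submodule.Quotient.mk_eq_zero R).1 hw
    have h1 : h x = w := congrArg Prod.fst hx
    have h2 : -σ x = 0 := congrArg Prod.snd hx
    rw [← h1]
    exact hh (neg_eq_zero.1 h2)
  have hqk : ∀ y, q (k y) = π y := fun y => rfl
  have hker : LinearMap.ker q ≤ LinearMap.range i := by
    intro z hz
    obtain ⟨⟨w, y⟩, rfl⟩ := R.mkQ_surjective z
    have hy : y ∈ LinearMap.ker π := hz
    rw [← hex] at hy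
    obtain ⟨x, rfl⟩ := hy
    refine ⟨w + h x, (Submodule.Quotient.eq R).2 ⟨x, ?_⟩⟩
    simp
  have hE : torsionClosure C (ModuleCat.of A ((W × Q₀) ⧸ R)) :=
    torsionClosure_ext (Y := ModuleCat.of A ((W × Q₀) ⧸ R)) hW hT i q
      (fun y => by obtain ⟨y, rfl⟩ := hπ y; exact ⟨k y, rfl⟩) hker
  obtain ⟨y₀, hy₀⟩ := hπ t
  -- Lifting `t` to the extension gives an endomorphism `q ∘ₗ ψ` of `T` fixing `t`; by minimality it
  -- is an automorphism, so the extension splits.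
  obtain ⟨ψ, hψ⟩ := hweak _ hE (k y₀)
  have hsurj : Function.Surjective (q ∘ₗ ψ) := hmin (q ∘ₗ ψ) (by
    rw [LinearMap.comp_apply, hψ, hqk, hy₀])
  let e := LinearEquiv.ofBijective (q ∘ₗ ψ)
    ⟨IsNoetherian.injective_of_surjective_endomorphism _ hsurj, hsurj⟩
  let s : T →ₗ[A] (W × Q₀) ⧸ R := ψ ∘ₗ e.symm.toLinearMap
  have hs : ∀ x, q (s x) = x := fun x => e.apply_symm_apply x
  obtain ⟨c, hc⟩ := exists_comp_eq_of_range_le i hi (k - s ∘ₗ π) fun y => hker (by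
    change q (k y - s (π y)) = 0
    rw [map_sub, hs, hqk, sub_self])
  refine ⟨c, fun x => hi ?_⟩
  rw [hc]
  change k (σ x) - s (π (σ x)) = _
  rw [hπσ, map_zero, sub_zero, hik]

/-- The obstruction to the previous lemma is `L = b (ker σ)`, which is properly contained in the
range of `b` because `ker σ` is superfluous. Modulo `L` the map extends; after lifting, the error
has values in `L`, and induction on the range applies. -/
lemma exists_extension_of_isMinimalPresentation {Q₁ Q₀ : ModuleCat.{u} A} {σ : Q₁ ⟶ Q₀}
    {π : Q₀ ⟶ T} (hσ : IsMinimalPresentation σ π) {Z : ModuleCat.{u} A}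
    (hZ : torsionClosure C Z) (b : Q₁ →ₗ[A] Z) : ∃ c : Q₀ →ₗ[A] Z, c ∘ₗ σ.hom = b := by
  have := hZ.1
  have := hσ.proj₀.2
  induction h : LinearMap.range b using WellFoundedLT.induction generalizing b with
  | ind n ih =>
  subst h
  by_cases hb : b = 0
  · exact ⟨0, by rw [hb, LinearMap.zero_comp]⟩
  let L : Submodule A Z := (LinearMap.ker σ.hom).map b
  have hL : L < LinearMap.range b := by
    refine lt_of_le_of_ne LinearMap.map_le_range fun h => hb ?_
    rw [← LinearMap.ker_eq_top]
    refine hσ.superfluous₁ _ (eq_top_iff.2 fun x _ => ?_)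
    obtain ⟨y, hy, hxy⟩ : b x ∈ L := h ▸ LinearMap.mem_range_self b x
    rw [← add_sub_cancel y x]
    refine Submodule.add_mem_sup hy ?_
    rw [LinearMap.mem_ker, map_sub, hxy, sub_self]
  obtain ⟨c, hc⟩ := exists_extension_of_ker_le hT hweak hmin σ.hom π.hom hσ.surjective hσ.exact
    (W := ModuleCat.of A (Z ⧸ L)) (torsionClosure_of_surjective (Y := ModuleCat.of A (Z ⧸ L)) hZ
      L.mkQ L.mkQ_surjective) (L.mkQ ∘ₗ b) (fun x hx =>
        (Submodule.Quotient.mk_eq_zero L).2 (Submodule.mem_map_of_mem hx))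
  obtain ⟨c', hc'⟩ := Module.projective_lifting_property L.mkQ c L.mkQ_surjective
  have hle : LinearMap.range (b - c' ∘ₗ σ.hom) ≤ L := by
    rintro _ ⟨x, rfl⟩
    rw [← Submodule.Quotient.mk_eq_zero, ← Submodule.mkQ_apply, LinearMap.sub_apply, map_sub,
      sub_eq_zero, LinearMap.comp_apply, ← LinearMap.comp_apply L.mkQ c', hc']
    exact (hc x).symm
  obtain ⟨d, hd⟩ := ih _ (lt_of_le_of_lt hle hL) _ rfl
  exact ⟨c' + d, by rw [LinearMap.add_comp, hd, add_sub_cancel]⟩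

omit hT hweak hmin

/-- A wide subcategory of modules over a Nakayama algebra is recovered from the modules whose minimal
projective presentations it inverts. -/
theorem IsWide.rightStar_leftStar (K : Type v) [Field K] [Algebra K A] [FiniteDimensional K A]
    (hS : IsSerialRing A) (hC : IsWide C) : rightStar (leftStar C) = C := by
  refine le_antisymm (fun Y hY => ?_) (le_rightStar_leftStar hC.le_fg)
  obtain ⟨M, m, hM, hm⟩ := hS.exists_weaklyInitial K (torsionClosure_isAdditiveClass (C := C))
  obtain ⟨T, t, hT, hweak, hmin⟩ := exists_minimal_weaklyInitial (fun X hX => hX.1)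
    (fun X φ hX => torsionClosure_of_surjective (Y := ModuleCat.of A (LinearMap.range φ)) hX
      φ.rangeRestrict φ.surjective_rangeRestrict) M m hM hm
  obtain ⟨Q₁, Q₀, σ, π, hσ⟩ := exists_isMinimalPresentation T hT.1
  have := hσ.proj₁.1
  have := hσ.proj₀.1
  have := hσ.proj₁.2
  have := hσ.proj₀.2
  have hπσ : ∀ x, π.hom (σ.hom x) = 0 := fun x => by
    have : σ.hom x ∈ LinearMap.ker π.hom := hσ.exact ▸ LinearMap.mem_range_self σ.hom x
    exact this
  obtain ⟨y₀, hy₀⟩ := hσ.surjective t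
  -- `τ` records the approximation `A → T` at the level of projectives: a map on `Q₀` that kills `σ`
  -- is a map on `T`, and its value on the generator of `A` is its value at `t`.
  let P : ModuleCat.{u} A := ModuleCat.of A (A × Q₁)
  let τ : P ⟶ Q₀ := ModuleCat.ofHom ((LinearMap.toSpanSingleton A Q₀ y₀).coprod σ.hom)
  have hτ₁ : τ.hom ∘ₗ LinearMap.inl A A Q₁ = LinearMap.toSpanSingleton A Q₀ y₀ :=
    LinearMap.coprod_inl _ _
  have hτ₂ : τ.hom ∘ₗ LinearMap.inr A A Q₁ = σ.hom := LinearMap.coprod_inr _ _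
  have hτ₁₀ : τ.hom ((1 : A), (0 : Q₁)) = y₀ := by
    change (LinearMap.toSpanSingleton A Q₀ y₀).coprod σ.hom ((1 : A), (0 : Q₁)) = y₀
    simp
  have hP : IsFGProjective P := ⟨inferInstanceAs (Module.Finite A (A × Q₁)),
    inferInstanceAs (Module.Projective A (A × Q₁))⟩
  have hfac : ∀ {Z : ModuleCat.{u} A} (φ : Q₀ →ₗ[A] Z), φ ∘ₗ σ.hom = 0 →
      ∃ χ : T →ₗ[A] Z, ∀ y, χ (π.hom y) = φ y := fun φ hφ =>
    exists_comp_eq_of_ker_le π.hom hσ.surjective φ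
      (hσ.exact ▸ LinearMap.range_le_ker_iff.2 hφ)
  have hτC : ∀ Z, C Z → HomIso τ Z := by
    intro Z hZ
    have hTZ := le_torsionClosure hC.le_fg Z hZ
    rw [homIso_iff]
    refine ⟨fun φ hφ => ?_, fun ψ => ?_⟩
    · obtain ⟨χ, hχ⟩ := hfac φ (by
        rw [← hτ₂, ← LinearMap.comp_assoc, hφ, LinearMap.zero_comp])
      have hχt : χ t = 0 := by
        have h1 : φ (τ.hom (1, 0)) = 0 := LinearMap.congr_fun hφ (1, 0)
        rwa [hτ₁₀, ← hχ, hy₀] at h1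
      -- The kernel of `χ` is torsion and contains `t`; by minimality it is all of `T`.
      obtain ⟨ψ, hψ⟩ := hweak _ (hC.torsionClosure_ker T Z hT hZ χ) ⟨t, hχt⟩
      have hs := hmin ((LinearMap.ker χ).subtype ∘ₗ ψ) (congrArg Subtype.val hψ)
      ext y
      obtain ⟨x, hx⟩ := hs (π.hom y)
      rw [← hχ, ← hx]
      exact (ψ x).2
    -- The component on `Q₁` extends to `Q₀`; a map from `T` with prescribed value at `t` then
    -- corrects the component on `A`.
    · obtain ⟨c, hc⟩ := exists_extension_of_isMinimalPresentation hT hweak hmin hσ hTZ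
        (ψ ∘ₗ LinearMap.inr A A Q₁)
      obtain ⟨χ, hχ⟩ := hweak Z hTZ (ψ (1, 0) - c y₀)
      refine ⟨c + χ ∘ₗ π.hom, LinearMap.prod_ext ?_ ?_⟩
      · rw [LinearMap.comp_assoc, hτ₁]
        ext
        simp [hy₀, hχ]
      · have h1 : (χ ∘ₗ π.hom) ∘ₗ σ.hom = 0 := by
          ext x
          simp [hπσ]
        rw [LinearMap.comp_assoc, hτ₂, LinearMap.add_comp, hc, h1, add_zero]
  have hτY := homIso_iff.1 (HomIso.of_rightStar_leftStar hP hσ.proj₀ τ hτC hY)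
  have hext : ∀ y : Y, ∃ χ : T →ₗ[A] Y, χ t = y := by
    intro y
    obtain ⟨φ, hφ⟩ := hτY.2 ((LinearMap.toSpanSingleton A Y y).coprod 0)
    obtain ⟨χ, hχ⟩ := hfac φ (by
      rw [← hτ₂, ← LinearMap.comp_assoc, hφ, LinearMap.coprod_inr])
    refine ⟨χ, ?_⟩
    have h1 : φ (τ.hom (1, 0)) = (LinearMap.toSpanSingleton A Y y).coprod 0 ((1 : A), (0 : Q₁)) :=
      LinearMap.congr_fun hφ (1, 0)
    rw [hτ₁₀, ← hχ, hy₀] at h1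
    simpa using h1
  have huniq : ∀ χ : T →ₗ[A] Y, χ t = 0 → χ = 0 := by
    intro χ hχ
    have h1 : χ ∘ₗ π.hom = 0 := hτY.1 _ (LinearMap.prod_ext
      (by rw [LinearMap.comp_assoc, hτ₁]; ext; simp [hy₀, hχ])
      (by rw [LinearMap.comp_assoc, hτ₂]; ext x; simp [hπσ]))
    ext x
    obtain ⟨y, rfl⟩ := hσ.surjective x
    exact LinearMap.congr_fun h1 y
  have hTY : torsionClosure C Y := by
    refine ⟨hY.1, fun W p hp hW => ?_⟩
    obtain ⟨w, hw⟩ := exists_ne (0 : W)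
    obtain ⟨y, rfl⟩ := hp w
    obtain ⟨χ, rfl⟩ := hext y
    exact torsionClosure_exists_ne_zero hT (p ∘ₗ χ) fun h => hw (LinearMap.congr_fun h t)
  refine hC.of_torsionClosure_ker Y hTY fun M hM g => ?_
  have := hM.1
  refine ⟨inferInstanceAs (Module.Finite A (LinearMap.ker g)), fun W p hp hW => ?_⟩
  -- realise `W` as the kernel of the map `M / ker p → Y` induced by `g`
  let N : Submodule A M := (LinearMap.ker p).map (LinearMap.ker g).subtype
  let g' : M ⧸ N →ₗ[A] Y := N.liftQ g (by
    rintro _ ⟨z, -, rfl⟩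
    exact z.2)
  obtain ⟨j, hj⟩ := exists_comp_eq_of_ker_le p hp (N.mkQ ∘ₗ (LinearMap.ker g).subtype) (fun z hz =>
    (Submodule.Quotient.mk_eq_zero N).2 (Submodule.mem_map_of_mem hz))
  have hjinj : Function.Injective j := by
    rw [← LinearMap.ker_eq_bot, eq_bot_iff]
    intro w hw
    obtain ⟨z, rfl⟩ := hp w
    rw [LinearMap.mem_ker, hj] at hw
    obtain ⟨z', hz', h1⟩ := (Submodule.Quotient.mk_eq_zero N).1 hw
    obtain rfl : z' = z := Subtype.ext h1
    exact hz'
  obtain ⟨w, hw⟩ := exists_ne (0 : W)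
  obtain ⟨z, rfl⟩ := hp w
  -- A nonzero element of `W`, seen in `M ⧸ N`, is reached from `t` by `χ`. Since `g' ∘ₗ χ` kills
  -- `t` it is zero, so `χ` factors through `W`.
  obtain ⟨χ, hχ⟩ := hweak (ModuleCat.of A (M ⧸ N)) (torsionClosure_of_surjective
    (Y := ModuleCat.of A (M ⧸ N)) hM N.mkQ N.mkQ_surjective) (j (p z))
  have hzero : g' ∘ₗ χ = 0 := huniq _ (by
    rw [LinearMap.comp_apply, hχ, hj]
    exact z.2)
  obtain ⟨θ, hθ⟩ := exists_comp_eq_of_range_le j hjinj χ fun x => by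
    obtain ⟨y, hy⟩ := N.mkQ_surjective (χ x)
    have h1 : g y = 0 := by
      have h2 := LinearMap.congr_fun hzero x
      rw [LinearMap.comp_apply, ← hy] at h2
      exact h2
    refine ⟨p ⟨y, h1⟩, ?_⟩
    rw [hj, ← hy]
    rfl
  refine torsionClosure_exists_ne_zero hT θ fun h => hw (hjinj ?_)
  rw [← hχ, ← hθ, h]
  rfl

end Approximation

/-! ### The tensor-restriction adjunction and inverted maps -/

noncomputable section TensorAdjunction

variable {A B : Type u} [Ring A] [Ring B] (f : A →+* B)

/-- The restriction of a `B`-module along `f : A → B`. -/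
abbrev resModule (N : ModuleCat.{u} B) : ModuleCat.{u} A := (ModuleCat.restrictScalars f).obj N

variable {M : Type u} [AddCommGroup M] [Module A M] {N : ModuleCat.{u} B}

/-- The element `1 ⊗ m` of `B ⊗_A M`. -/
def tensorMk (m : M) : BTensor f M := Submodule.Quotient.mk ((1 : B) ⊗ₜ[ℤ] m)

lemma smul_tensorMk (b : B) (m : M) : b • tensorMk f m = Submodule.Quotient.mk (b ⊗ₜ[ℤ] m) := by
  rw [tensorMk, ← Submodule.Quotient.mk_smul, TensorProduct.smul_tmul', smul_eq_mul, mul_one]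

lemma tensorMk_smul (a : A) (m : M) : tensorMk f (a • m) = f a • tensorMk f m := by
  rw [smul_tensorMk]
  refine ((Submodule.Quotient.eq _).2 ?_).symm
  rw [tensorRel]
  refine Submodule.subset_span ⟨1, a, m, ?_⟩
  rw [one_mul]

/-- The unit `M → B ⊗_A M`. -/
def tensorUnit (M : Type u) [AddCommGroup M] [Module A M] :
    M →ₗ[A] resModule f (ModuleCat.of B (BTensor f M)) where
  toFun m := tensorMk f m
  map_add' m m' := by
    change (Submodule.Quotient.mk ((1 : B) ⊗ₜ[ℤ] (m + m')) : BTensor f M) = _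
    rw [TensorProduct.tmul_add]
    rfl
  map_smul' a m := tensorMk_smul f a m

lemma tensorUnit_apply (m : M) : tensorUnit f M m = tensorMk f m := rfl

lemma tensorMap_tensorMk {M' : Type u} [AddCommGroup M'] [Module A M'] (φ : M →ₗ[A] M') (m : M) :
    tensorMap f φ (tensorMk f m) = tensorMk f (φ m) := rfl

lemma tensor_hom_ext_unit {N : Type u} [AddCommGroup N] [Module B N] {φ ψ : BTensor f M →ₗ[B] N}
    (h : ∀ m, φ (tensorMk f m) = ψ (tensorMk f m)) : φ = ψ := by
  refine tensor_hom_ext f fun b m => ?_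
  rw [← smul_tensorMk, map_smul, map_smul, h]

/-- The `B`-linear map `B ⊗_A M → N` induced by an `A`-linear map `M → N`. -/
def tensorLift (φ : M →ₗ[A] resModule f N) : BTensor f M →ₗ[B] N :=
  (tensorRel f M).liftQ
    (AlgebraTensorModule.lift (LinearMap.toSpanSingleton B (M →ₗ[ℤ] N)
      (show M →+ N from φ.toAddMonoidHom).toIntLinearMap)) (by
    refine Submodule.span_le.2 ?_
    rintro _ ⟨b, a, m, rfl⟩
    have h : (φ (a • m) : N) = f a • (φ m : N) := map_smul φ a m
    change (AlgebraTensorModule.lift (LinearMap.toSpanSingleton B (M →ₗ[ℤ] N)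
      (show M →+ N from φ.toAddMonoidHom).toIntLinearMap)) _ = 0
    rw [map_sub, sub_eq_zero]
    change (b * f a) • (φ m : N) = b • (φ (a • m) : N)
    rw [h, mul_smul])

lemma tensorLift_tensorMk (φ : M →ₗ[A] resModule f N) (m : M) :
    tensorLift f φ (tensorMk f m) = φ m := by
  change (1 : B) • (φ m : N) = φ m
  rw [one_smul]

/-- The restriction of a `B`-linear map. -/
def resMap {N N' : ModuleCat.{u} B} (φ : N →ₗ[B] N') : resModule f N →ₗ[A] resModule f N' :=
  ((ModuleCat.restrictScalars f).map (ModuleCat.ofHom φ)).hom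

/-- By adjunction, `Hom_A(σ, N)` is `Hom_B(B ⊗ σ, N)`. -/
lemma homIso_of_isIso {P Q : ModuleCat.{u} A} (σ : P ⟶ Q) (h : IsIso ((tensorFunctor f).map σ))
    (N : ModuleCat.{u} B) : HomIso σ (resModule f N) := by
  let e : BTensor f P ≃ₗ[B] BTensor f Q := (asIso ((tensorFunctor f).map σ)).toLinearEquiv
  have he : ∀ x : P, e (tensorMk f x) = tensorMk f (σ.hom x) := fun x => rfl
  rw [homIso_iff]
  refine ⟨fun φ hφ => ?_, fun ψ => ?_⟩
  · have h1 : tensorLift f φ ∘ₗ e.toLinearMap = 0 := by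
      refine tensor_hom_ext_unit f fun x => ?_
      have h2 : tensorLift f φ (e (tensorMk f x)) = 0 := by
        rw [he, tensorLift_tensorMk]
        exact LinearMap.congr_fun hφ x
      exact h2
    ext y
    have h3 := LinearMap.congr_fun h1 (e.symm (tensorMk f y))
    rw [LinearMap.comp_apply, LinearEquiv.coe_coe, e.apply_symm_apply, tensorLift_tensorMk] at h3
    exact h3
  · let χ : ModuleCat.of B (BTensor f Q) →ₗ[B] N := tensorLift f ψ ∘ₗ e.symm.toLinearMap
    refine ⟨resMap f χ ∘ₗ tensorUnit f Q, ?_⟩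
    ext x
    change tensorLift f ψ (e.symm (tensorMk f (σ.hom x))) = ψ x
    rw [← he, e.symm_apply_apply, tensorLift_tensorMk]

/-- For `R` finitely generated projective, `B ⊗ R` is a direct summand of a finite power of `B`. -/
lemma homIso_tensor {P Q R : ModuleCat.{u} A} (hR : IsFGProjective R) (σ : P ⟶ Q)
    (h : HomIso σ (resModule f (ModuleCat.of B B))) :
    HomIso σ (resModule f (ModuleCat.of B (BTensor f R))) := by
  have := hR.1
  have := hR.2
  obtain ⟨n, r, hr⟩ := Module.Finite.exists_fin' A R
  obtain ⟨i, hi⟩ := Module.projective_lifting_property r LinearMap.id hr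
  have h1 : HomIso σ (resModule f (ModuleCat.of B (Fin n → B))) := by
    let p (j : Fin n) : resModule f (ModuleCat.of B (Fin n → B)) →ₗ[A]
        resModule f (ModuleCat.of B B) :=
      resMap f (N := ModuleCat.of B (Fin n → B)) (N' := ModuleCat.of B B)
        (LinearMap.proj (R := B) (φ := fun _ => B) j)
    refine HomIso.pi p (fun Z g => ?_) fun _ => h
    refine ⟨{ toFun := fun z => (fun j => g j z : Fin n → B),
              map_add' := fun z z' => funext fun j => map_add (g j) z z',
              map_smul' := fun a z => funext fun j => map_smul (g j) a z }, fun j => rfl, ?_⟩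
    intro g' hg'
    ext z
    exact funext fun j => LinearMap.congr_fun (hg' j) z
  let s : R →ₗ[A] resModule f (ModuleCat.of B (Fin n → B)) :=
    { toFun := fun x => (fun j => f (i x j) : Fin n → B)
      map_add' := fun x y => funext fun j => by
        change f (i (x + y) j) = f (i x j) + f (i y j)
        rw [map_add, Pi.add_apply, map_add]
      map_smul' := fun a x => funext fun j => by
        change f (i (a • x) j) = f a * f (i x j)
        rw [map_smul, Pi.smul_apply, smul_eq_mul, map_mul] }
  let back : (Fin n → B) →ₗ[B] BTensor f R :=
    Fintype.linearCombination B fun j => tensorMk f (r (Pi.single j 1))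
  refine h1.of_retract
    (resMap f (N := ModuleCat.of B (BTensor f R)) (N' := ModuleCat.of B (Fin n → B))
      (tensorLift f s))
    (resMap f (N := ModuleCat.of B (Fin n → B)) (N' := ModuleCat.of B (BTensor f R)) back) ?_
  have h2 : back ∘ₗ tensorLift f s = LinearMap.id := by
    refine tensor_hom_ext_unit f fun x => ?_
    have h3 : back (s x) = tensorMk f x := by
      have h4 : x = ∑ j, i x j • r (Pi.single j 1) := by
        conv_lhs => rw [← LinearMap.id_apply (R := A) x, ← hi, LinearMap.comp_apply,
          ← Finset.univ_sum_single (i x)]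
        rw [map_sum]
        refine Finset.sum_congr rfl fun j _ => ?_
        rw [← map_smul]
        congr 1
        ext k
        simp [Pi.single_apply]
      conv_rhs => rw [h4, ← tensorUnit_apply, map_sum]
      change Fintype.linearCombination B _ (fun j => f (i x j)) = _
      rw [Fintype.linearCombination_apply]
      refine Finset.sum_congr rfl fun j _ => ?_
      rw [map_smul]
      rfl
    rw [LinearMap.comp_apply, tensorLift_tensorMk]
    exact h3
  exact LinearMap.ext fun x => LinearMap.congr_fun h2 x

/-- `B ⊗_A σ` is an isomorphism if and only if `Hom_A(σ, B)` is. -/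
lemma isIso_tensor_iff {P Q : ModuleCat.{u} A} (hP : IsFGProjective P) (hQ : IsFGProjective Q)
    (σ : P ⟶ Q) : IsIso ((tensorFunctor f).map σ) ↔
      HomIso σ (resModule f (ModuleCat.of B B)) := by
  refine ⟨fun h => homIso_of_isIso f σ h _, fun h => ?_⟩
  -- The inverse of `B ⊗ σ` comes from extending the unit `P → B ⊗ P` along `σ`.
  obtain ⟨φ, hφ⟩ := (homIso_iff.1 (homIso_tensor f hP σ h)).2 (tensorUnit f P)
  have hφ' : ∀ x, φ (σ.hom x) = tensorMk f x := LinearMap.congr_fun hφ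
  let ρ : BTensor f Q →ₗ[B] BTensor f P := tensorLift f (N := ModuleCat.of B (BTensor f P)) φ
  have h1 : ρ ∘ₗ tensorMap f σ.hom = LinearMap.id := by
    refine tensor_hom_ext_unit f fun x => ?_
    rw [LinearMap.comp_apply, tensorMap_tensorMk]
    refine (tensorLift_tensorMk f (N := ModuleCat.of B (BTensor f P)) φ _).trans ?_
    exact hφ' x
  let τ : ModuleCat.of B (BTensor f Q) →ₗ[B] ModuleCat.of B (BTensor f Q) :=
    tensorMap f σ.hom ∘ₗ ρ
  have h2 : resMap f τ ∘ₗ tensorUnit f Q - tensorUnit f Q = 0 := by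
    refine (homIso_iff.1 (homIso_tensor f hQ σ h)).1 _ ?_
    ext x
    rw [LinearMap.comp_apply, LinearMap.sub_apply, LinearMap.zero_apply, sub_eq_zero]
    change tensorMap f σ.hom (ρ (tensorMap f σ.hom (tensorMk f x))) =
      tensorMap f σ.hom (tensorMk f x)
    rw [← LinearMap.comp_apply ρ, h1, LinearMap.id_apply]
  have h3 : tensorMap f σ.hom ∘ₗ ρ = LinearMap.id := by
    refine tensor_hom_ext_unit f fun y => ?_
    exact LinearMap.congr_fun (sub_eq_zero.1 h2) y
  refine ⟨ModuleCat.ofHom ρ, ?_, ?_⟩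
  · ext1
    exact h1
  · ext1
    exact h3

lemma inverts_iff {S : MorphismProperty (ModuleCat.{u} A)} (hS : BetweenFGProjectives S) :
    Inverts f S ↔ ∀ ⦃P Q : ModuleCat.{u} A⦄ (σ : P ⟶ Q), S σ →
      HomIso σ (resModule f (ModuleCat.of B B)) :=
  forall₃_congr fun _ _ σ => imp_congr_right fun hσ =>
    isIso_tensor_iff f (hS σ hσ).1 (hS σ hσ).2 σ

end TensorAdjunction

/-! ### Constructing wide subcategories -/

section WideConstruction

variable {A : Type u} [Ring A] {C : ObjectProperty (ModuleCat.{u} A)}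

lemma IsWide.of_linear (fg : ∀ X, C X → Module.Finite A X)
    (of_equiv : ∀ {X Y : ModuleCat.{u} A}, (X ≃ₗ[A] Y) → C X → C Y)
    (zero : C (ModuleCat.of A PUnit))
    (ker : ∀ {X Y : ModuleCat.{u} A} (g : X →ₗ[A] Y), C X → C Y →
      C (ModuleCat.of A (LinearMap.ker g)))
    (coker : ∀ {X Y : ModuleCat.{u} A} (g : X →ₗ[A] Y), C X → C Y →
      C (ModuleCat.of A (Y ⧸ LinearMap.range g)))
    (ext : ∀ {X Y Z : ModuleCat.{u} A} (i : X →ₗ[A] Y) (p : Y →ₗ[A] Z), Function.Injective i →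
      Function.Surjective p → LinearMap.range i = LinearMap.ker p → C X → C Z → C Y) :
    IsWide C := by
  have hiso : C.IsClosedUnderIsomorphisms := ⟨fun e h => of_equiv e.toLinearEquiv h⟩
  have hzero : C.ContainsZero := ⟨⟨_, ModuleCat.isZero_of_subsingleton (ModuleCat.of A PUnit), zero⟩⟩
  have hprod : C.IsClosedUnderBinaryProducts := by
    refine ⟨?_⟩
    rintro X ⟨p⟩
    -- A binary product is an extension of its factors.
    have h1 : C (ModuleCat.of A
        (p.diag.obj (.mk WalkingPair.left) × p.diag.obj (.mk WalkingPair.right))) :=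
      ext (X := p.diag.obj (.mk WalkingPair.left)) (Z := p.diag.obj (.mk WalkingPair.right))
        (LinearMap.inl A _ _) (LinearMap.snd A _ _) LinearMap.inl_injective
        LinearMap.snd_surjective (LinearMap.range_inl _ _ _)
        (p.prop_diag_obj (.mk .left)) (p.prop_diag_obj (.mk .right))
    refine C.prop_of_iso ?_ h1
    exact IsLimit.conePointUniqueUpToIso (ModuleCat.binaryProductLimitCone _ _).isLimit
      ((IsLimit.postcomposeHomEquiv (diagramIsoPair p.diag) _).2 p.isLimit)
  refine ⟨fun X hX => fg X hX, hiso, hzero, .mk', ⟨?_⟩, ⟨?_⟩, ⟨?_⟩⟩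
  · rintro _ ⟨g, k, hk, hg⟩
    exact C.prop_of_iso (IsLimit.conePointUniqueUpToIso (ModuleCat.kernelIsLimit g) hk)
      (ker g.hom hg.1 hg.2)
  · rintro _ ⟨g, k, hk, hg⟩
    exact C.prop_of_iso (IsColimit.coconePointUniqueUpToIso (ModuleCat.cokernelIsColimit g) hk)
      (coker g.hom hg.1 hg.2)
  · intro S hS h1 h3
    exact ext S.f.hom S.g.hom hS.moduleCat_injective_f hS.moduleCat_surjective_g
      (ShortComplex.Exact.moduleCat_range_eq_ker hS.exact) h1 h3

/-- The modules that see all maps in `S` as isomorphisms form a wide subcategory. -/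
lemma isWide_mapStar [IsNoetherianRing A] {S : MorphismProperty (ModuleCat.{u} A)}
    (hS : BetweenFGProjectives S) : IsWide (mapStar S) := by
  refine IsWide.of_linear (fun X hX => hX.1) (fun e h => ?_) ?_ (fun {X Y} g hX hY => ?_)
    (fun {X Y} g hX hY => ?_) fun {X Y Z} i p hi hp hex hX hZ => ?_
  · have := h.1
    exact ⟨Module.Finite.equiv e, fun P Q σ hσ => (h.2 σ hσ).of_equiv e.symm⟩
  · refine ⟨inferInstanceAs (Module.Finite A PUnit.{u + 1}), fun P Q σ hσ => homIso_iff.2 ?_⟩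
    exact ⟨fun φ _ => LinearMap.ext fun _ => rfl, fun ψ => ⟨0, LinearMap.ext fun _ => rfl⟩⟩
  · have := hX.1
    exact ⟨inferInstanceAs (Module.Finite A (LinearMap.ker g)), fun P Q σ hσ =>
      HomIso.ker (Z := ModuleCat.of A (LinearMap.ker g)) (hX.2 σ hσ) (hY.2 σ hσ)
        (LinearMap.ker g).subtype g Subtype.val_injective (Submodule.range_subtype _)⟩
  · have := hY.1
    exact ⟨inferInstanceAs (Module.Finite A (Y ⧸ LinearMap.range g)), fun P Q σ hσ =>
      HomIso.coker (Z := ModuleCat.of A (Y ⧸ LinearMap.range g)) (hS σ hσ).1.2 (hS σ hσ).2.2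
        (hX.2 σ hσ) (hY.2 σ hσ) g (LinearMap.range g).mkQ (Submodule.mkQ_surjective _)
        (Submodule.ker_mkQ _).symm⟩
  · have := hX.1
    have := hZ.1
    refine ⟨?_, fun P Q σ hσ => HomIso.ext (hS σ hσ).2.2 (hX.2 σ hσ) (hZ.2 σ hσ) i p hi hp hex⟩
    exact Module.Finite.of_exact (LinearMap.exact_iff.2 hex.symm) hp

end WideConstruction

/-! ### Modules over a ring epimorphism -/

noncomputable section Local

variable {A B : Type u} [Ring A] [Ring B] (f : A →+* B)

/-- `f`, as a map of left `A`-modules. -/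
def unitHom : ModuleCat.of A A ⟶ resModule f (ModuleCat.of B B) :=
  ModuleCat.ofHom (Y := resModule f (ModuleCat.of B B))
    (LinearMap.toSpanSingleton A (resModule f (ModuleCat.of B B)) (1 : B))

/-- The `A`-modules `Y` such that `Hom_A(B, Y) → Hom_A(A, Y) = Y` is bijective. -/
def IsLocalModule (Y : ModuleCat.{u} A) : Prop := HomIso (unitHom f) Y

variable {f}

lemma isLocalModule_iff {Y : ModuleCat.{u} A} : IsLocalModule f Y ↔
    (∀ φ : resModule f (ModuleCat.of B B) →ₗ[A] Y, φ (1 : B) = 0 → φ = 0) ∧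
      ∀ y, ∃ φ : resModule f (ModuleCat.of B B) →ₗ[A] Y, φ (1 : B) = y := by
  have h1 : ∀ φ : resModule f (ModuleCat.of B B) →ₗ[A] Y,
      φ ∘ₗ (unitHom f).hom = LinearMap.toSpanSingleton A Y (φ (1 : B)) := fun φ =>
    LinearMap.ext_ring ((congrArg φ (one_smul A _)).trans (one_smul A _).symm)
  rw [IsLocalModule, homIso_iff]
  refine and_congr (forall_congr' fun φ => imp_congr_left ?_) ⟨fun h y => ?_, fun h ψ => ?_⟩
  · rw [h1, LinearMap.toSpanSingleton_eq_zero_iff]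
  · obtain ⟨φ, hφ⟩ := h (LinearMap.toSpanSingleton A Y y)
    refine ⟨φ, ?_⟩
    rw [h1] at hφ
    have h2 := LinearMap.congr_fun hφ (1 : A)
    simpa using h2
  · obtain ⟨φ, hφ⟩ := h (ψ (1 : A))
    refine ⟨φ, ?_⟩
    rw [h1, hφ]
    exact LinearMap.ext_ring (one_smul A _)

lemma IsRingEpi.hom_ext (hf : IsRingEpi f) {R : Type u} [Ring R] {g h : B →+* R}
    (hgh : g.comp f = h.comp f) : g = h := by
  have : Epi (RingCat.ofHom f) := hf
  have h1 : RingCat.ofHom g = RingCat.ofHom h := by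
    rw [← cancel_epi (RingCat.ofHom f), ← RingCat.ofHom_comp, ← RingCat.ofHom_comp, hgh]
  exact congrArg RingCat.Hom.hom h1

/-- The ring homomorphism `B → End(M × N)` obtained by conjugating the diagonal action with the
automorphism `(m, n) ↦ (m, n + φ m)`. -/
def conjEnd {M N : Type u} [AddCommGroup M] [Module B M] [AddCommGroup N] [Module B N]
    (φ : M →+ N) : B →+* AddMonoid.End (M × N) where
  toFun b :=
    { toFun := fun p => (b • p.1, b • (p.2 + φ p.1) - φ (b • p.1))
      map_zero' := by simp
      map_add' := fun p q => by
        refine Prod.ext (by simp) ?_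
        simp only [Prod.snd_add, Prod.fst_add, map_add, smul_add]
        abel }
  map_one' := by
    refine AddMonoidHom.ext fun p => Prod.ext (one_smul _ _) ?_
    change (1 : B) • (p.2 + φ p.1) - φ ((1 : B) • p.1) = p.2
    rw [one_smul, one_smul, add_sub_cancel_right]
  map_zero' := by
    refine AddMonoidHom.ext fun p => Prod.ext (zero_smul _ _) ?_
    change (0 : B) • (p.2 + φ p.1) - φ ((0 : B) • p.1) = 0
    rw [zero_smul, zero_smul, map_zero, sub_zero]
  map_add' b c := by
    refine AddMonoidHom.ext fun p => Prod.ext (add_smul _ _ _) ?_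
    change (b + c) • (p.2 + φ p.1) - φ ((b + c) • p.1) =
      (b • (p.2 + φ p.1) - φ (b • p.1)) + (c • (p.2 + φ p.1) - φ (c • p.1))
    rw [add_smul, add_smul, map_add]
    abel
  map_mul' b c := by
    refine AddMonoidHom.ext fun p => Prod.ext (mul_smul _ _ _) ?_
    change (b * c) • (p.2 + φ p.1) - φ ((b * c) • p.1) =
      b • ((c • (p.2 + φ p.1) - φ (c • p.1)) + φ (c • p.1)) - φ (b • c • p.1)
    rw [sub_add_cancel, mul_smul, mul_smul]

/-- Restriction along a ring epimorphism is full. -/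
lemma IsRingEpi.map_smul (hf : IsRingEpi f) {M N : ModuleCat.{u} B}
    (φ : resModule f M →ₗ[A] resModule f N) (b : B) (m : M) :
    (φ (b • m : M) : N) = b • (φ m : N) := by
  let φ' : M →+ N := φ.toAddMonoidHom
  -- The two actions of `B` on `M × N` agree on `A` because `φ` is `A`-linear, hence they agree;
  -- evaluating at `(m, 0)` gives `B`-linearity of `φ`.
  have h1 : conjEnd (B := B) φ' = Module.toAddMonoidEnd B (M × N) := hf.hom_ext (by
    ext1 a
    refine AddMonoidHom.ext fun p => Prod.ext rfl ?_
    change f a • (p.2 + φ' p.1) - φ' (f a • p.1) = f a • p.2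
    have h2 : φ' (f a • p.1) = f a • φ' p.1 := LinearMap.map_smul φ a (show resModule f M from p.1)
    rw [h2, smul_add, add_sub_cancel_right])
  have h3 := congrArg Prod.snd (DFunLike.congr_fun (RingHom.congr_fun h1 b) (m, (0 : N)))
  change b • ((0 : N) + φ' m) - φ' (b • m) = b • (0 : N) at h3
  rw [zero_add, smul_zero, sub_eq_zero] at h3
  exact h3.symm

/-- By fullness, `A`-linear maps from `B` to `N` are `B`-linear, hence correspond to elements of
`N`. -/
lemma IsRingEpi.isLocalModule (hf : IsRingEpi f) (N : ModuleCat.{u} B) :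
    IsLocalModule f (resModule f N) := by
  refine isLocalModule_iff.2 ⟨fun φ hφ => ?_, fun y => ?_⟩
  · refine LinearMap.ext fun b => ?_
    have h := hf.map_smul φ (show B from b) (1 : B)
    have h' : φ ((show B from b) • (1 : B) : B) = φ b := congrArg φ (mul_one (show B from b))
    refine (h'.symm.trans h).trans ?_
    refine (congrArg ((show B from b) • ·) (show (φ (1 : B) : N) = 0 from hφ)).trans ?_
    exact smul_zero _
  · refine ⟨resMap f (N := ModuleCat.of B B) (LinearMap.toSpanSingleton B N y), ?_⟩
    exact one_smul B (y : N)

lemma IsLocalModule.of_equiv {Y Z : ModuleCat.{u} A} (h : IsLocalModule f Z) (e : Y ≃ₗ[A] Z) :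
    IsLocalModule f Y :=
  HomIso.of_equiv h e

lemma IsRingEpi.isLocalModule_of_resImage (hf : IsRingEpi f) {Y : ModuleCat.{u} A}
    (hY : resImage f Y) : IsLocalModule f Y := by
  obtain ⟨N, -, ⟨e⟩⟩ := hY
  exact (hf.isLocalModule N).of_equiv e.toLinearEquiv

/-- The `B`-module is `Hom_A(B, Y)`, identified with `Y` by evaluation at `1`. -/
lemma IsLocalModule.exists_equiv {Y : ModuleCat.{u} A} (h : IsLocalModule f Y) :
    ∃ N : ModuleCat.{u} B, Nonempty (Y ≃ₗ[A] resModule f N) := by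
  rw [isLocalModule_iff] at h
  let N := (ModuleCat.coextendScalars f).obj Y
  let ev : resModule f N →ₗ[A] Y :=
    { toFun := fun g => (show resModule f (ModuleCat.of B B) →ₗ[A] Y from g) (1 : B)
      map_add' := fun g g' => rfl
      map_smul' := fun a g => by
        let g' : resModule f (ModuleCat.of B B) →ₗ[A] Y := g
        exact (congrArg g' (show (1 : B) * f a = f a * 1 by rw [one_mul, mul_one])).trans
          (g'.map_smul a (1 : B)) }
  refine ⟨N, ⟨(LinearEquiv.ofBijective ev ⟨?_, fun y => h.2 y⟩).symm⟩⟩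
  rw [← LinearMap.ker_eq_bot, eq_bot_iff]
  exact fun g hg => h.1 g hg

lemma finite_of_finite_resModule (N : ModuleCat.{u} B) (h : Module.Finite A (resModule f N)) :
    Module.Finite B N := by
  obtain ⟨s, hs⟩ := h.fg_top
  let t : Finset N := s
  refine ⟨⟨t, ?_⟩⟩
  rw [eq_top_iff]
  intro x _
  have hx : (show resModule f N from x) ∈ Submodule.span A (s : Set (resModule f N)) := by
    rw [hs]
    trivial
  exact Submodule.span_induction (M := resModule f N) (p := fun y _ => (show N from y) ∈ Submodule.span B (t : Set N))
    (fun y hy => Submodule.subset_span hy) (Submodule.zero_mem _)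
    (fun y z _ _ hy hz => Submodule.add_mem _ hy hz)
    (fun a y _ hy => Submodule.smul_mem _ (f a) hy) hx

lemma finite_resModule (hB : Module.Finite A (resModule f (ModuleCat.of B B)))
    (N : ModuleCat.{u} B) (h : Module.Finite B N) : Module.Finite A (resModule f N) := by
  obtain ⟨n, r, hr⟩ := Module.Finite.exists_fin' B N
  let r' : (Fin n → resModule f (ModuleCat.of B B)) →ₗ[A] resModule f N :=
    { toFun := fun x => r (fun i => x i)
      map_add' := fun x y => r.map_add (fun i => x i) (fun i => y i)
      map_smul' := fun a x => r.map_smul (f a) (fun i => x i) }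
  exact Module.Finite.of_surjective r' hr

lemma IsLocalModule.resImage {Y : ModuleCat.{u} A} (h : IsLocalModule f Y)
    (hY : Module.Finite A Y) : resImage f Y := by
  obtain ⟨N, ⟨e⟩⟩ := h.exists_equiv
  exact ⟨N, finite_of_finite_resModule N (Module.Finite.equiv e), ⟨e.toModuleIso⟩⟩

/-- Uniqueness and existence of maps `B → Y` each concern one element of `Y` at a time, which can be
placed in a finitely generated summand. -/
lemma IsSerialRing.isLocalModule [IsArtinianRing A] (hS : IsSerialRing A) (Y : ModuleCat.{u} A)
    (h : ∀ X X' : Submodule A Y, IsCompl X X' → X.FG → IsLocalModule f (ModuleCat.of A X)) :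
    IsLocalModule f Y := by
  refine isLocalModule_iff.2 ⟨fun φ hφ => ?_, fun y => ?_⟩
  · refine LinearMap.ext fun b => ?_
    obtain ⟨X, X', hc, hX, hb⟩ := hS.exists_fg_summand (φ b)
    have h1 := (isLocalModule_iff.1 (h X X' hc hX)).1 (X.projectionOnto X' hc ∘ₗ φ)
      ((congrArg (X.projectionOnto X' hc) hφ).trans (map_zero _))
    have h2 := LinearMap.congr_fun h1 b
    rw [LinearMap.comp_apply] at h2
    have h3 := Submodule.projectionOnto_apply_left hc ⟨φ b, hb⟩
    exact congrArg Subtype.val (h3.symm.trans h2)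
  · obtain ⟨X, X', hc, hX, hy⟩ := hS.exists_fg_summand y
    obtain ⟨φ, hφ⟩ := (isLocalModule_iff.1 (h X X' hc hX)).2 ⟨y, hy⟩
    exact ⟨X.subtype ∘ₗ φ, congrArg Subtype.val hφ⟩

/-- `1` lies in a finitely generated summand `X` of `B`. The projection onto `X` and the identity
agree at `1`, hence everywhere because `B` is local, so `X = B`. -/
lemma IsRingEpi.finite [IsArtinianRing A] (hf : IsRingEpi f) (hS : IsSerialRing A) :
    Module.Finite A (resModule f (ModuleCat.of B B)) := by
  obtain ⟨X, X', hc, hX, h1⟩ := hS.exists_fg_summand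
    (show resModule f (ModuleCat.of B B) from (1 : B))
  have h2 := (isLocalModule_iff.1 (hf.isLocalModule (ModuleCat.of B B))).1
    (X.subtype ∘ₗ X.projectionOnto X' hc - LinearMap.id) (by
      have h3 := congrArg Subtype.val (Submodule.projectionOnto_apply_left hc ⟨_, h1⟩)
      exact sub_eq_zero.2 h3)
  have h4 : X = ⊤ := by
    rw [eq_top_iff]
    intro b _
    have h5 : (X.projectionOnto X' hc b : resModule f (ModuleCat.of B B)) = b :=
      sub_eq_zero.1 (LinearMap.congr_fun h2 b)
    rw [← h5]
    exact Subtype.prop _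
  exact ⟨h4 ▸ hX⟩

/-- The composite `g ∘ f` inverts `S` because the restriction of `R` comes from a `B`-module;
uniqueness of its factorisation gives `g = h`. -/
lemma IsUniversalLocalisationAt.isRingEpi {S : MorphismProperty (ModuleCat.{u} A)}
    (hf : IsUniversalLocalisationAt S f) : IsRingEpi f := by
  refine ⟨fun {R} g h hgh => ?_⟩
  have h1 : Inverts (g.hom.comp f) S := (inverts_iff _ hf.fgProjective).2 fun P Q σ hσ =>
    homIso_of_isIso f σ (hf.inverts σ hσ) (resModule g.hom (ModuleCat.of R R))
  obtain ⟨k, -, hk⟩ := hf.universal R _ h1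
  have h2 : h.hom.comp f = g.hom.comp f := (congrArg RingCat.Hom.hom hgh).symm
  ext1
  exact (hk g.hom rfl).trans (hk h.hom h2).symm

lemma IsUniversalLocalisationAt.exists_ringEquiv {B' : Type u} [Ring B'] {f' : A →+* B'}
    {S : MorphismProperty (ModuleCat.{u} A)} (hf : IsUniversalLocalisationAt S f)
    (hf' : IsUniversalLocalisationAt S f') :
    ∃ h : B ≃+* B', (h : B →+* B').comp f = f' := by
  obtain ⟨h, hh, -⟩ := hf.universal B' f' hf'.inverts
  obtain ⟨h', hh', -⟩ := hf'.universal B f hf.inverts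
  refine ⟨RingEquiv.ofRingHom h h' ?_ ?_, hh⟩
  · exact hf'.isRingEpi.hom_ext (by rw [RingHom.comp_assoc, hh', hh, RingHom.id_comp])
  · exact hf.isRingEpi.hom_ext (by rw [RingHom.comp_assoc, hh, hh', RingHom.id_comp])

end Local

/-! ### Universal localisations and wide subcategories -/

noncomputable section Localisation

variable {A : Type u} [Ring A]

lemma betweenFGProjectives_minimalPresentations (U : ObjectProperty (ModuleCat.{u} A)) :
    BetweenFGProjectives (minimalPresentations U) := by
  rintro P Q σ ⟨X, π, -, h⟩
  exact ⟨h.proj₁, h.proj₀⟩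

lemma resImage_self {B : Type u} [Ring B] (f : A →+* B) :
    resImage f (resModule f (ModuleCat.of B B)) :=
  ⟨ModuleCat.of B B, inferInstanceAs (Module.Finite B B), ⟨Iso.refl _⟩⟩

lemma resImage_le_mapStar {B : Type u} [Ring B] {f : A →+* B}
    (hB : Module.Finite A (resModule f (ModuleCat.of B B)))
    {S : MorphismProperty (ModuleCat.{u} A)} (hf : Inverts f S) : resImage f ≤ mapStar S := by
  rintro Y ⟨N, hN, ⟨e⟩⟩
  have := finite_resModule hB N hN
  exact ⟨Module.Finite.equiv e.symm.toLinearEquiv, fun P Q σ hσ =>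
    (homIso_of_isIso f σ (hf σ hσ) N).of_equiv e.toLinearEquiv⟩

variable (K : Type v) [Field K] [Algebra K A] [FiniteDimensional K A] [IsArtinianRing A]

include K in
-- If `g : A → R` inverts the presentations, each finitely generated summand of `R` lies in `(*X_B)*
-- = X_B`, so `R` is local. The factorisation is the unique `A`-linear map `B → R` sending `1` to
-- `1`.
lemma isUniversalLocalisationAt_of_isWide (hS : IsSerialRing A) {B : Type u} [Ring B] {f : A →+* B}
    (hw : IsWide (resImage f)) (hl : ∀ Y, resImage f Y → IsLocalModule f Y) :
    IsUniversalLocalisationAt (minimalPresentations (leftStar (resImage f))) f where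
  fgProjective := betweenFGProjectives_minimalPresentations _
  inverts := (inverts_iff f (betweenFGProjectives_minimalPresentations _)).2 fun P Q σ hσ =>
    (le_rightStar_leftStar hw.le_fg _ (resImage_self f)).2 σ hσ
  universal R _ g hg := by
    have hR : IsLocalModule f (resModule g (ModuleCat.of R R)) := by
      refine hS.isLocalModule _ fun X X' hc hX => hl _ ?_
      have hX' : Module.Finite A X := Module.Finite.iff_fg.2 hX
      rw [← hw.rightStar_leftStar K hS]
      exact ⟨hX', fun P Q σ hσ => (homIso_of_isIso g σ (hg σ hσ) _).summand hc⟩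
    obtain ⟨huniq, hext⟩ := isLocalModule_iff.1 hR
    have heq : ∀ φ ψ : resModule f (ModuleCat.of B B) →ₗ[A] resModule g (ModuleCat.of R R),
        φ (1 : B) = ψ (1 : B) → φ = ψ := fun φ ψ h =>
      sub_eq_zero.1 (huniq (φ - ψ) (sub_eq_zero.2 h))
    obtain ⟨θ, hθ⟩ := hext (1 : R)
    let t : B → R := fun b => θ b
    have ht1 : t 1 = 1 := hθ
    have htf : ∀ a b, t (f a * b) = g a * t b := fun a b => θ.map_smul a b
    have htadd : ∀ b c, t (b + c) = t b + t c := fun b c => θ.map_add b c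
    -- `x ↦ t (x c)` and `x ↦ t x * t c` are `A`-linear and agree at `1`.
    have htmul : ∀ b c, t (b * c) = t b * t c := by
      intro b c
      let φ : resModule f (ModuleCat.of B B) →ₗ[A] resModule g (ModuleCat.of R R) :=
        { toFun := fun x => t ((show B from x) * c)
          map_add' := fun x y => by
            change t (((show B from x) + (show B from y)) * c) = _
            rw [add_mul, htadd]
            rfl
          map_smul' := fun a x => by
            change t ((f a * (show B from x)) * c) = _
            rw [mul_assoc, htf]
            rfl }
      let ψ : resModule f (ModuleCat.of B B) →ₗ[A] resModule g (ModuleCat.of R R) :=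
        { toFun := fun x => t (show B from x) * t c
          map_add' := fun x y => by
            change t ((show B from x) + (show B from y)) * t c = _
            rw [htadd, add_mul]
            rfl
          map_smul' := fun a x => by
            change t (f a * (show B from x)) * t c = _
            rw [htf, mul_assoc]
            rfl }
      have h1 : φ = ψ := heq _ _ (by
        change t (1 * c) = t 1 * t c
        rw [ht1, one_mul, one_mul])
      exact LinearMap.congr_fun h1 (show resModule f (ModuleCat.of B B) from b)
    refine ⟨{ toFun := t, map_one' := ht1, map_mul' := htmul, map_add' := htadd,
              map_zero' := θ.map_zero }, ?_, fun k hk => ?_⟩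
    · ext a
      change t (f a) = g a
      rw [← mul_one (f a), htf, ht1, mul_one]
    · let κ : resModule f (ModuleCat.of B B) →ₗ[A] resModule g (ModuleCat.of R R) :=
        { toFun := fun x => k x
          map_add' := fun x y => k.map_add x y
          map_smul' := fun a x => by
            change k (f a * (show B from x)) = g a * k (show B from x)
            rw [map_mul, ← hk]
            rfl }
      have h1 : κ = θ := heq _ _ ((map_one k).trans ht1.symm)
      ext b
      exact LinearMap.congr_fun h1 (show resModule f (ModuleCat.of B B) from b)

include K in
/-- Every wide subcategory is the module category of a finite `A`-ring. -/
lemma IsWide.exists_resImage_eq (hS : IsSerialRing A) {C : ObjectProperty (ModuleCat.{u} A)}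
    (hC : IsWide C) : ∃ (B : Type u) (_ : Ring B) (f : A →+* B), resImage f = C ∧
      ∀ Y, C Y → IsLocalModule f Y := by
  obtain ⟨M₀, m₀, hM₀, hm₀⟩ := hS.exists_weaklyInitial K hC.isAdditiveClass
  obtain ⟨M, m, hM, hweak, hmin⟩ := exists_minimal_weaklyInitial (fun X hX => hC.le_fg X hX)
    (fun X φ hX => hC.range φ hX hX) M₀ m₀ hM₀ hm₀
  -- Kernels stay in `C`, so minimality upgrades weak initiality to uniqueness: `(M, m)` is the
  -- reflection of `A` in `C`, and evaluation at `m` identifies `End(M)` with `M`.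
  have huniq : ∀ Y, C Y → ∀ χ : M →ₗ[A] Y, χ m = 0 → χ = 0 := by
    intro Y hY χ hχ
    obtain ⟨φ, hφ⟩ := hweak _ (hC.ker χ hM hY) ⟨m, hχ⟩
    have h1 := hmin ((LinearMap.ker χ).subtype ∘ₗ φ) (congrArg Subtype.val hφ)
    ext x
    obtain ⟨y, rfl⟩ := h1 x
    exact (φ y).2
  have heq : ∀ φ ψ : Module.End A M, φ m = ψ m → φ = ψ := fun φ ψ h =>
    sub_eq_zero.1 (huniq M hM (φ - ψ) (sub_eq_zero.2 h))
  choose r hr using fun a : A => hweak M hM (a • m)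
  -- `r a` is the endomorphism with `m ↦ a • m`; since `r (a * b) = r b * r a`, the opposite ring
  -- appears.
  let f : A →+* (Module.End A M)ᵐᵒᵖ :=
    { toFun := fun a => MulOpposite.op (r a)
      map_one' := congrArg MulOpposite.op (heq _ _ (by rw [hr, one_smul]; rfl))
      map_zero' := congrArg MulOpposite.op (heq _ _ (by rw [hr, zero_smul]; rfl))
      map_add' := fun a b => congrArg MulOpposite.op (heq _ (r a + r b) (by
        rw [hr, LinearMap.add_apply, hr, hr, add_smul]))
      map_mul' := fun a b => congrArg MulOpposite.op (heq _ (r b * r a) (by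
        rw [Module.End.mul_apply, hr, hr, map_smul, hr, mul_smul])) }
  let R := resModule f (ModuleCat.of (Module.End A M)ᵐᵒᵖ (Module.End A M)ᵐᵒᵖ)
  let ev : R →ₗ[A] M :=
    { toFun := fun b => (show (Module.End A M)ᵐᵒᵖ from b).unop m
      map_add' := fun b c => rfl
      map_smul' := fun a b => by
        let b' : Module.End A M := (show (Module.End A M)ᵐᵒᵖ from b).unop
        change b' (r a m) = a • b' m
        rw [hr, map_smul] }
  have hev : Function.Bijective ev := by
    refine ⟨?_, fun x => ?_⟩
    · rw [← LinearMap.ker_eq_bot, eq_bot_iff]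
      intro b hb
      exact congrArg MulOpposite.op (huniq M hM (show (Module.End A M)ᵐᵒᵖ from b).unop hb)
    · obtain ⟨φ, hφ⟩ := hweak M hM x
      exact ⟨MulOpposite.op φ, hφ⟩
  let e : M ≃ₗ[A] R := (LinearEquiv.ofBijective ev hev).symm
  have he : e m = (1 : (Module.End A M)ᵐᵒᵖ) :=
    (LinearEquiv.symm_apply_eq (LinearEquiv.ofBijective ev hev)).2 rfl
  have hR : C R := hC.of_equiv e hM
  have hlocal : ∀ Y, C Y → IsLocalModule f Y := by
    intro Y hY
    refine isLocalModule_iff.2 ⟨fun φ hφ => ?_, fun y => ?_⟩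
    · have h1 := huniq Y hY (φ ∘ₗ e.toLinearMap) ((congrArg φ he).trans hφ)
      refine LinearMap.ext fun b => ?_
      have h2 := LinearMap.congr_fun h1 (e.symm b)
      rw [LinearMap.comp_apply, LinearEquiv.coe_coe, e.apply_symm_apply] at h2
      exact h2
    · obtain ⟨φ, hφ⟩ := hweak Y hY y
      refine ⟨φ ∘ₗ ev, ?_⟩
      exact hφ
  refine ⟨(Module.End A M)ᵐᵒᵖ, inferInstance, f, le_antisymm ?_ fun Y hY =>
    (hlocal Y hY).resImage (hC.le_fg Y hY), hlocal⟩
  -- `B` lies in `C`, so `f` inverts the presentations of `*C`, and then so do all `B`-modules.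
  calc resImage f ≤ rightStar (leftStar C) := resImage_le_mapStar (hC.le_fg _ hR)
        ((inverts_iff f (betweenFGProjectives_minimalPresentations _)).2 fun P Q σ hσ =>
          (le_rightStar_leftStar hC.le_fg _ hR).2 σ hσ)
    _ = C := hC.rightStar_leftStar K hS

include K in
-- The wide subcategory `S*` is `X_{B'}` for some `A → B'`. As `B'` lies in `S*`, this map inverts
-- `S` and factors through `B`, so modules in `S*` are `B`-modules.
lemma IsUniversalLocalisationAt.resImage_eq (hS : IsSerialRing A) {B : Type u} [Ring B]
    {f : A →+* B} {S : MorphismProperty (ModuleCat.{u} A)} (hf : IsUniversalLocalisationAt S f) :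
    resImage f = mapStar S := by
  refine le_antisymm (resImage_le_mapStar (hf.isRingEpi.finite hS) hf.inverts) fun Y hY => ?_
  obtain ⟨B', _, f', hf', -⟩ :=
    IsWide.exists_resImage_eq K hS (isWide_mapStar hf.fgProjective)
  have hB' : mapStar S (resModule f' (ModuleCat.of B' B')) := hf' ▸ resImage_self f'
  obtain ⟨h, rfl, -⟩ := hf.universal B' f' ((inverts_iff f' hf.fgProjective).2 fun P Q σ hσ =>
    hB'.2 σ hσ)
  have hfin := hY.1
  rw [← hf'] at hY
  obtain ⟨N, -, ⟨e⟩⟩ := hY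
  have h1 : Module.Finite A (resModule f (resModule h N)) :=
    Module.Finite.equiv (N := resModule f (resModule h N)) e.toLinearEquiv
  exact ⟨resModule h N, finite_of_finite_resModule _ h1, ⟨e⟩⟩

end Localisation

/-! ### Vanishing of `Tor_1^A(B, B)` -/

noncomputable section Tor

variable {A B : Type u} [Ring A] [Ring B] (f : A →+* B)

/-- The vanishing of `Tor_1^A(B, B)` in terms of a projective resolution of `B`. -/
lemma exists_resolution_isZero_torOne : ∃ (P₂ P₁ P₀ : ModuleCat.{u} A) (d₂ : P₂ →ₗ[A] P₁)
    (d₁ : P₁ →ₗ[A] P₀) (ε : P₀ →ₗ[A] resModule f (ModuleCat.of B B)), Module.Projective A P₀ ∧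
      LinearMap.range d₂ = LinearMap.ker d₁ ∧ LinearMap.range d₁ = LinearMap.ker ε ∧
      Function.Surjective ε ∧ (IsZero (torOne f) ↔
        LinearMap.ker (tensorMap f d₁) ≤ LinearMap.range (tensorMap f d₂)) := by
  let P := projectiveResolution (resModule f (ModuleCat.of B B))
  let e := (HomologicalComplex.singleObjXSelf (ComplexShape.down ℕ) 0
    (resModule f (ModuleCat.of B B))).toLinearEquiv
  let ε₀ := (P.π.f 0).hom
  have hsurj : Function.Surjective ε₀ := (ModuleCat.epi_iff_surjective (P.π.f 0)).1 inferInstance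
  refine ⟨P.complex.X 2, P.complex.X 1, P.complex.X 0, (P.complex.d 2 1).hom, (P.complex.d 1 0).hom,
    e.toLinearMap ∘ₗ ε₀, ?_, ?_, ?_, e.surjective.comp hsurj, ?_⟩
  · exact (IsProjective.iff_projective _).2 (P.projective 0)
  · exact (P.exact_succ 0).moduleCat_range_eq_ker
  · rw [LinearMap.ker_comp, LinearEquiv.ker, Submodule.comap_bot]
    exact P.exact₀.moduleCat_range_eq_ker
  · rw [torOne, (P.isoLeftDerivedObj (tensorFunctor f) 1).isZero_iff]
    refine Iff.trans (HomologicalComplex.exactAt_iff_isZero_homology _ 1).symm ?_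
    rw [HomologicalComplex.exactAt_iff' _ 2 1 0 (by simp) (by simp)]
    rw [ShortComplex.moduleCat_exact_iff_ker_sub_range]
    rfl

variable {f}

/-- If `Tor_1^A(B, B) = 0`, maps to `B`-modules extend along the first syzygy of `B`. -/
lemma IsRingEpi.exists_extension (hf : IsRingEpi f) {P₂ P₁ P₀ : ModuleCat.{u} A} {d₂ : P₂ →ₗ[A] P₁}
    {d₁ : P₁ →ₗ[A] P₀} {ε : P₀ →ₗ[A] resModule f (ModuleCat.of B B)}
    (h2 : LinearMap.range d₂ = LinearMap.ker d₁) (h1 : LinearMap.range d₁ = LinearMap.ker ε)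
    (hε : Function.Surjective ε)
    (hT : LinearMap.ker (tensorMap f d₁) ≤ LinearMap.range (tensorMap f d₂))
    (N : ModuleCat.{u} B) (κ : LinearMap.ker ε →ₗ[A] resModule f N) :
    ∃ κ' : P₀ →ₗ[A] resModule f N, ∀ x : LinearMap.ker ε, κ' x = κ x := by
  have hd₁ : ∀ z, ε (d₁ z) = 0 := fun z => by
    have h3 : d₁ z ∈ LinearMap.range d₁ := ⟨z, rfl⟩
    rwa [h1] at h3
  have hd₂ : ∀ z, d₁ (d₂ z) = 0 := fun z => by
    have h3 : d₂ z ∈ LinearMap.range d₂ := ⟨z, rfl⟩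
    rwa [h2] at h3
  let μ : BTensor f P₀ →ₗ[B] B := tensorLift f (N := ModuleCat.of B B) ε
  have hμ : ∀ x, μ (tensorMk f x) = ε x := fun x => tensorLift_tensorMk f _ x
  let I := LinearMap.range (tensorMap f d₁)
  let Q : ModuleCat.{u} B := ModuleCat.of B (BTensor f P₀ ⧸ I)
  have hIμ : ∀ x, μ (tensorMap f d₁ x) = 0 := by
    have h3 : μ ∘ₗ tensorMap f d₁ = 0 := tensor_hom_ext_unit f fun z => by
      rw [LinearMap.comp_apply, tensorMap_tensorMk, hμ]
      exact hd₁ z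
    exact LinearMap.congr_fun h3
  -- The kernel of `B ⊗ P₀ → B` is the image of `B ⊗ P₁`: maps from `B` to `B`-modules are
  -- `B`-linear, so the quotient map by `I` factors through `μ`.
  have hker : LinearMap.ker μ ≤ I := by
    let q : P₀ →ₗ[A] resModule f Q :=
      resMap f (N := ModuleCat.of B (BTensor f P₀)) (N' := Q) I.mkQ ∘ₗ tensorUnit f P₀
    obtain ⟨q', hq'⟩ := exists_comp_eq_of_ker_le ε hε q (by
      rw [← h1]
      rintro _ ⟨z, rfl⟩
      exact (Submodule.Quotient.mk_eq_zero I).2 ⟨tensorMk f z, tensorMap_tensorMk f d₁ z⟩)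
    have h3 : LinearMap.toSpanSingleton B Q (q' (1 : B)) ∘ₗ μ = I.mkQ := by
      refine tensor_hom_ext_unit f fun x => ?_
      rw [LinearMap.comp_apply, hμ]
      refine (hf.map_smul (M := ModuleCat.of B B) q' (ε x) (1 : B)).symm.trans ?_
      exact (congrArg q' (mul_one (show B from ε x))).trans (hq' x)
    intro x hx
    rw [← Submodule.Quotient.mk_eq_zero, ← Submodule.mkQ_apply, ← h3, LinearMap.comp_apply,
      LinearMap.mem_ker.1 hx, map_zero]
  obtain ⟨p, hp⟩ := hε (1 : B)
  have hp' : μ (tensorMk f p) = 1 := (hμ p).trans hp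
  -- A preimage of `1` splits `μ`, and `ρ` is the resulting projection onto `I`.
  let ρ : BTensor f P₀ →ₗ[B] BTensor f P₀ :=
    LinearMap.id - (LinearMap.toSpanSingleton B _ (tensorMk f p)) ∘ₗ μ
  have hρ : ∀ x, ρ x ∈ I := fun x => hker (by
    change μ (x - μ x • tensorMk f p) = 0
    rw [map_sub, LinearMap.map_smul, hp', smul_eq_mul, mul_one, sub_self])
  let κ₁ : P₁ →ₗ[A] resModule f N := κ ∘ₗ d₁.codRestrict (LinearMap.ker ε) hd₁
  let l : BTensor f P₁ →ₗ[B] N := tensorLift f κ₁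
  have hl : ∀ z, l (tensorMk f z) = κ₁ z := fun z => tensorLift_tensorMk f _ z
  -- Here Tor vanishing enters: the map `l` induced by `κ` on `B ⊗ P₁` kills the image of `B ⊗ P₂`,
  -- so it descends to `I`.
  have hl2 : LinearMap.ker (tensorMap f d₁).rangeRestrict ≤ LinearMap.ker l := by
    rw [LinearMap.ker_rangeRestrict]
    refine hT.trans ?_
    have h3 : l ∘ₗ tensorMap f d₂ = 0 := tensor_hom_ext_unit f fun z => by
      rw [LinearMap.comp_apply, tensorMap_tensorMk, hl]
      change κ ⟨d₁ (d₂ z), _⟩ = 0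
      rw [← map_zero κ]
      exact congrArg κ (Subtype.ext (hd₂ z))
    rintro _ ⟨z, rfl⟩
    exact LinearMap.congr_fun h3 z
  obtain ⟨l', hl'⟩ := exists_comp_eq_of_ker_le (tensorMap f d₁).rangeRestrict
    (tensorMap f d₁).surjective_rangeRestrict l hl2
  refine ⟨resMap f (N := ModuleCat.of B (BTensor f P₀)) (N' := N) (l' ∘ₗ ρ.codRestrict I hρ) ∘ₗ
    tensorUnit f P₀, ?_⟩
  rintro ⟨x, hx⟩
  have hx' := hx
  rw [← h1] at hx'
  obtain ⟨z, rfl⟩ := hx'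
  change l' (ρ.codRestrict I hρ (tensorMk f (d₁ z))) = κ ⟨d₁ z, hx⟩
  have h3 : ρ.codRestrict I hρ (tensorMk f (d₁ z)) =
      (tensorMap f d₁).rangeRestrict (tensorMk f z) := Subtype.ext (by
    change tensorMk f (d₁ z) - μ (tensorMap f d₁ (tensorMk f z)) • tensorMk f p = tensorMk f (d₁ z)
    rw [hIμ, zero_smul, sub_zero])
  rw [h3, hl', hl]
  rfl

/-- If `Tor_1^A(B, B) = 0`, the local modules are closed under extensions. -/
lemma IsRingEpi.isLocalModule_ext (hf : IsRingEpi f) (hT : IsZero (torOne f))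
    {X Y Z : ModuleCat.{u} A} (i : X →ₗ[A] Y) (p : Y →ₗ[A] Z) (hi : Function.Injective i)
    (hp : Function.Surjective p) (hex : LinearMap.range i = LinearMap.ker p)
    (hX : IsLocalModule f X) (hZ : IsLocalModule f Z) : IsLocalModule f Y := by
  obtain ⟨P₂, P₁, P₀, d₂, d₁, ε, hP₀, h2, h1, hε, hT'⟩ := exists_resolution_isZero_torOne f
  obtain ⟨N, ⟨e⟩⟩ := hX.exists_equiv
  rw [isLocalModule_iff] at hX hZ ⊢
  refine ⟨fun φ hφ => ?_, fun y => ?_⟩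
  · have h3 := hZ.1 (p ∘ₗ φ) ((congrArg p hφ).trans (map_zero p))
    obtain ⟨χ, hχ⟩ := exists_comp_eq_of_range_le i hi φ fun b => by
      rw [hex]
      exact LinearMap.congr_fun h3 b
    have h4 := hX.1 χ (hi (((hχ _).trans hφ).trans (map_zero i).symm))
    refine LinearMap.ext fun b => ?_
    rw [← hχ, h4, LinearMap.zero_apply, LinearMap.zero_apply, map_zero]
  -- Lift `ψ ∘ₗ ε` to `g : P₀ → Y`. On `ker ε` it takes values in `X`; extending this part to `P₀`
  -- and subtracting yields a map from `B` whose value at `1` agrees with `y` modulo `X`.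
  · obtain ⟨ψ, hψ⟩ := hZ.2 (p y)
    obtain ⟨g, hg⟩ := Module.projective_lifting_property p (ψ ∘ₗ ε) hp
    obtain ⟨κ, hκ⟩ := exists_comp_eq_of_range_le i hi (g ∘ₗ (LinearMap.ker ε).subtype) fun x => by
      rw [hex, LinearMap.mem_ker, ← LinearMap.comp_apply, ← LinearMap.comp_assoc, hg,
        LinearMap.comp_apply, LinearMap.comp_apply]
      exact (congrArg ψ x.2).trans (map_zero ψ)
    obtain ⟨κ', hκ'⟩ := hf.exists_extension h2 h1 hε (hT'.1 hT) N (e.toLinearMap ∘ₗ κ)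
    obtain ⟨φ, hφ⟩ := exists_comp_eq_of_ker_le ε hε (g - i ∘ₗ e.symm.toLinearMap ∘ₗ κ') (by
      intro x hx
      have h3 : e.symm (κ' x) = κ ⟨x, hx⟩ := (e.symm_apply_eq).2 (hκ' ⟨x, hx⟩)
      rw [LinearMap.mem_ker, LinearMap.sub_apply, LinearMap.comp_apply, LinearMap.comp_apply,
        LinearEquiv.coe_coe, h3, hκ, sub_eq_zero]
      rfl)
    obtain ⟨x₁, hx₁⟩ := hε (1 : B)
    have h4 : p (φ (1 : B)) = p y := by
      rw [← hψ, ← hx₁, hφ, LinearMap.sub_apply, map_sub, ← LinearMap.comp_apply p g, hg]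
      have h5 : ∀ x, p (i x) = 0 := fun x => by
        have h6 : i x ∈ LinearMap.range i := ⟨x, rfl⟩
        rwa [hex] at h6
      rw [LinearMap.comp_apply i, h5, sub_zero, LinearMap.comp_apply]
    have h5 : y - φ (1 : B) ∈ LinearMap.range i := by
      rw [hex, LinearMap.mem_ker, map_sub, sub_eq_zero]
      exact h4.symm
    obtain ⟨x, hx⟩ := h5
    obtain ⟨χ, hχ⟩ := hX.2 x
    refine ⟨φ + i ∘ₗ χ, ?_⟩
    refine (congrArg (φ (1 : B) + i ·) hχ).trans ?_
    rw [hx]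
    exact add_sub_cancel _ _

lemma IsRingEpi.isWide_resImage [IsArtinianRing A] (hf : IsRingEpi f) (hS : IsSerialRing A)
    (hT : IsZero (torOne f)) : IsWide (resImage f) := by
  have hB := hf.finite hS
  have hfg : ∀ X, resImage f X → Module.Finite A X := by
    rintro X ⟨N, hN, ⟨e⟩⟩
    have := finite_resModule hB N hN
    exact Module.Finite.equiv e.symm.toLinearEquiv
  have hloc : ∀ {X}, resImage f X → IsLocalModule f X := fun h => hf.isLocalModule_of_resImage h
  refine IsWide.of_linear hfg (fun e h => ?_) ?_ (fun {X Y} g hX hY => ?_)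
    (fun {X Y} g hX hY => ?_) fun {X Y Z} i p hi hp hex hX hZ => ?_
  · obtain ⟨N, hN, ⟨e'⟩⟩ := h
    exact ⟨N, hN, ⟨e.symm.toModuleIso ≪≫ e'⟩⟩
  · refine IsLocalModule.resImage (isLocalModule_iff.2 ?_)
      (inferInstanceAs (Module.Finite A PUnit.{u + 1}))
    exact ⟨fun φ _ => LinearMap.ext fun _ => rfl, fun ψ => ⟨0, rfl⟩⟩
  · have := hfg X hX
    refine IsLocalModule.resImage ?_ (inferInstanceAs (Module.Finite A (LinearMap.ker g)))
    exact HomIso.ker (Z := ModuleCat.of A (LinearMap.ker g)) (hloc hX) (hloc hY)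
        (LinearMap.ker g).subtype g Subtype.val_injective (Submodule.range_subtype _)
  -- By fullness `g` is `B`-linear up to the identifications, so its cokernel is a `B`-module.
  · obtain ⟨M, hM, ⟨eM⟩⟩ := hX
    obtain ⟨N, hN, ⟨eN⟩⟩ := hY
    let g' : resModule f M →ₗ[A] resModule f N :=
      eN.toLinearEquiv.toLinearMap ∘ₗ g ∘ₗ eM.toLinearEquiv.symm.toLinearMap
    let k : M →ₗ[B] N :=
      { toFun := fun x => g' x
        map_add' := fun x y => g'.map_add x y
        map_smul' := fun b x => hf.map_smul g' b x }
    let q : Y →ₗ[A] resModule f (ModuleCat.of B (N ⧸ LinearMap.range k)) :=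
      resMap f (N' := ModuleCat.of B (N ⧸ LinearMap.range k)) (LinearMap.range k).mkQ ∘ₗ
        eN.toLinearEquiv.toLinearMap
    have hq : Function.Surjective q :=
      (Submodule.mkQ_surjective (LinearMap.range k)).comp eN.toLinearEquiv.surjective
    have hker : LinearMap.ker q = LinearMap.range g := by
      ext y
      have h1 : y ∈ LinearMap.ker q ↔ (eN.toLinearEquiv y : N) ∈ LinearMap.range k :=
        Submodule.Quotient.mk_eq_zero _
      rw [h1]
      constructor
      · rintro ⟨x, hx⟩
        exact ⟨eM.toLinearEquiv.symm x, eN.toLinearEquiv.injective hx⟩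
      · rintro ⟨x, rfl⟩
        refine ⟨eM.toLinearEquiv x, ?_⟩
        change eN.toLinearEquiv (g (eM.toLinearEquiv.symm (eM.toLinearEquiv x))) = _
        rw [LinearEquiv.symm_apply_apply]
    refine ⟨ModuleCat.of B (N ⧸ LinearMap.range k),
      inferInstanceAs (Module.Finite B (N ⧸ LinearMap.range k)), ⟨LinearEquiv.toModuleIso ?_⟩⟩
    exact (Submodule.quotEquivOfEq _ _ hker.symm).trans (q.quotKerEquivOfSurjective hq)
  · have := hfg X hX
    have := hfg Z hZ
    exact (hf.isLocalModule_ext hT i p hi hp hex (hloc hX) (hloc hZ)).resImage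
      (Module.Finite.of_exact (LinearMap.exact_iff.2 hex.symm) hp)

variable (K : Type v) [Field K] [Algebra K A] [FiniteDimensional K A] [IsArtinianRing A]

include K in
-- `Y` may be infinitely generated, as are the modules arising from an arbitrary projective
-- resolution of `B`.
lemma IsUniversalLocalisationAt.isLocalModule (hS : IsSerialRing A)
    {S : MorphismProperty (ModuleCat.{u} A)} (hf : IsUniversalLocalisationAt S f)
    (Y : ModuleCat.{u} A) (hY : ∀ ⦃P Q : ModuleCat.{u} A⦄ (σ : P ⟶ Q), S σ → HomIso σ Y) :
    IsLocalModule f Y := by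
  refine hS.isLocalModule Y fun X X' hc hX => hf.isRingEpi.isLocalModule_of_resImage ?_
  rw [hf.resImage_eq K hS]
  exact ⟨Module.Finite.iff_fg.2 hX, fun P Q σ hσ => (hY σ hσ).summand hc⟩

include K in
lemma IsUniversalLocalisationAt.exists_extension (hS : IsSerialRing A)
    {S : MorphismProperty (ModuleCat.{u} A)} (hf : IsUniversalLocalisationAt S f)
    {P : ModuleCat.{u} A} {ε : P →ₗ[A] resModule f (ModuleCat.of B B)}
    (hε : Function.Surjective ε) (N : ModuleCat.{u} B)
    (κ : LinearMap.ker ε →ₗ[A] resModule f N) :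
    ∃ κ' : P →ₗ[A] resModule f N, ∀ x : LinearMap.ker ε, κ' x = κ x := by
  -- the pushout of `0 → ker ε → P → B → 0` along `κ` splits
  let W : Submodule A (resModule f N × P) :=
    LinearMap.range (κ.prod (-(LinearMap.ker ε).subtype))
  let Y : ModuleCat.{u} A := ModuleCat.of A ((resModule f N × P) ⧸ W)
  let i : resModule f N →ₗ[A] Y := W.mkQ ∘ₗ LinearMap.inl A _ _
  let t : P →ₗ[A] Y := W.mkQ ∘ₗ LinearMap.inr A _ _
  let p : Y →ₗ[A] resModule f (ModuleCat.of B B) := W.liftQ (ε ∘ₗ LinearMap.snd A _ _) (by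
    rintro _ ⟨x, rfl⟩
    change ε (-(x : P)) = 0
    rw [map_neg, LinearMap.mem_ker.1 x.2, neg_zero])
  have hpt : ∀ x, p (t x) = ε x := fun x => rfl
  have hpi : ∀ x, p (i x) = 0 := fun x => map_zero ε
  have hit : ∀ x : LinearMap.ker ε, t x = i (κ x) := fun x => by
    refine ((Submodule.Quotient.eq W).2 ⟨-x, ?_⟩)
    refine Prod.ext ?_ ?_
    · change κ (-x) = 0 - κ x
      rw [map_neg, zero_sub]
    · change -((-x : LinearMap.ker ε) : P) = x - 0
      simp
  have hi : Function.Injective i := by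
    rw [← LinearMap.ker_eq_bot, eq_bot_iff]
    intro n hn
    obtain ⟨x, hx⟩ := (Submodule.Quotient.mk_eq_zero W).1 hn
    have h1 : κ x = n := congrArg Prod.fst hx
    have h2 : -(x : P) = 0 := congrArg Prod.snd hx
    obtain rfl : x = 0 := Subtype.ext (neg_eq_zero.1 h2)
    rw [← h1, map_zero]
    exact Submodule.zero_mem _
  have hp : Function.Surjective p := fun b => by
    obtain ⟨x, rfl⟩ := hε b
    exact ⟨t x, rfl⟩
  have hex : LinearMap.range i = LinearMap.ker p := by
    refine le_antisymm ?_ fun y hy => ?_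
    · rintro _ ⟨x, rfl⟩
      exact hpi x
    · obtain ⟨⟨n, x⟩, rfl⟩ := W.mkQ_surjective y
      have hx : ε x = 0 := hy
      refine ⟨n + κ ⟨x, hx⟩, ?_⟩
      rw [map_add, ← hit]
      change W.mkQ (n, 0) + W.mkQ (0, x) = W.mkQ (n, x)
      rw [← map_add]
      simp
  -- `Y` is an extension of modules that invert `S`, so it inverts `S` and is local; a preimage of
  -- `1` then defines a section of `p`.
  have hY := isLocalModule_iff.1 (hf.isLocalModule K hS Y fun P Q σ hσ =>
    HomIso.ext (hf.fgProjective σ hσ).2.2 (homIso_of_isIso f σ (hf.inverts σ hσ) N)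
      (homIso_of_isIso f σ (hf.inverts σ hσ) (ModuleCat.of B B)) i p hi hp hex)
  obtain ⟨y, hy⟩ := hp (1 : B)
  obtain ⟨φ, hφ⟩ := hY.2 y
  have hpφ : ∀ b, p (φ b) = b := fun b => by
    have h1 := (isLocalModule_iff.1 (hf.isRingEpi.isLocalModule (ModuleCat.of B B))).1
      (p ∘ₗ φ - LinearMap.id) (sub_eq_zero.2 ((congrArg p hφ).trans hy))
    exact LinearMap.congr_fun (sub_eq_zero.1 h1) b
  obtain ⟨κ', hκ'⟩ := exists_comp_eq_of_range_le i hi (t - φ ∘ₗ ε) fun x => by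
    rw [hex, LinearMap.mem_ker, LinearMap.sub_apply, map_sub, LinearMap.comp_apply φ, hpφ, hpt,
      sub_self]
  refine ⟨κ', fun x => hi ?_⟩
  rw [hκ', LinearMap.sub_apply, LinearMap.comp_apply φ, LinearMap.mem_ker.1 x.2, map_zero, sub_zero,
    hit]

include K in
/-- Universal localisations are homological in degree one. -/
lemma IsUniversalLocalisationAt.isZero_torOne (hS : IsSerialRing A)
    {S : MorphismProperty (ModuleCat.{u} A)} (hf : IsUniversalLocalisationAt S f) :
    IsZero (torOne f) := by
  obtain ⟨P₂, P₁, P₀, d₂, d₁, ε, -, h2, h1, hε, hT⟩ := exists_resolution_isZero_torOne f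
  refine hT.2 ?_
  have hd₁ : ∀ z, d₁ z ∈ LinearMap.ker ε := fun z => h1 ▸ ⟨z, rfl⟩
  -- The quotient map of `B ⊗ P₁` by `I` comes from a map on the syzygy `ker ε`. Its extension to
  -- `P₀` makes it factor through `B ⊗ d₁`, so `ker (B ⊗ d₁) ≤ I`.
  let I := LinearMap.range (tensorMap f d₂)
  let N : ModuleCat.{u} B := ModuleCat.of B (BTensor f P₁ ⧸ I)
  let q : P₁ →ₗ[A] resModule f N :=
    resMap f (N := ModuleCat.of B (BTensor f P₁)) (N' := N) I.mkQ ∘ₗ tensorUnit f P₁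
  obtain ⟨κ, hκ⟩ := exists_comp_eq_of_ker_le (d₁.codRestrict (LinearMap.ker ε) hd₁) (by
    rintro ⟨x, hx⟩
    have hx' := hx
    rw [← h1] at hx'
    obtain ⟨z, rfl⟩ := hx'
    exact ⟨z, rfl⟩) q (by
    rw [LinearMap.ker_codRestrict, ← h2]
    rintro _ ⟨z, rfl⟩
    exact (Submodule.Quotient.mk_eq_zero I).2 ⟨tensorMk f z, tensorMap_tensorMk f d₂ z⟩)
  obtain ⟨κ', hκ'⟩ := hf.exists_extension K hS hε N κ
  have h3 : tensorLift f κ' ∘ₗ tensorMap f d₁ = I.mkQ := tensor_hom_ext_unit f fun z => by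
    rw [LinearMap.comp_apply, tensorMap_tensorMk, tensorLift_tensorMk]
    exact (hκ' ⟨d₁ z, hd₁ z⟩).trans (hκ z)
  intro x hx
  rw [← Submodule.Quotient.mk_eq_zero, ← Submodule.mkQ_apply]
  refine (LinearMap.congr_fun h3 x).symm.trans ?_
  rw [LinearMap.comp_apply, LinearMap.mem_ker.1 hx, map_zero]

end Tor

/-! ### The correspondence -/

noncomputable section Correspondence

variable {A : Type u} [Ring A]

lemma resImage_eq_of_ringEquiv {B B' : Type u} [Ring B] [Ring B'] {f : A →+* B} (h : B ≃+* B') :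
    resImage f = resImage ((h : B →+* B').comp f) := by
  have key : ∀ {B B' : Type u} [Ring B] [Ring B'] (f : A →+* B) (h : B ≃+* B'),
      resImage ((h : B →+* B').comp f) ≤ resImage f := by
    rintro B B' _ _ f h Y ⟨N, hN, ⟨e⟩⟩
    refine ⟨resModule (h : B →+* B') N, ?_, ⟨e⟩⟩
    exact finite_resModule (Module.Finite.of_surjective
      (P := resModule (h : B →+* B') (ModuleCat.of B' B')) (unitHom (h : B →+* B')).hom fun b =>
        ⟨h.symm (show B' from b), by
          change h (h.symm (show B' from b)) * 1 = _
          rw [mul_one, RingEquiv.apply_symm_apply]⟩) N hN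
  refine le_antisymm ?_ (key f h)
  have h1 := key ((h : B →+* B').comp f) h.symm
  have h2 : (h.symm : B' →+* B).comp ((h : B →+* B').comp f) = f := by
    ext a
    simp
  rwa [h2] at h1

variable (K : Type v) [Field K] [Algebra K A] [FiniteDimensional K A] [IsArtinianRing A]

include K in
lemma IsUniversalLocalisation.isWide_resImage (hS : IsSerialRing A) {B : Type u} [Ring B]
    {f : A →+* B} (hf : IsUniversalLocalisation f) : IsWide (resImage f) := by
  obtain ⟨S, hS'⟩ := hf
  rw [hS'.resImage_eq K hS]
  exact isWide_mapStar hS'.fgProjective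

include K in
lemma IsUniversalLocalisation.isUniversalLocalisationAt_leftStar (hS : IsSerialRing A) {B : Type u}
    [Ring B] {f : A →+* B} (hf : IsUniversalLocalisation f) :
    IsUniversalLocalisationAt (minimalPresentations (leftStar (resImage f))) f := by
  refine isUniversalLocalisationAt_of_isWide K hS (hf.isWide_resImage K hS) fun Y hY => ?_
  obtain ⟨S, hS'⟩ := hf
  exact hS'.isRingEpi.isLocalModule_of_resImage hY

/-- The map from epiclasses of universal localisations to wide subcategories. -/
def uniLocToWide (hS : IsSerialRing A) : UniLoc A → Wide A :=
  Quotient.lift (fun L => ⟨resImage L.hom, L.isUniversalLocalisation.isWide_resImage K hS⟩) (by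
    rintro L L' ⟨h, hh⟩
    refine Subtype.ext ?_
    change resImage L.hom = resImage L'.hom
    rw [← hh]
    exact resImage_eq_of_ringEquiv h)

/-- Each localisation is the one at the minimal presentations of `*X_B`, a class that depends only
on `X_B`. -/
lemma uniLocToWide_injective (hS : IsSerialRing A) : Function.Injective (uniLocToWide K hS) := by
  refine Quotient.ind₂ fun L L' h => Quotient.sound ?_
  have h1 : resImage L.hom = resImage L'.hom := congrArg Subtype.val h
  have h2 := L.isUniversalLocalisation.isUniversalLocalisationAt_leftStar K hS
  have h3 := L'.isUniversalLocalisation.isUniversalLocalisationAt_leftStar K hS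
  rw [← h1] at h3
  exact h2.exists_ringEquiv h3

lemma uniLocToWide_surjective (hS : IsSerialRing A) : Function.Surjective (uniLocToWide K hS) := by
  rintro ⟨C, hC⟩
  obtain ⟨B, _, f, rfl, hl⟩ := hC.exists_resImage_eq K hS
  exact ⟨UniversalLocalisation.epiclass
    ⟨B, f, _, isUniversalLocalisationAt_of_isWide K hS hC hl⟩, rfl⟩

lemma uniLocToWide_epiclass_eq_iff (hS : IsSerialRing A) (C : Wide A)
    (L : UniversalLocalisation A) : uniLocToWide K hS L.epiclass = C ↔
      IsUniversalLocalisationAt (minimalPresentations (leftStar C.1)) L.hom := by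
  constructor
  · rintro rfl
    exact L.isUniversalLocalisation.isUniversalLocalisationAt_leftStar K hS
  · intro h
    refine Subtype.ext ?_
    calc resImage L.hom = rightStar (leftStar C.1) := h.resImage_eq K hS
      _ = C.1 := C.2.rightStar_leftStar K hS

end Correspondence

theorem corollary5p9 {K : Type v} [Field K] [IsAlgClosed K] {A : Type u} [Ring A] [Algebra K A]
    [FiniteDimensional K A] (hA : IsNakayama A) :
    -- the bijection `ω`, given by `A_S ↦ X_{A_S}`, with inverse `C ↦ A_{*C}`
    (∃ ω : UniLoc A ≃ Wide A,
      (∀ L : UniversalLocalisation A, (ω L.epiclass).1 = resImage L.hom) ∧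
      (∀ (C : Wide A) (L : UniversalLocalisation A), ω.symm C = L.epiclass ↔
        IsUniversalLocalisationAt (minimalPresentations (leftStar C.1)) L.hom)) ∧
    -- `X_{A_S} = S*`, for localisations at a class `S` of maps or at a class `U` of modules
    (∀ (B : Type u) [Ring B] (f : A →+* B),
      (∀ S : MorphismProperty (ModuleCat.{u} A), IsUniversalLocalisationAt S f →
        resImage f = mapStar S) ∧
      (∀ U : ObjectProperty (ModuleCat.{u} A), U ≤ ModuleCat.isFG.{u} A →
        IsUniversalLocalisationAt (minimalPresentations U) f → resImage f = rightStar U)) ∧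
    -- ring epimorphisms that are universal localisations
    (∀ (B : Type u) [Ring B] (f : A →+* B), IsRingEpi f →
      (IsUniversalLocalisation f ↔ IsZero (torOne f))) := by
  have : IsArtinianRing A := isArtinian_of_tower K inferInstance
  have hS : IsSerialRing A := hA.isSerialRing K
  refine ⟨⟨Equiv.ofBijective (uniLocToWide K hS)
      ⟨uniLocToWide_injective K hS, uniLocToWide_surjective K hS⟩, fun L => rfl, fun C L => ?_⟩,
    fun B _ f => ⟨fun S h => h.resImage_eq K hS, fun U _ h => h.resImage_eq K hS⟩,
    fun B _ f hf => ⟨fun ⟨S, h⟩ => h.isZero_torOne K hS, fun hT =>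
      ⟨_, isUniversalLocalisationAt_of_isWide K hS (hf.isWide_resImage hS hT)
        fun Y hY => hf.isLocalModule_of_resImage hY⟩⟩⟩
  rw [← uniLocToWide_epiclass_eq_iff K hS, Equiv.symm_apply_eq, eq_comm]
  rfl
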